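/- Let $Sym=\mathbb{Q}[p_1,p_2,\dots]$ be the ring of symmetric functions, and for a partition $\mu=(\mu_1,\dots,\mu_\ell)$ let $h_\mu=\prod_i h_{\mu_i}$ and $e_\mu=\prod_i e_{\mu_i}$, where $h_n=\sum_{\gamma\vdash n}p_\gamma/z_\gamma$ and $e_n=\sum_{\gamma\vdash n}(-1)^{n+\ell(\gamma)}p_\gamma/z_\gamma$ are the complete homogeneous and elementary symmetric functions. The induced trivial character basis $\{\tilde h_\mu\}$ is defined recursively by $$h_\mu=\sum_{\pi}\tilde h_{\tilde m(\pi)},$$ summed over all multisets $\pi$ of non-empty multisets whose multiset union is $\{\!\{1^{\mu_1},2^{\mu_2},\dots,\ell^{\mu_\ell}\}\!\}$, where $\tilde m(\pi)$ is the partition formed by the multiplicities of the distinct elements of $\pi$. The irreducible character basis $\{\tilde s_\lambda\}$ is defined by $$\tilde h_\mu=\sum_{|\lambda|\le|\mu|}K_{(n-|\lambda|,\lambda),(n-|\mu|,\mu)}\,\tilde s_\lambda,\qquad n=2|\mu|,$$ where $K_{\alpha\beta}$ is the Kostka number, the number of column strict tableaux of shape $\alpha$ and content $\beta$. For a partition $\lambda=(\lambda_1,\lambda_2,\dots)$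 write $\overline\lambda=(\lambda_2,\lambda_3,\dots)$. **Theorem.** Fix any total order on the finite sets of positive integers. For every partition $\mu=(\mu_1,\dots,\mu_\ell)$, $$e_\mu=\sum_T\tilde s_{\overline{\mathrm{shape}(T)}},$$ where the sum is over the (finitely many) tableaux $T$ of skew shape $\lambda/(\lambda_2)$, for some partition $\lambda=\mathrm{shape}(T)$ (with $\lambda_2=0$ if $\lambda$ has fewer than two parts), whose cells are filled with non-empty finite sets of positive integers (no repeated elements inside a set) such that * the entries increase weakly along rows (from left to right) and along columns (away from the first row); * the total content, i.e. the multiset union of all entries, is $\{\!\{1^{\mu_1},2^{\mu_2},\dots,\ell^{\mu_\ell}\}\!\}$; * a set may appear more than once in the same column if and only if it has an odd number of elements, and may appear more than once in the same row if and only if it has an even number of elements. -/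

import Mathlib

namespace SymChar

open Finset

/-! ### The ring of symmetric functions

Partitions are Mathlib's `YoungDiagram`s: `μ.rowLen i` is the part `μ_{i+1}` (and `0` beyond the
length), `μ.colLen 0` is the length `ℓ(μ)`, `μ.rowLens` is the list of parts, `μ.card` the size. -/

/-- `Sym = ℚ[p₁, p₂, p₃, …]`, the polynomial ring on the power sum generators. -/
abbrev SymFun : Type := MvPolynomial ℕ+ ℚ

/-- The power sum generator `p_k`; only used for `k ≥ 1`. -/
noncomputable def powerSum (k : ℕ) : SymFun := MvPolynomial.X k.toPNat'

/-- `p_γ = p_{γ₁} p_{γ₂} ⋯`. -/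
noncomputable def powerSumPart {n : ℕ} (γ : n.Partition) : SymFun :=
  (γ.parts.map powerSum).prod

/-- `z_γ = ∏ᵢ i ^ {mᵢ(γ)} mᵢ(γ)!`. -/
def zee {n : ℕ} (γ : n.Partition) : ℕ :=
  ∏ i ∈ γ.parts.toFinset, i ^ γ.parts.count i * (γ.parts.count i).factorial

/-- The complete homogeneous symmetric function `h_n = ∑_{γ ⊢ n} p_γ / z_γ`. -/
noncomputable def complete (n : ℕ) : SymFun :=
  ∑ γ : n.Partition, ((zee γ : ℚ)⁻¹) • powerSumPart γ

/-- The elementary symmetric function `e_n = ∑_{γ ⊢ n} (-1) ^ (n + ℓ(γ)) p_γ / z_γ`. -/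
noncomputable def elementary (n : ℕ) : SymFun :=
  ∑ γ : n.Partition, ((-1) ^ (n + γ.parts.card) * (zee γ : ℚ)⁻¹) • powerSumPart γ

/-- `h_μ = h_{μ₁} h_{μ₂} ⋯ h_{μ_ℓ}`. -/
noncomputable def completePart (μ : YoungDiagram) : SymFun := (μ.rowLens.map complete).prod

/-- `e_μ = e_{μ₁} e_{μ₂} ⋯ e_{μ_ℓ}`. -/
noncomputable def elementaryPart (μ : YoungDiagram) : SymFun := (μ.rowLens.map elementary).prod

/-! ### Multiset partitions and the induced trivial character basis -/

/-- The multiset `{{1^{μ₁}, 2^{μ₂}, …, ℓ^{μ_ℓ}}}`. -/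
def content (μ : YoungDiagram) : Multiset ℕ :=
  ∑ i ∈ range (μ.colLen 0), Multiset.replicate (μ.rowLen i) (i + 1)

/-- `π` is a multiset of non-empty multisets whose multiset union is `S`. -/
def IsMultisetPartition (π : Multiset (Multiset ℕ)) (S : Multiset ℕ) : Prop :=
  0 ∉ π ∧ π.sum = S

/-- The partition `m̃(π)` whose parts are the multiplicities of the distinct blocks of `π`. -/
def mTilde (π : Multiset (Multiset ℕ)) : YoungDiagram :=
  YoungDiagram.ofRowLens ((π.dedup.map fun B => π.count B).sort (· ≥ ·))
    (List.sortedGE_iff_pairwise.2 (Multiset.pairwise_sort _ _))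

theorem sum_cellsOfRowLens_cons (f : ℕ × ℕ → ℕ) (a : ℕ) (w : List ℕ) :
    ∑ c ∈ YoungDiagram.cellsOfRowLens (a :: w), f c =
      ∑ j ∈ range a, f (0, j) + ∑ c ∈ YoungDiagram.cellsOfRowLens w, f (c.1 + 1, c.2) := by
  rw [YoungDiagram.cellsOfRowLens, Finset.sum_union, Finset.sum_product, Finset.sum_map]
  · simp only [Finset.sum_singleton]
    rfl
  · rw [Finset.disjoint_left]
    rintro ⟨i, j⟩ h1 h2
    simp at h1 h2
    omega

theorem card_cellsOfRowLens (w : List ℕ) : (YoungDiagram.cellsOfRowLens w).card = w.sum := by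
  induction w with
  | nil => rfl
  | cons a w ih =>
    rw [Finset.card_eq_sum_ones, sum_cellsOfRowLens_cons, ← Finset.card_eq_sum_ones,
      ← Finset.card_eq_sum_ones, ih]
    simp

theorem sum_rowLens (μ : YoungDiagram) : μ.rowLens.sum = μ.card := by
  conv_rhs => rw [← YoungDiagram.ofRowLens_to_rowLens_eq_self (μ := μ)]
  exact (card_cellsOfRowLens _).symm

theorem rowLen_pos_iff (μ : YoungDiagram) (k : ℕ) : 0 < μ.rowLen k ↔ k < μ.colLen 0 := by
  rw [← YoungDiagram.mem_iff_lt_rowLen, ← YoungDiagram.mem_iff_lt_colLen]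

theorem count_content (μ : YoungDiagram) (k : ℕ) : (content μ).count (k + 1) = μ.rowLen k := by
  rw [content, Multiset.count_sum']
  simp only [Multiset.count_replicate, add_left_inj]
  rw [Finset.sum_ite_eq' (range (μ.colLen 0)) k]
  have := rowLen_pos_iff μ k
  split_ifs with h <;> simp at h <;> omega

theorem card_content (μ : YoungDiagram) : (content μ).card = μ.card := by
  rw [content, Multiset.card_sum, ← sum_rowLens, YoungDiagram.rowLens]
  simp only [Multiset.card_replicate]
  rfl

theorem card_mTilde (π : Multiset (Multiset ℕ)) : (mTilde π).card = π.card := by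
  have h : (mTilde π).card = ((π.dedup.map fun B => π.count B).sort (· ≥ ·)).sum :=
    card_cellsOfRowLens _
  rw [h, ← Multiset.sum_coe, Multiset.sort_eq]
  exact Multiset.toFinset_sum_count_eq π

/-- A multiset partition of `S` has at most `|S|` blocks, with equality only for singletons. -/
theorem card_le_of_isMultisetPartition {π : Multiset (Multiset ℕ)} {S : Multiset ℕ}
    (h : IsMultisetPartition π S) :
    π.card ≤ S.card ∧ (π.card = S.card → π = S.map fun a => {a}) := by
  obtain ⟨h0, rfl⟩ := h
  induction π using Multiset.induction with
  | empty => simp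
  | cons B π ih =>
    rw [Multiset.mem_cons, not_or] at h0
    obtain ⟨ih1, ih2⟩ := ih h0.2
    have hB : 0 < B.card := Multiset.card_pos.2 (Ne.symm h0.1)
    simp only [Multiset.card_cons, Multiset.sum_cons, Multiset.card_add]
    refine ⟨by omega, fun h => ?_⟩
    obtain ⟨a, rfl⟩ := Multiset.card_eq_one.1 (show B.card = 1 by omega)
    rw [Multiset.map_add, ← ih2 (by omega)]
    simp

theorem mTilde_singletons (μ : YoungDiagram) :
    mTilde ((content μ).map fun a => {a}) = μ := by
  have h1 : (content μ).dedup = (Multiset.range (μ.colLen 0)).map (· + 1) := by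
    rw [Multiset.Nodup.ext (Multiset.nodup_dedup _)
      ((Multiset.nodup_range _).map (add_left_injective 1))]
    intro a
    rw [Multiset.mem_dedup]
    simp only [content, Multiset.mem_sum, Multiset.mem_map, Finset.mem_range, Multiset.mem_range,
      Multiset.mem_replicate]
    constructor
    · rintro ⟨i, hi, -, rfl⟩
      exact ⟨i, hi, rfl⟩
    · rintro ⟨i, hi, rfl⟩
      exact ⟨i, hi, ((rowLen_pos_iff μ i).2 hi).ne', rfl⟩
  have h2 : (((content μ).map fun a => ({a} : Multiset ℕ)).dedup.map fun B =>
      ((content μ).map fun a => ({a} : Multiset ℕ)).count B) = (μ.rowLens : Multiset ℕ) := by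
    have hinj : Function.Injective fun a : ℕ => ({a} : Multiset ℕ) :=
      fun a b h => Multiset.singleton_inj.1 h
    rw [Multiset.dedup_map_of_injective hinj, h1, Multiset.map_map, Multiset.map_map]
    simp only [YoungDiagram.rowLens, Multiset.range, Multiset.map_coe]
    congr 1
    refine List.map_congr_left fun i _ => ?_
    rw [← count_content]
    exact Multiset.count_map_eq_count' _ _ hinj _
  have h3 : (((content μ).map fun a => ({a} : Multiset ℕ)).dedup.map fun B =>
      ((content μ).map fun a => ({a} : Multiset ℕ)).count B).sort (· ≥ ·) = μ.rowLens := by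
    rw [h2]
    refine List.Perm.eq_of_pairwise' (r := (· ≥ ·)) (Multiset.pairwise_sort _ _)
      (List.sortedGE_iff_pairwise.1 μ.rowLens_sorted) ?_
    rw [← Multiset.coe_eq_coe, Multiset.sort_eq]
  conv_rhs => rw [← YoungDiagram.ofRowLens_to_rowLens_eq_self (μ := μ)]
  unfold mTilde
  congr 1

theorem card_mTilde_lt {π : Multiset (Multiset ℕ)} {μ : YoungDiagram}
    (h : IsMultisetPartition π (content μ)) (hne : mTilde π ≠ μ) : (mTilde π).card < μ.card := by
  obtain ⟨h1, h2⟩ := card_le_of_isMultisetPartition h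
  rw [card_content] at h1 h2
  rw [card_mTilde]
  refine lt_of_le_of_ne h1 fun heq => hne ?_
  rw [h2 heq, mTilde_singletons]

theorem finite_multisetPartitions (S : Multiset ℕ) : {π | IsMultisetPartition π S}.Finite := by
  refine (Set.finite_Iic (S.card • S.powerset)).subset fun π hπ => ?_
  rw [Set.mem_Iic, Multiset.le_iff_count]
  intro B
  by_cases hB : B ∈ π
  · have h1 : 1 ≤ S.powerset.count B := by
      rw [Multiset.one_le_count_iff_mem, Multiset.mem_powerset, ← hπ.2]
      exact Multiset.single_le_sum (fun _ _ => Multiset.zero_le _) _ hB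
    rw [Multiset.count_nsmul]
    calc π.count B ≤ π.card := Multiset.count_le_card _ _
      _ ≤ S.card := (card_le_of_isMultisetPartition hπ).1
      _ ≤ S.card * S.powerset.count B := Nat.le_mul_of_pos_right _ h1
  · rw [Multiset.count_eq_zero_of_notMem hB]
    exact Nat.zero_le _

/-- The induced trivial character basis, by the recursion
`h̃_μ = h_μ - ∑ h̃_{m̃(π)}` over the multiset partitions `π` of `{{1^{μ₁}, …, ℓ^{μ_ℓ}}}`
with `m̃(π) ≠ μ`. -/
noncomputable def hTilde (μ : YoungDiagram) : SymFun :=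
  completePart μ -
    ∑ᶠ π : {π // IsMultisetPartition π (content μ) ∧ mTilde π ≠ μ}, hTilde (mTilde π.1)
termination_by μ.card
decreasing_by exact card_mTilde_lt π.2.1 π.2.2

/-- The relation characterising `h̃`. -/
theorem completePart_eq_sum_hTilde (μ : YoungDiagram) :
    completePart μ = ∑ᶠ π : {π // IsMultisetPartition π (content μ)}, hTilde (mTilde π.1) := by
  set π₀ := (content μ).map fun a => ({a} : Multiset ℕ) with hπ₀
  have h0 : IsMultisetPartition π₀ (content μ) := by
    refine ⟨fun h => ?_, Multiset.sum_map_singleton _⟩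
    obtain ⟨a, -, ha⟩ := Multiset.mem_map.1 h
    exact Multiset.singleton_ne_zero a ha
  have hset : {π | IsMultisetPartition π (content μ)} =
      insert π₀ {π | IsMultisetPartition π (content μ) ∧ mTilde π ≠ μ} := by
    ext π
    simp only [Set.mem_ofPred_eq, Set.mem_insert_iff]
    constructor
    · intro h
      by_cases hm : mTilde π = μ
      · refine Or.inl ((card_le_of_isMultisetPartition h).2 ?_)
        rw [← card_mTilde, hm, card_content]
      · exact Or.inr ⟨h, hm⟩
    · rintro (rfl | h)
      exacts [h0, h.1]
  have h1 := finsum_set_coe_eq_finsum_mem (f := fun π => hTilde (mTilde π))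
    {π | IsMultisetPartition π (content μ)}
  have h2 := finsum_set_coe_eq_finsum_mem (f := fun π => hTilde (mTilde π))
    {π | IsMultisetPartition π (content μ) ∧ mTilde π ≠ μ}
  rw [hset, finsum_mem_insert _ (fun h => h.2 (mTilde_singletons μ))
    ((finite_multisetPartitions (content μ)).subset fun _ h => h.1), ← hset, ← h2,
    mTilde_singletons] at h1
  refine Eq.trans ?_ h1.symm
  rw [hTilde]
  exact (sub_add_cancel _ _).symm

/-! ### Kostka numbers and the irreducible character basis -/

/-- The Kostka number `K_{λ μ}`: the number of column strict tableaux of shape `λ` and content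
`μ`. Mathlib's tableaux have entries in `ℕ`, so the label `k` plays the role of `k + 1`. -/
noncomputable def kostka (lam μ : YoungDiagram) : ℕ :=
  Nat.card {T : SemistandardYoungTableau lam //
    ∀ k, (lam.cells.filter fun c => T c.1 c.2 = k).card = μ.rowLen k}

open Classical in
/-- The partition `(n - |ν|, ν)`; only used when `ν₁ ≤ n - |ν|` (the empty partition otherwise). -/
noncomputable def padPart (n : ℕ) (ν : YoungDiagram) : YoungDiagram :=
  if h : ((n - ν.card) :: ν.rowLens).SortedGE then YoungDiagram.ofRowLens _ h else ⊥

/-- `K_{(n - |ν|, ν), (n - |μ|, μ)}` with `n = 2|μ|`. -/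
noncomputable def paddedKostka (ν μ : YoungDiagram) : ℕ :=
  kostka (padPart (2 * μ.card) ν) (padPart (2 * μ.card) μ)

/-- The statistic `∑ᵢ i ν_i`, along which Kostka matrices are triangular. -/
def rowWeight (ν : YoungDiagram) : ℕ := ∑ c ∈ ν.cells, (c.1 + 1)

theorem sum_fst_le {α β : YoungDiagram} (T : SemistandardYoungTableau α)
    (hT : ∀ k, (α.cells.filter fun c => T c.1 c.2 = k).card = β.rowLen k) :
    ∑ c ∈ α.cells, c.1 ≤ ∑ c ∈ β.cells, c.1 ∧
      (∑ c ∈ α.cells, c.1 = ∑ c ∈ β.cells, c.1 →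
        α = β ∧ T = SemistandardYoungTableau.highestWeight α) := by
  have hrow (γ : YoungDiagram) (k : ℕ) : (γ.cells.filter fun c => c.1 = k).card = γ.rowLen k :=
    (γ.rowLen_eq_card).symm
  have hms : α.cells.val.map (fun c => T c.1 c.2) = β.cells.val.map fun c => c.1 := by
    ext k
    rw [Multiset.count_map, Multiset.count_map]
    have h1 := hT k
    rw [← hrow β k] at h1
    simpa [Finset.card, Finset.filter, eq_comm] using h1
  have hsum : ∑ c ∈ α.cells, T c.1 c.2 = ∑ c ∈ β.cells, c.1 := congrArg Multiset.sum hms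
  have hle : ∀ i j, (i, j) ∈ α → i ≤ T i j := by
    intro i
    induction i with
    | zero => exact fun _ _ => Nat.zero_le _
    | succ i ih =>
      intro j hj
      exact (ih j (α.up_left_mem (Nat.le_succ i) le_rfl hj)).trans_lt
        (T.col_strict (Nat.lt_succ_self i) hj)
  have hle' : ∀ c ∈ α.cells, c.1 ≤ T c.1 c.2 := fun c hc => hle c.1 c.2 hc
  rw [← hsum]
  refine ⟨Finset.sum_le_sum hle', fun h => ?_⟩
  have heq := (Finset.sum_eq_sum_iff_of_le hle').1 h
  constructor
  · ext ⟨i, j⟩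
    rw [YoungDiagram.mem_cells, YoungDiagram.mem_cells, YoungDiagram.mem_iff_lt_rowLen,
      YoungDiagram.mem_iff_lt_rowLen, ← hT i, ← hrow α i,
      Finset.filter_congr fun c hc => by rw [heq c hc]]
  · ext i j
    rw [SemistandardYoungTableau.highestWeight_apply]
    split_ifs with hc
    · exact (heq (i, j) hc).symm
    · exact T.zeros hc

theorem padPart_eq {ν : YoungDiagram} {m : ℕ} (h : ν.card ≤ m) :
    ∃ hs, padPart (2 * m) ν = YoungDiagram.ofRowLens ((2 * m - ν.card) :: ν.rowLens) hs := by
  have hs : ((2 * m - ν.card) :: ν.rowLens).SortedGE := by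
    rw [List.sortedGE_iff_pairwise, List.pairwise_cons]
    refine ⟨fun x hx => ?_, List.sortedGE_iff_pairwise.1 ν.rowLens_sorted⟩
    have := List.le_sum_of_mem hx
    rw [sum_rowLens] at this
    omega
  exact ⟨hs, dif_pos hs⟩

theorem sum_fst_padPart {ν : YoungDiagram} {m : ℕ} (h : ν.card ≤ m) :
    ∑ c ∈ (padPart (2 * m) ν).cells, c.1 = rowWeight ν := by
  obtain ⟨hs, he⟩ := padPart_eq h
  have h1 : YoungDiagram.cellsOfRowLens ν.rowLens = ν.cells :=
    congrArg YoungDiagram.cells (YoungDiagram.ofRowLens_to_rowLens_eq_self (μ := ν))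
  rw [he, YoungDiagram.ofRowLens, sum_cellsOfRowLens_cons, h1]
  simp [rowWeight]

theorem mem_padPart {ν : YoungDiagram} {m : ℕ} (h : ν.card ≤ m) (i j : ℕ) :
    (i + 1, j) ∈ padPart (2 * m) ν ↔ (i, j) ∈ ν := by
  obtain ⟨hs, he⟩ := padPart_eq h
  conv_rhs => rw [← YoungDiagram.ofRowLens_to_rowLens_eq_self (μ := ν)]
  rw [he, YoungDiagram.mem_ofRowLens, YoungDiagram.mem_ofRowLens]
  simp

theorem rowWeight_lt {ν μ : YoungDiagram} (h : ν.card ≤ μ.card) (hne : ν ≠ μ)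
    (hK : paddedKostka ν μ ≠ 0) : rowWeight ν < rowWeight μ := by
  have hne' : Nonempty {T : SemistandardYoungTableau (padPart (2 * μ.card) ν) //
      ∀ k, ((padPart (2 * μ.card) ν).cells.filter fun c => T c.1 c.2 = k).card =
        (padPart (2 * μ.card) μ).rowLen k} := by
    by_contra hcon
    rw [not_nonempty_iff] at hcon
    exact hK Nat.card_of_isEmpty
  obtain ⟨T, hT⟩ := hne'
  obtain ⟨h1, h2⟩ := sum_fst_le T hT
  rw [sum_fst_padPart h, sum_fst_padPart le_rfl] at h1 h2
  refine lt_of_le_of_ne h1 fun heq => hne ?_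
  ext ⟨i, j⟩
  rw [YoungDiagram.mem_cells, YoungDiagram.mem_cells, ← mem_padPart h, (h2 heq).1,
    mem_padPart le_rfl]

theorem paddedKostka_self (μ : YoungDiagram) : paddedKostka μ μ = 1 := by
  unfold paddedKostka kostka
  rw [Nat.card_eq_one_iff_unique]
  refine ⟨⟨fun T T' => Subtype.ext ?_⟩, ⟨SemistandardYoungTableau.highestWeight _, fun k => ?_⟩⟩
  · rw [((sum_fst_le T.1 T.2).2 rfl).2, ((sum_fst_le T'.1 T'.2).2 rfl).2]
  · rw [YoungDiagram.rowLen_eq_card, YoungDiagram.row]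
    congr 1
    refine Finset.filter_congr fun c hc => ?_
    rw [SemistandardYoungTableau.highestWeight_apply, 
      if_pos ((YoungDiagram.mem_cells c).1 hc)]

theorem finite_card_le (n : ℕ) : {ν : YoungDiagram | ν.card ≤ n}.Finite := by
  refine Set.Finite.subset (((range n ×ˢ range n).powerset.finite_toSet).preimage
    (f := YoungDiagram.cells) (Set.injOn_of_injective fun a b h => YoungDiagram.ext h)) ?_
  intro ν hν
  rw [Set.mem_preimage, Finset.mem_coe, Finset.mem_powerset]
  rintro ⟨i, j⟩ hc
  rw [YoungDiagram.mem_cells] at hc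
  have h1 : ν.colLen j ≤ ν.card := by
    rw [YoungDiagram.colLen_eq_card]
    exact Finset.card_filter_le _ _
  have h2 : ν.rowLen i ≤ ν.card := by
    rw [YoungDiagram.rowLen_eq_card]
    exact Finset.card_filter_le _ _
  have h3 := YoungDiagram.mem_iff_lt_colLen.1 hc
  have h4 := YoungDiagram.mem_iff_lt_rowLen.1 hc
  have h5 : ν.card ≤ n := hν
  rw [Finset.mem_product, Finset.mem_range, Finset.mem_range]
  omega

/-- The irreducible character basis, by solving
`h̃_μ = ∑_{|ν| ≤ |μ|} K_{(n - |ν|, ν), (n - |μ|, μ)} s̃_ν` for the term `ν = μ`, whose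
coefficient is `1`; terms with vanishing coefficient are left out. -/
noncomputable def sTilde (μ : YoungDiagram) : SymFun :=
  hTilde μ -
    ∑ᶠ ν : {ν : YoungDiagram // ν.card ≤ μ.card ∧ ν ≠ μ ∧ paddedKostka ν μ ≠ 0},
      (paddedKostka ν.1 μ : ℚ) • sTilde ν.1
termination_by rowWeight μ
decreasing_by exact rowWeight_lt ν.2.1 ν.2.2.1 ν.2.2.2

/-- The relation characterising `s̃`. -/
theorem hTilde_eq_sum_sTilde (μ : YoungDiagram) :
    hTilde μ = ∑ᶠ ν : {ν : YoungDiagram // ν.card ≤ μ.card},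
      (paddedKostka ν.1 μ : ℚ) • sTilde ν.1 := by
  have h1 := finsum_set_coe_eq_finsum_mem (f := fun ν => (paddedKostka ν μ : ℚ) • sTilde ν)
    {ν : YoungDiagram | ν.card ≤ μ.card}
  have h2 := finsum_set_coe_eq_finsum_mem (f := fun ν => (paddedKostka ν μ : ℚ) • sTilde ν)
    {ν : YoungDiagram | ν.card ≤ μ.card ∧ ν ≠ μ ∧ paddedKostka ν μ ≠ 0}
  have h3 : ∑ᶠ ν ∈ {ν : YoungDiagram | ν.card ≤ μ.card}, (paddedKostka ν μ : ℚ) • sTilde ν =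
      ∑ᶠ ν ∈ insert μ {ν : YoungDiagram | ν.card ≤ μ.card ∧ ν ≠ μ ∧ paddedKostka ν μ ≠ 0},
        (paddedKostka ν μ : ℚ) • sTilde ν := by
    refine finsum_mem_inter_support_eq' _ _ _ fun ν hν => ?_
    have hK : paddedKostka ν μ ≠ 0 := fun h => hν (by simp [h])
    simp only [Set.mem_ofPred_eq, Set.mem_insert_iff]
    constructor
    · intro h
      by_cases hm : ν = μ
      exacts [Or.inl hm, Or.inr ⟨h, hm, hK⟩]
    · rintro (rfl | h)
      exacts [le_rfl, h.1]
  rw [h3, finsum_mem_insert _ (fun h => h.2.1 rfl)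
    ((finite_card_le μ.card).subset fun _ h => h.1), ← h2, paddedKostka_self, Nat.cast_one,
    one_smul] at h1
  refine Eq.trans ?_ h1.symm
  rw [sTilde]
  exact (sub_add_cancel _ _).symm

/-! ### Set-valued tableaux -/

/-- The partition `(λ₂, λ₃, …)`: `λ` with its first part removed. -/
def removeFirst (lam : YoungDiagram) : YoungDiagram :=
  YoungDiagram.ofRowLens lam.rowLens.tail
    (List.sortedGE_iff_pairwise.2 (List.sortedGE_iff_pairwise.1 lam.rowLens_sorted).tail)

/-- The cells of the skew shape `λ/(λ₂)`: all cells of `λ` except the first `λ₂` of the first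
row. -/
def skewCells (lam : YoungDiagram) : Finset (ℕ × ℕ) :=
  lam.cells.filter fun c => ¬(c.1 = 0 ∧ c.2 < lam.rowLen 1)

/-- The tableaux of skew shape `λ/(λ₂)`, for some partition `λ`, filled with non-empty sets, weakly
increasing in rows and columns for the order `r` on sets, of total content
`{{1^{μ₁}, …, ℓ^{μ_ℓ}}}`, in which a set that is repeated in a row has even size and a set that is
repeated in a column has odd size. Entries outside the skew shape are `∅` by convention. -/
@[ext]
structure SetTableau (r : Finset ℕ → Finset ℕ → Prop) (μ : YoungDiagram) where
  shape : YoungDiagram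
  entry : ℕ → ℕ → Finset ℕ
  entry_nonempty : ∀ i j, (i, j) ∈ skewCells shape → (entry i j).Nonempty
  entry_eq_empty : ∀ i j, (i, j) ∉ skewCells shape → entry i j = ∅
  row_weak : ∀ i j₁ j₂, j₁ < j₂ → (i, j₁) ∈ skewCells shape → (i, j₂) ∈ skewCells shape →
    r (entry i j₁) (entry i j₂)
  col_weak : ∀ i₁ i₂ j, i₁ < i₂ → (i₁, j) ∈ skewCells shape → (i₂, j) ∈ skewCells shape →
    r (entry i₁ j) (entry i₂ j)
  row_repeat : ∀ i j₁ j₂, j₁ < j₂ → (i, j₁) ∈ skewCells shape → (i, j₂) ∈ skewCells shape →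
    entry i j₁ = entry i j₂ → Even (entry i j₁).card
  col_repeat : ∀ i₁ i₂ j, i₁ < i₂ → (i₁, j) ∈ skewCells shape → (i₂, j) ∈ skewCells shape →
    entry i₁ j = entry i₂ j → Odd (entry i₁ j).card
  content_eq : ∑ c ∈ skewCells shape, (entry c.1 c.2).val = content μ

end SymChar

/-! The eigenvalues of a permutation matrix of cycle type `L` are the `k`-th roots of unity for each
`k` in `L`. `evalRoots L` evaluates a symmetric function at them, and these evaluations separate
symmetric functions (`eq_zero_of_evalRoots`). At this point `∑ h_n xⁿ` becomes `∏ 1/(1 - x^k)` and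
`∑ e_n xⁿ` becomes `∏ (1 - (-x)^k)`, over `k` in `L`. With one variable `x_i` per letter, the factor
of `k` is, for `h`, the sum of `x^(kB)` over multisets `B` and, for `e`, the sum over sets `S` of
`(-(-1)^k)^|S| x^(kS)`.

On the other side, `p_k^⊥ = k ∂/∂p_k` multiplies `∑ h_n yⁿ` by `y^k` and `∑ e_n yⁿ` by `-(-1)^k
y^k`. Hence `evalSkew L`, which applies `∏ (1 + p_k^⊥)` and sets `p = 0`, sends a product of such
series in monomials `y = x^B` to a product over `k` of sums over blocks. The two sides match: `h_μ`
at `L` is `evalSkew L` of the sum of `h_{m̃(π)}` over multiset partitions, and `e_μ` at `L` is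
`evalSkew L` of the analogous sum over families of sets. There a set of even size contributes `h`
and one of odd size `e`, because `(-(-1)^k)^|S|` is `1` or `-(-1)^k` accordingly. This is the source
of the parity rule.

The linear map `charMap` adjoins a variable equal to `1`, expands by the Pieri rules and replaces
each diagram by its `s̃`. Adjoining the variable amounts to deleting a very long first row, so the
definition of `s̃` gives `charMap h_μ = h̃_μ` (`charMap_completePart`). The recursion for `h̃` then
yields `evalRoots L ∘ charMap = evalSkew L` by induction on `|μ|` (`evalRoots_charMap`), and
therefore `e_μ` is `charMap` of the sum over families of sets (`elementaryPart_eq_charMap`).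

Finally, the Pieri rules expand `charMap` of a product of `h`s and `e`s over fillings with the sets
as labels (`charMap_prod`). The factors commute, so the sets may be added in any order, which is why
every total order works. The fillings carry `|μ|` extra labels `0` at the start of the first row.
Erasing these and sliding the rest of that row to start in column `λ₂` gives the tableaux of shape
`λ/(λ₂)` (`blockFillingEquiv`). -/

namespace SymChar
open Finset

/-! ### Coefficients of the complete and elementary symmetric functions -/

/-- The parts of the partition with `m k` parts equal to `k`. -/
noncomputable def partsOf (m : ℕ+ →₀ ℕ) : Multiset ℕ :=
  (Finsupp.toMultiset m).map fun k : ℕ+ => (k : ℕ)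

theorem count_partsOf (m : ℕ+ →₀ ℕ) (k : ℕ+) : (partsOf m).count (k : ℕ) = m k := by
  rw [partsOf, Multiset.count_map_eq_count' _ _ PNat.coe_injective, Finsupp.count_toMultiset]

theorem powerSum_coe (k : ℕ+) : powerSum (k : ℕ) = MvPolynomial.X k := by
  rw [powerSum, PNat.coe_toPNat']

theorem prod_powerSum_partsOf (m : ℕ+ →₀ ℕ) :
    ((partsOf m).map powerSum).prod = MvPolynomial.monomial m 1 := by
  rw [partsOf, Multiset.map_map]
  simp only [Function.comp_def, powerSum_coe]
  rw [Finsupp.toMultiset_map, Finsupp.prod_toMultiset, MvPolynomial.monomial_eq,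
    Finsupp.prod_mapDomain_index (by simp) (by simp [pow_add])]
  simp

theorem partsOf_injective : Function.Injective partsOf := by
  intro m m' h
  ext k
  rw [← count_partsOf, h, count_partsOf]

theorem exists_partsOf {s : Multiset ℕ} (h : ∀ i ∈ s, 0 < i) : ∃ m, partsOf m = s := by
  refine ⟨Multiset.toFinsupp (s.map Nat.toPNat'), ?_⟩
  rw [partsOf, Multiset.toFinsupp_toMultiset, Multiset.map_map]
  conv_rhs => rw [← Multiset.map_id s]
  refine Multiset.map_congr rfl fun i hi => ?_
  have := h i hi
  simp [this]

/-- Distinct partitions give distinct monomials, so at most one term contributes. The coefficient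
`c` is a function of multisets, so that it can be evaluated at `partsOf m` without knowing the size
of `m`. -/
theorem coeff_sum_powerSumPart (n : ℕ) (c : Multiset ℕ → ℚ) (m : ℕ+ →₀ ℕ) :
    MvPolynomial.coeff m (∑ γ : n.Partition, c γ.parts • powerSumPart γ) =
      if (partsOf m).sum = n then c (partsOf m) else 0 := by
  have key (γ : n.Partition) : MvPolynomial.coeff m (c γ.parts • powerSumPart γ) =
      if partsOf m = γ.parts then c γ.parts else 0 := by
    obtain ⟨m', hm'⟩ := exists_partsOf fun i hi => γ.parts_pos hi
    rw [powerSumPart, ← hm', prod_powerSum_partsOf, MvPolynomial.coeff_smul,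
      MvPolynomial.coeff_monomial]
    simp [partsOf_injective.eq_iff, eq_comm]
  rw [MvPolynomial.coeff_sum, Finset.sum_congr rfl fun γ _ => key γ]
  split_ifs with h
  · have hpos : ∀ i ∈ partsOf m, 0 < i := by
      intro i hi
      obtain ⟨k, -, rfl⟩ := Multiset.mem_map.1 hi
      exact k.pos
    rw [Finset.sum_eq_single ⟨partsOf m, fun {i} hi => hpos i hi, h⟩]
    · simp
    · intro γ _ hγ
      refine if_neg fun h' => hγ ?_
      ext1
      exact h'.symm
    · simp
  · refine Finset.sum_eq_zero fun γ _ => if_neg fun h' => h ?_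
    rw [h', γ.parts_sum]

/-- `z_γ` for the partition with `m k` parts equal to `k`. -/
noncomputable def zeeFinsupp (m : ℕ+ →₀ ℕ) : ℚ :=
  m.prod fun k a => (k : ℚ) ^ a * (a.factorial : ℚ)

theorem zeeFinsupp_ne_zero (m : ℕ+ →₀ ℕ) : zeeFinsupp m ≠ 0 := by
  rw [zeeFinsupp, Finsupp.prod, Finset.prod_ne_zero_iff]
  intro k _
  positivity

/-- The factor `k (m_k + 1)` is exactly the one that `k ∂/∂p_k` produces; this cancellation
underlies both `skewPower_complete_add` and Newton's identity. -/
theorem zeeFinsupp_add_single (m : ℕ+ →₀ ℕ) (k : ℕ+) :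
    zeeFinsupp (m + Finsupp.single k 1) = k * (m k + 1) * zeeFinsupp m := by
  have h1 : (m + Finsupp.single k 1).support ⊆ insert k m.support := by
    intro i hi
    by_cases h : i = k
    · simp [h]
    · simp [Ne.symm h] at hi
      simp [hi]
  rw [zeeFinsupp, zeeFinsupp, Finsupp.prod_of_support_subset _ h1 _ (by simp),
    Finsupp.prod_of_support_subset m (Finset.subset_insert k m.support) _ (by simp),
    ← Finset.mul_prod_erase _ _ (Finset.mem_insert_self k _),
    ← Finset.mul_prod_erase _ _ (Finset.mem_insert_self k _)]
  have h2 : ∀ i ∈ (insert k m.support).erase k, (m + Finsupp.single k 1 : ℕ+ →₀ ℕ) i = m i := by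
    intro i hi
    have := Finset.ne_of_mem_erase hi
    simp [this]
  rw [Finset.prod_congr rfl fun i hi => by rw [h2 i hi]]
  simp only [Finsupp.add_apply, Finsupp.single_eq_same, pow_succ, Nat.factorial_succ]
  push_cast
  ring

theorem prod_partsOf (m : ℕ+ →₀ ℕ) :
    ((∏ i ∈ (partsOf m).toFinset, i ^ (partsOf m).count i * ((partsOf m).count i).factorial : ℕ) :
      ℚ) = zeeFinsupp m := by
  have h : (partsOf m).toFinset = m.support.map ⟨fun k : ℕ+ => (k : ℕ), PNat.coe_injective⟩ := by
    ext i
    simp [partsOf]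
  rw [h, Finset.prod_map, zeeFinsupp, Finsupp.prod]
  push_cast
  refine Finset.prod_congr rfl fun k _ => ?_
  simp [count_partsOf]

theorem coeff_complete (n : ℕ) (m : ℕ+ →₀ ℕ) :
    MvPolynomial.coeff m (complete n) =
      if (partsOf m).sum = n then (zeeFinsupp m)⁻¹ else 0 := by
  rw [← prod_partsOf]
  exact coeff_sum_powerSumPart n (fun s => ((∏ i ∈ s.toFinset,
    i ^ s.count i * (s.count i).factorial : ℕ) : ℚ)⁻¹) m

theorem coeff_elementary (n : ℕ) (m : ℕ+ →₀ ℕ) :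
    MvPolynomial.coeff m (elementary n) =
      (-1) ^ (n + (partsOf m).card) * MvPolynomial.coeff m (complete n) := by
  rw [coeff_complete, mul_ite, mul_zero, ← prod_partsOf]
  exact coeff_sum_powerSumPart n (fun s => (-1) ^ (n + s.card) * ((∏ i ∈ s.toFinset,
    i ^ s.count i * (s.count i).factorial : ℕ) : ℚ)⁻¹) m

theorem partsOf_add (m m' : ℕ+ →₀ ℕ) : partsOf (m + m') = partsOf m + partsOf m' := by
  simp [partsOf]

theorem partsOf_single (k : ℕ+) : partsOf (Finsupp.single k 1) = {(k : ℕ)} := by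
  simp [partsOf]

/-- Changing the sign of all power sums. -/
noncomputable def negPowerSums : SymFun →ₐ[ℚ] SymFun := MvPolynomial.aeval fun k => -MvPolynomial.X k

theorem coeff_negPowerSums (f : SymFun) (m : ℕ+ →₀ ℕ) :
    MvPolynomial.coeff m (negPowerSums f) = (-1) ^ (partsOf m).card * MvPolynomial.coeff m f := by
  have h (s : ℕ+ →₀ ℕ) : negPowerSums (MvPolynomial.monomial s 1) =
      (-1) ^ (partsOf s).card * MvPolynomial.monomial s 1 := by
    rw [← prod_powerSum_partsOf, ← AlgHom.coe_toMonoidHom, map_multiset_prod, Multiset.map_map]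
    have h2 : (⇑(negPowerSums : SymFun →* SymFun) ∘ powerSum) = fun k => -1 * powerSum k := by
      funext k
      simp [powerSum, negPowerSums]
    rw [h2, Multiset.prod_map_mul]
    simp
  induction f using MvPolynomial.induction_on' with
  | monomial s a =>
    have h1 : MvPolynomial.monomial s a = a • (MvPolynomial.monomial s 1 : SymFun) := by
      rw [MvPolynomial.smul_monomial, smul_eq_mul, mul_one]
    have h2 : ((-1) ^ (partsOf s).card * MvPolynomial.monomial s 1 : SymFun) =
        ((-1) ^ (partsOf s).card : ℚ) • MvPolynomial.monomial s 1 := by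
      rw [Algebra.smul_def]; simp
    rw [h1, map_smul, h, h2]
    simp only [MvPolynomial.coeff_smul, MvPolynomial.coeff_monomial, smul_eq_mul]
    split_ifs with hs
    · rw [hs]; ring
    · simp
  | add p q hp hq => rw [map_add, MvPolynomial.coeff_add, hp, hq, MvPolynomial.coeff_add, mul_add]

/-- Negating all power sums multiplies `p_γ` by `(-1)^ℓ(γ)`. Facts about `e_n` are deduced in this
way from those about `h_n`. -/
theorem negPowerSums_complete (n : ℕ) : negPowerSums (complete n) = (-1) ^ n * elementary n := by
  ext m
  have : ((-1) ^ n * elementary n : SymFun) = ((-1) ^ n : ℚ) • elementary n := by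
    rw [Algebra.smul_def]; simp
  rw [coeff_negPowerSums, this, MvPolynomial.coeff_smul, coeff_elementary, smul_eq_mul, ← mul_assoc,
    pow_add, ← mul_assoc, ← mul_pow]
  simp

/-- The derivation `k ∂/∂p_k`. -/
noncomputable def skewPower (k : ℕ+) : Derivation ℚ SymFun SymFun := (k : ℚ) • MvPolynomial.pderiv k

/-- The coefficient of `p^m` on the left is `k (m_k + 1)` divided by the `z` of `m` with a part `k`
added, which is `1 / z_m`. -/
theorem skewPower_complete_add (k : ℕ+) (n : ℕ) :
    skewPower k (complete (n + k)) = complete n := by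
  ext m
  rw [skewPower, Derivation.smul_apply, MvPolynomial.coeff_smul, MvPolynomial.coeff_pderiv,
    coeff_complete, coeff_complete, partsOf_add, partsOf_single, zeeFinsupp_add_single]
  have h0 := zeeFinsupp_ne_zero m
  have h1 : (k : ℚ) ≠ 0 := by positivity
  have h2 : (m k + 1 : ℚ) ≠ 0 := by positivity
  simp only [Multiset.sum_add, Multiset.sum_singleton, add_left_inj]
  split_ifs
  · simp only [smul_eq_mul]
    field_simp
  · simp

theorem skewPower_complete_of_lt {k : ℕ+} {n : ℕ} (h : n < k) :
    skewPower k (complete n) = 0 := by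
  ext m
  rw [skewPower, Derivation.smul_apply, MvPolynomial.coeff_smul, MvPolynomial.coeff_pderiv,
    coeff_complete, partsOf_add, partsOf_single, if_neg]
  · simp
  · simp only [Multiset.sum_add, Multiset.sum_singleton]
    omega

theorem skewPower_negPowerSums (k : ℕ+) (f : SymFun) :
    skewPower k (negPowerSums f) = -negPowerSums (skewPower k f) := by
  ext m
  simp only [skewPower, Derivation.smul_apply, map_smul, MvPolynomial.coeff_smul,
    MvPolynomial.coeff_pderiv, MvPolynomial.coeff_neg, coeff_negPowerSums, partsOf_add,
    partsOf_single, Multiset.card_add, Multiset.card_singleton, pow_succ, smul_eq_mul]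
  ring

theorem complete_zero : complete 0 = 1 := by
  ext m
  rw [coeff_complete, MvPolynomial.coeff_one]
  have h : (partsOf m).sum = 0 ↔ 0 = m := by
    constructor
    · intro h
      ext k
      rw [← count_partsOf m, eq_comm, Finsupp.zero_apply, Multiset.count_eq_zero]
      intro hk
      have := Multiset.single_le_sum (fun _ _ => Nat.zero_le _) _ hk
      have := k.pos
      omega
    · rintro rfl
      simp [partsOf]
  by_cases hm : 0 = m
  · rw [if_pos (h.2 hm), if_pos hm, ← hm]
    simp [zeeFinsupp]
  · rw [if_neg (fun h' => hm (h.1 h')), if_neg hm]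

theorem elementary_eq (n : ℕ) : elementary n = (-1) ^ n * negPowerSums (complete n) := by
  rw [negPowerSums_complete, ← mul_assoc, ← mul_pow]
  simp

theorem elementary_zero : elementary 0 = 1 := by
  rw [elementary_eq, complete_zero]
  simp

theorem skewPower_elementary_add (k : ℕ+) (n : ℕ) :
    skewPower k (elementary (n + k)) = -(-1) ^ (k : ℕ) * elementary n := by
  have : ((-1) ^ (n + k) : SymFun) = algebraMap ℚ _ ((-1) ^ (n + (k : ℕ))) := by simp
  rw [elementary_eq, this, ← Algebra.smul_def, Derivation.map_smul, skewPower_negPowerSums,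
    skewPower_complete_add, elementary_eq, Algebra.smul_def, ← this, pow_add]
  ring

theorem skewPower_elementary_of_lt {k : ℕ+} {n : ℕ} (h : n < k) :
    skewPower k (elementary n) = 0 := by
  have : ((-1) ^ n : SymFun) = algebraMap ℚ _ ((-1) ^ n) := by simp
  rw [elementary_eq, this, ← Algebra.smul_def, Derivation.map_smul, skewPower_negPowerSums,
    skewPower_complete_of_lt h]
  simp

/-- Newton's identity. -/
theorem newton_complete (n : ℕ) :
    ((n + 1 : ℕ) : SymFun) * complete (n + 1) =
      ∑ k ∈ range (n + 1), MvPolynomial.X k.succPNat * complete (n - k) := by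
  ext m
  have : ((n + 1 : ℕ) : SymFun) = algebraMap ℚ _ ((n + 1 : ℕ) : ℚ) := by simp
  rw [this, ← Algebra.smul_def, MvPolynomial.coeff_smul, MvPolynomial.coeff_sum]
  -- Removing a part `k + 1` from `m` divides `z_m` by `(k + 1) m_{k + 1}`. Summing these factors
  -- over `k` gives the size of the partition, `n + 1`.
  have key (k : ℕ) (hk : k ∈ range (n + 1)) :
      MvPolynomial.coeff m (MvPolynomial.X k.succPNat * complete (n - k)) =
        (((k + 1) * m k.succPNat : ℕ) : ℚ) * MvPolynomial.coeff m (complete (n + 1)) := by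
    rw [MvPolynomial.coeff_X_mul']
    split_ifs with h
    · obtain ⟨m', rfl⟩ : ∃ m', m = m' + Finsupp.single k.succPNat 1 := by
        refine ⟨m - Finsupp.single k.succPNat 1, (tsub_add_cancel_of_le ?_).symm⟩
        simpa [Nat.one_le_iff_ne_zero] using h
      rw [mem_range] at hk
      rw [add_tsub_cancel_right, coeff_complete, coeff_complete, zeeFinsupp_add_single,
        partsOf_add, partsOf_single]
      have h0 := zeeFinsupp_ne_zero m'
      have h1 : ((k : ℚ) + 1) ≠ 0 := by positivity
      have h2 : (m' k.succPNat + 1 : ℚ) ≠ 0 := by positivity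
      simp only [Multiset.sum_add, Multiset.sum_singleton, Nat.succPNat_coe, Nat.succ_eq_add_one]
      have h3 : (partsOf m').sum + (k + 1) = n + 1 ↔ (partsOf m').sum = n - k := by omega
      simp only [h3]
      split_ifs
      · simp
        field_simp
      · simp
    · simp at h
      simp [h]
  rw [Finset.sum_congr rfl key, ← Finset.sum_mul, ← Nat.cast_sum, smul_eq_mul, coeff_complete]
  split_ifs with h
  · congr 2
    have : ∀ k : ℕ, m k.succPNat = (partsOf m).count (k + 1) := by
      intro k
      rw [← count_partsOf]
      rfl
    simp only [this]
    conv_lhs => rw [← h, Finset.sum_multiset_count_of_subset (partsOf m)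
      ((range (n + 1)).map (addRightEmbedding 1)) (by
        intro i hi
        rw [Multiset.mem_toFinset] at hi
        have h1 := Multiset.single_le_sum (fun _ _ => Nat.zero_le _) _ hi
        obtain ⟨k, -, hk⟩ := Multiset.mem_map.1 hi
        have := k.pos
        simp only [mem_map, mem_range, addRightEmbedding_apply]
        exact ⟨i - 1, by omega, by omega⟩)]
    rw [Finset.sum_map]
    refine Finset.sum_congr rfl fun k _ => ?_
    simp [mul_comm]
  · simp
end SymChar

namespace SymChar
open Finset

/-! ### Homomorphisms out of the ring of symmetric functions -/

section Hom

variable {A : Type*} [CommRing A] [Algebra ℚ A]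

/-- The power series `∑ φ(h_n) tⁿ`. -/
noncomputable def completeSeries (φ : SymFun →ₐ[ℚ] A) : PowerSeries A :=
  PowerSeries.mk fun n => φ (complete n)

/-- The power series `∑ φ(e_n) tⁿ`. -/
noncomputable def elementarySeries (φ : SymFun →ₐ[ℚ] A) : PowerSeries A :=
  PowerSeries.mk fun n => φ (elementary n)

/-- The power series `∑ φ(p_{n + 1}) tⁿ`. -/
noncomputable def powerSeries (φ : SymFun →ₐ[ℚ] A) : PowerSeries A :=
  PowerSeries.mk fun n => φ (MvPolynomial.X n.succPNat)

theorem natCast_mul_left_cancel {n : ℕ} {a b : A} (h : ((n + 1 : ℕ) : A) * a = (n + 1 : ℕ) * b) :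
    a = b := by
  have h1 : ((n + 1 : ℕ) : A) = algebraMap ℚ A ((n + 1 : ℕ) : ℚ) := by simp
  rw [h1, ← Algebra.smul_def, ← Algebra.smul_def] at h
  exact smul_right_injective A (show ((n + 1 : ℕ) : ℚ) ≠ 0 by positivity) h

theorem newton_hom (φ : SymFun →ₐ[ℚ] A) (n : ℕ) :
    ((n + 1 : ℕ) : A) * φ (complete (n + 1)) =
      ∑ k ∈ range (n + 1), φ (MvPolynomial.X k.succPNat) * φ (complete (n - k)) := by
  have h := congrArg φ (newton_complete n)
  simpa only [map_mul, map_sum, map_natCast] using h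

/-- Over `ℚ` the factor `n + 1` can be cancelled, so Newton's recursion has a unique solution with
initial value `1`. -/
theorem complete_eq_of_newton (φ : SymFun →ₐ[ℚ] A) {a : ℕ → A} (h0 : a 0 = 1)
    (h : ∀ n : ℕ, ((n + 1 : ℕ) : A) * a (n + 1) =
      ∑ k ∈ range (n + 1), φ (MvPolynomial.X k.succPNat) * a (n - k)) (n : ℕ) :
    φ (complete n) = a n := by
  induction n using Nat.strong_induction_on with
  | _ n ih =>
    cases n with
    | zero => rw [complete_zero, map_one, h0]
    | succ n =>
      refine natCast_mul_left_cancel (n := n) ?_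
      rw [newton_hom, h]
      exact Finset.sum_congr rfl fun k _ => by rw [ih _ (by omega)]

/-- The sequence of power sums attached by Newton's identities to a sequence of complete symmetric
functions. -/
noncomputable def newtonPower (a : ℕ → A) (n : ℕ) : A :=
  (n + 1 : ℕ) * a (n + 1) - ∑ k : Fin n, newtonPower a k * a (n - k)

/-- There is a homomorphism with prescribed values on the complete symmetric functions. -/
theorem exists_hom_complete {a : ℕ → A} (h0 : a 0 = 1) :
    ∃ φ : SymFun →ₐ[ℚ] A, ∀ n, φ (complete n) = a n := by
  refine ⟨MvPolynomial.aeval fun k => newtonPower a k.natPred, complete_eq_of_newton _ h0 ?_⟩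
  intro n
  simp only [MvPolynomial.aeval_X, Nat.natPred_succPNat]
  rw [Finset.sum_range_succ, Nat.sub_self, h0, mul_one, newtonPower,
    Finset.sum_range fun k => newtonPower a k * a (n - k)]
  ring

theorem derivative_completeSeries (φ : SymFun →ₐ[ℚ] A) :
    PowerSeries.derivative A (completeSeries φ) = powerSeries φ * completeSeries φ := by
  ext n
  rw [PowerSeries.coeff_derivative, PowerSeries.coeff_mul,
    Finset.Nat.sum_antidiagonal_eq_sum_range_succ_mk]
  simp only [completeSeries, powerSeries, PowerSeries.coeff_mk]
  rw [← newton_hom, mul_comm]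
  push_cast
  rfl

/-- Newton's identities say that `H' = P H` with `H(0) = 1`, and they determine `H`. The product and
root formulas below are verified through this differential equation, which avoids exponentials of
power series. -/
theorem completeSeries_eq_of_derivative (φ : SymFun →ₐ[ℚ] A) {f : PowerSeries A}
    (h0 : PowerSeries.constantCoeff f = 1)
    (h : PowerSeries.derivative A f = powerSeries φ * f) : completeSeries φ = f := by
  ext n
  rw [completeSeries, PowerSeries.coeff_mk]
  refine complete_eq_of_newton φ (a := fun n => PowerSeries.coeff n f) (by simpa using h0) ?_ n
  intro n
  have h1 := congrArg (PowerSeries.coeff n) h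
  rw [PowerSeries.coeff_derivative, PowerSeries.coeff_mul,
    Finset.Nat.sum_antidiagonal_eq_sum_range_succ_mk] at h1
  simp only [powerSeries, PowerSeries.coeff_mk] at h1
  rw [← h1, mul_comm]
  push_cast
  rfl

theorem constantCoeff_completeSeries (φ : SymFun →ₐ[ℚ] A) :
    PowerSeries.constantCoeff (completeSeries φ) = 1 := by
  rw [← PowerSeries.coeff_zero_eq_constantCoeff_apply, completeSeries, PowerSeries.coeff_mk,
    complete_zero, map_one]

/-- The logarithmic derivative of a product is the sum of the logarithmic derivatives. -/
theorem completeSeries_add {φ φ₁ φ₂ : SymFun →ₐ[ℚ] A}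
    (h : ∀ k, φ (MvPolynomial.X k) = φ₁ (MvPolynomial.X k) + φ₂ (MvPolynomial.X k)) :
    completeSeries φ = completeSeries φ₁ * completeSeries φ₂ := by
  refine completeSeries_eq_of_derivative φ ?_ ?_
  · rw [map_mul, constantCoeff_completeSeries, constantCoeff_completeSeries, one_mul]
  · have hp : powerSeries φ = powerSeries φ₁ + powerSeries φ₂ := by
      ext n
      simp [powerSeries, h]
    rw [Derivation.leibniz, derivative_completeSeries, derivative_completeSeries, hp]
    simp only [smul_eq_mul]
    ring

theorem elementarySeries_eq (φ : SymFun →ₐ[ℚ] A) :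
    elementarySeries φ = PowerSeries.rescale (-1) (completeSeries (φ.comp negPowerSums)) := by
  ext n
  simp [elementarySeries, completeSeries, PowerSeries.coeff_rescale, elementary_eq]

theorem elementarySeries_add {φ φ₁ φ₂ : SymFun →ₐ[ℚ] A}
    (h : ∀ k, φ (MvPolynomial.X k) = φ₁ (MvPolynomial.X k) + φ₂ (MvPolynomial.X k)) :
    elementarySeries φ = elementarySeries φ₁ * elementarySeries φ₂ := by
  simp only [elementarySeries_eq]
  rw [← map_mul, completeSeries_add (φ₁ := φ₁.comp negPowerSums) (φ₂ := φ₂.comp negPowerSums)]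
  intro k
  simp [negPowerSums, h]
  ring

/-- `E(-t)` is the series `H` for the negated power sums. By additivity the product belongs to power
sums that all vanish, for which `H = 1`. -/
theorem completeSeries_mul_rescale_elementarySeries (φ : SymFun →ₐ[ℚ] A) :
    completeSeries φ * PowerSeries.rescale (-1) (elementarySeries φ) = 1 := by
  rw [elementarySeries_eq, PowerSeries.rescale_rescale]
  simp only [mul_neg, mul_one, neg_neg, PowerSeries.rescale_one, RingHom.id_apply]
  rw [← completeSeries_add (φ := MvPolynomial.aeval fun _ => 0)]
  · refine completeSeries_eq_of_derivative _ (by simp) ?_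
    have : powerSeries (MvPolynomial.aeval fun _ => 0 : SymFun →ₐ[ℚ] A) = 0 := by
      ext n
      simp [powerSeries]
    rw [this]
    simp
  · simp [negPowerSums]

/-- The power sums of the `k`-th roots of unity are `k` when `k ∣ j` and `0` otherwise. Their
negatives are treated first since `H` is then a polynomial; the series for the roots themselves
follow from `E(-t) H(t) = 1`. -/
theorem completeSeries_neg_root {φ : SymFun →ₐ[ℚ] A} (k : ℕ+)
    (h : ∀ j, φ (MvPolynomial.X j) = -if (k : ℕ) ∣ j then ((k : ℕ) : A) else 0) :
    completeSeries φ = 1 - PowerSeries.X ^ (k : ℕ) := by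
  have hk := k.pos
  have hX (i : ℕ) : φ (MvPolynomial.X i.succPNat) =
      if (k : ℕ) ∣ i + 1 then -((k : ℕ) : A) else 0 := by
    simp only [h, Nat.succPNat_coe, Nat.succ_eq_add_one]
    split_ifs with h1 <;> simp [h1]
  refine completeSeries_eq_of_derivative φ (by simp) ?_
  ext n
  rw [map_sub, map_sub, mul_sub, mul_one, map_sub, PowerSeries.coeff_mul_X_pow']
  simp only [powerSeries, PowerSeries.coeff_mk, hX, PowerSeries.coeff_derivative,
    PowerSeries.coeff_X_pow, PowerSeries.coeff_one]
  by_cases h1 : (k : ℕ) ≤ n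
  · have h2 : (k : ℕ) ∣ n - k + 1 ↔ (k : ℕ) ∣ n + 1 := by
      rw [← Nat.dvd_add_self_right (m := (k : ℕ)) (n := n - k + 1)]
      rw [show n - k + 1 + k = n + 1 by omega]
    rw [if_pos h1, if_neg (show n + 1 ≠ k by omega)]
    simp only [h2]
    simp
  · rw [if_neg h1]
    by_cases h3 : n + 1 = k
    · have : (k : ℕ) ∣ n + 1 := by rw [h3]
      rw [if_pos this, if_pos h3, ← h3]
      simp
    · have : ¬ (k : ℕ) ∣ n + 1 := fun h4 => by
        have := Nat.le_of_dvd (by omega) h4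
        omega
      rw [if_neg this, if_neg h3]
      simp

theorem elementarySeries_root {φ : SymFun →ₐ[ℚ] A} (k : ℕ+)
    (h : ∀ j, φ (MvPolynomial.X j) = if (k : ℕ) ∣ j then ((k : ℕ) : A) else 0) :
    elementarySeries φ = 1 - (-PowerSeries.X) ^ (k : ℕ) := by
  rw [elementarySeries_eq, completeSeries_neg_root k]
  · simp [PowerSeries.rescale_X]
  · intro j
    simp [negPowerSums, h]

theorem completeSeries_root {φ : SymFun →ₐ[ℚ] A} (k : ℕ+)
    (h : ∀ j, φ (MvPolynomial.X j) = if (k : ℕ) ∣ j then ((k : ℕ) : A) else 0) :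
    completeSeries φ * (1 - PowerSeries.X ^ (k : ℕ)) = 1 := by
  have := completeSeries_mul_rescale_elementarySeries φ
  rw [elementarySeries_root k h] at this
  simpa [PowerSeries.rescale_X] using this

end Hom

/-- The homomorphism `p_k ↦ p_k + 1`. -/
noncomputable def shiftPowerSums : SymFun →ₐ[ℚ] SymFun := MvPolynomial.aeval fun k => MvPolynomial.X k + 1

/-- Adding `1` to every power sum adjoins a variable equal to `1`, which multiplies `H` by `1/(1 -
t)` and `E` by `1 + t`. -/
theorem shiftPowerSums_complete (n : ℕ) :
    shiftPowerSums (complete n) = ∑ j ∈ range (n + 1), complete j := by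
  have h1 : completeSeries shiftPowerSums = completeSeries (AlgHom.id ℚ SymFun) *
      completeSeries (MvPolynomial.aeval fun _ => 1) :=
    completeSeries_add fun k => by simp [shiftPowerSums]
  have h2 := completeSeries_root (φ := (MvPolynomial.aeval fun _ => 1 : SymFun →ₐ[ℚ] SymFun)) 1
    (fun j => by simp)
  have h3 : completeSeries (MvPolynomial.aeval fun _ => 1 : SymFun →ₐ[ℚ] SymFun) =
      PowerSeries.mk 1 := by
    have h4 := PowerSeries.mk_one_mul_one_sub_eq_one SymFun
    simp only [PNat.one_coe, pow_one] at h2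
    calc _ = completeSeries (MvPolynomial.aeval fun _ => 1 : SymFun →ₐ[ℚ] SymFun) *
          (PowerSeries.mk 1 * (1 - PowerSeries.X)) := by rw [h4, mul_one]
      _ = completeSeries (MvPolynomial.aeval fun _ => 1 : SymFun →ₐ[ℚ] SymFun) *
          (1 - PowerSeries.X) * PowerSeries.mk 1 := by ring
      _ = _ := by rw [h2, one_mul]
  rw [h3] at h1
  have h5 := congrArg (PowerSeries.coeff n) h1
  rw [PowerSeries.coeff_mul, Finset.Nat.sum_antidiagonal_eq_sum_range_succ_mk] at h5
  simpa [completeSeries] using h5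

theorem elementarySeries_shiftPowerSums : elementarySeries shiftPowerSums =
    elementarySeries (AlgHom.id ℚ SymFun) * (1 + PowerSeries.X) := by
  have h := elementarySeries_root (φ := (MvPolynomial.aeval fun _ => 1 : SymFun →ₐ[ℚ] SymFun)) 1
    (by simp)
  rw [elementarySeries_add (φ₁ := AlgHom.id ℚ SymFun)
    (φ₂ := (MvPolynomial.aeval fun _ => 1 : SymFun →ₐ[ℚ] SymFun))
    fun k => by simp [shiftPowerSums], h]
  simp

theorem shiftPowerSums_elementary_succ (n : ℕ) :
    shiftPowerSums (elementary (n + 1)) = elementary (n + 1) + elementary n := by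
  have h := congrArg (PowerSeries.coeff (n + 1)) elementarySeries_shiftPowerSums
  rw [mul_add, mul_one, map_add, PowerSeries.coeff_succ_mul_X] at h
  simpa [elementarySeries] using h

end SymChar

namespace SymChar
open Finset

/-! ### Young diagrams given by their row lengths -/

theorem rowLen_ext {α β : YoungDiagram} (h : ∀ i, α.rowLen i = β.rowLen i) : α = β := by
  ext ⟨i, j⟩
  rw [YoungDiagram.mem_cells, YoungDiagram.mem_cells, YoungDiagram.mem_iff_lt_rowLen,
    YoungDiagram.mem_iff_lt_rowLen, h]

theorem le_iff_rowLen {α β : YoungDiagram} : α ≤ β ↔ ∀ i, α.rowLen i ≤ β.rowLen i := by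
  constructor
  · intro h i
    by_contra! hlt
    have h1 : (i, β.rowLen i) ∈ α := YoungDiagram.mem_iff_lt_rowLen.2 hlt
    have h2 := YoungDiagram.mem_iff_lt_rowLen.1 (h h1)
    exact lt_irrefl _ h2
  · rintro h ⟨i, j⟩ hc
    exact YoungDiagram.mem_iff_lt_rowLen.2 ((YoungDiagram.mem_iff_lt_rowLen.1 hc).trans_le (h i))

theorem rowLen_eq_zero {α : YoungDiagram} {N : ℕ} : α.rowLen N = 0 ↔ α.colLen 0 ≤ N := by
  have := rowLen_pos_iff α N
  omega

theorem card_eq_sum_rowLen {α : YoungDiagram} {N : ℕ} (h : α.rowLen N = 0) :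
    α.card = ∑ i ∈ range N, α.rowLen i := by
  have h1 : ∑ i ∈ range (α.colLen 0), α.rowLen i = α.card := by
    rw [← sum_rowLens, YoungDiagram.rowLens]
    rfl
  rw [← h1]
  refine Finset.sum_subset (Finset.range_subset_range.2 (rowLen_eq_zero.1 h)) fun i _ hi => ?_
  rw [mem_range, not_lt] at hi
  exact rowLen_eq_zero.2 hi

open Classical in
/-- The Young diagram with prescribed row lengths, if there is one. -/
noncomputable def ofRows (f : ℕ → ℕ) : YoungDiagram :=
  if h : ∃ ρ : YoungDiagram, ∀ i, ρ.rowLen i = f i then h.choose else ⊥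

theorem rowLen_ofRows {f : ℕ → ℕ} (hf : ∀ i, f (i + 1) ≤ f i) {N : ℕ} (hN : f N = 0) (i : ℕ) :
    (ofRows f).rowLen i = f i := by
  have h : ∃ ρ : YoungDiagram, ∀ i, ρ.rowLen i = f i := by
    have hanti : Antitone f := antitone_nat_of_succ_le hf
    refine ⟨⟨(range N ×ˢ range (f 0)).filter fun c => c.2 < f c.1, ?_⟩, fun i => ?_⟩
    · rintro ⟨i, j⟩ ⟨i', j'⟩ ⟨h1, h2⟩ hc
      simp only [coe_filter, mem_product, mem_range, Set.mem_ofPred_eq] at hc h1 h2 ⊢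
      have := hanti h1
      omega
    · refine eq_of_forall_lt_iff fun j => ?_
      rw [← YoungDiagram.mem_iff_lt_rowLen]
      change (i, j) ∈ (range N ×ˢ range (f 0)).filter (fun c => c.2 < f c.1) ↔ _
      simp only [mem_filter, mem_product, mem_range]
      constructor
      · exact fun h => h.2
      · intro h
        have h0 := hanti (Nat.zero_le i)
        refine ⟨⟨?_, by omega⟩, h⟩
        by_contra! hi
        have := hanti hi
        omega
  rw [ofRows, dif_pos h]
  exact h.choose_spec i

/-! ### Horizontal and vertical strips -/

/-- `β/α` is a horizontal strip if `t` holds, a vertical strip otherwise. -/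
def Strip (t : Prop) (α β : YoungDiagram) : Prop :=
  α ≤ β ∧ (t → ∀ i j, (i + 1, j) ∈ β → (i, j) ∈ α) ∧ (¬t → ∀ i j, (i, j + 1) ∈ β → (i, j) ∈ α)

theorem strip_true_iff {α β : YoungDiagram} :
    Strip True α β ↔ ∀ i, α.rowLen i ≤ β.rowLen i ∧ β.rowLen (i + 1) ≤ α.rowLen i := by
  simp only [Strip, le_iff_rowLen, true_imp_iff, not_true_eq_false, false_imp_iff, and_true,
    forall_and, YoungDiagram.mem_iff_lt_rowLen]
  exact and_congr_right fun _ => forall_congr' fun i => forall_lt_iff_le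

theorem strip_false_iff {α β : YoungDiagram} :
    Strip False α β ↔ ∀ i, α.rowLen i ≤ β.rowLen i ∧ β.rowLen i ≤ α.rowLen i + 1 := by
  simp only [Strip, le_iff_rowLen, not_false_eq_true, true_imp_iff, false_imp_iff, true_and,
    forall_and, YoungDiagram.mem_iff_lt_rowLen]
  refine and_congr_right fun _ => forall_congr' fun i => ?_
  constructor
  · intro h
    by_contra! hlt
    exact lt_irrefl _ (h _ hlt)
  · intro h j hj
    omega

open Classical in
/-- The diagrams obtained from `α` by adding a strip of size `k`. -/
noncomputable def stripSet (t : Prop) (k : ℕ) (α : YoungDiagram) : Finset YoungDiagram :=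
  (finite_card_le (α.card + k)).toFinset.filter fun β => Strip t α β ∧ β.card = α.card + k

theorem mem_stripSet {t : Prop} {k : ℕ} {α β : YoungDiagram} :
    β ∈ stripSet t k α ↔ Strip t α β ∧ β.card = α.card + k := by
  simp only [stripSet, mem_filter, Set.Finite.mem_toFinset, Set.mem_ofPred_eq, and_iff_right_iff_imp]
  exact fun h => h.2.le

/-- The operator that adds strips of size `k` in all possible ways. -/
noncomputable def addStrip (t : Prop) (k : ℕ) : Module.End ℚ (YoungDiagram →₀ ℚ) :=
  Finsupp.linearCombination ℚ fun α => ∑ β ∈ stripSet t k α, Finsupp.single β 1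

theorem addStrip_single (t : Prop) (k : ℕ) (α : YoungDiagram) :
    addStrip t k (Finsupp.single α 1) = ∑ β ∈ stripSet t k α, Finsupp.single β 1 := by
  simp [addStrip]

open Classical in
theorem addStrip_apply (t : Prop) (k : ℕ) (x : YoungDiagram →₀ ℚ) (β : YoungDiagram) :
    addStrip t k x β = ∑ ν ∈ (finite_card_le β.card).toFinset,
      x ν * if Strip t ν β ∧ β.card = ν.card + k then 1 else 0 := by
  induction x using Finsupp.induction_linear with
  | zero => simp
  | add x y hx hy => simp only [map_add, Finsupp.add_apply, hx, hy, add_mul, Finset.sum_add_distrib]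
  | single α a =>
    rw [addStrip, Finsupp.linearCombination_single, Finsupp.smul_apply, Finsupp.finsetSum_apply]
    simp only [Finsupp.single_apply, Finset.sum_ite_eq', mem_stripSet]
    by_cases h : Strip t α β ∧ β.card = α.card + k
    · rw [Finset.sum_eq_single α]
      · simp
      · intro ν _ hν
        rw [if_neg hν.symm, zero_mul]
      · intro hα
        exfalso
        apply hα
        simp only [Set.Finite.mem_toFinset, Set.mem_ofPred_eq]
        omega
    · rw [if_neg h, smul_zero, eq_comm]
      refine Finset.sum_eq_zero fun ν _ => ?_
      split_ifs with h1 h2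
      · exact absurd (h1 ▸ h2) h
      all_goals simp

open Classical in
theorem addStrip_addStrip_apply (t t' : Prop) (i j : ℕ) (α β : YoungDiagram) :
    addStrip t i (addStrip t' j (Finsupp.single α 1)) β =
      ∑ ν ∈ (finite_card_le β.card).toFinset,
        if (Strip t' α ν ∧ ν.card = α.card + j) ∧ Strip t ν β ∧ β.card = ν.card + i
          then 1 else 0 := by
  rw [addStrip_apply]
  refine Finset.sum_congr rfl fun ν _ => ?_
  rw [addStrip_single, Finsupp.finsetSum_apply]
  simp only [Finsupp.single_apply, Finset.sum_ite_eq', mem_stripSet, ite_and]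
  split_ifs <;> simp

/-- The row lengths of the reflection of `ν` between `α` and `β`. -/
def flipRow (α β ν : YoungDiagram) : ℕ → ℕ
  | 0 => max (α.rowLen 0) (β.rowLen (0 + 1)) + β.rowLen 0 - ν.rowLen 0
  | i + 1 => max (α.rowLen (i + 1)) (β.rowLen (i + 1 + 1)) + min (β.rowLen (i + 1)) (α.rowLen i) -
      ν.rowLen (i + 1)

/-- If `ν/α` and `β/ν` are horizontal strips, row `i` of `ν` ranges independently of the other rows
over the interval from `max(α_i, β_{i+1})` to `min(β_i, α_{i-1})`, the upper end being `β_0` for `i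
= 0`. Reflecting every row in its interval, as in the Bender–Knuth involution, again gives such a
diagram. -/
theorem flipRow_spec {α β ν : YoungDiagram} (h1 : Strip True α ν) (h2 : Strip True ν β) :
    ∀ i, (ofRows (flipRow α β ν)).rowLen i = flipRow α β ν i := by
  rw [strip_true_iff] at h1 h2
  refine rowLen_ofRows (N := β.colLen 0 + 1) (fun i => ?_) ?_
  · cases i with
    | zero =>
      have := h1 0; have := h1 (0 + 1); have := h2 0; have := h2 (0 + 1)
      simp only [flipRow]
      omega
    | succ i =>
      have := h1 i; have := h1 (i + 1); have := h1 (i + 1 + 1)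
      have := h2 i; have := h2 (i + 1); have := h2 (i + 1 + 1)
      simp only [flipRow]
      omega
  · have := h1 (β.colLen 0); have := h1 (β.colLen 0 + 1)
    have := h2 (β.colLen 0); have := h2 (β.colLen 0 + 1)
    have : β.rowLen (β.colLen 0) = 0 := rowLen_eq_zero.2 le_rfl
    have : β.rowLen (β.colLen 0 + 1 + 1) = 0 := rowLen_eq_zero.2 (by omega)
    simp only [flipRow]
    omega

theorem strip_flip {α β ν : YoungDiagram} (h1 : Strip True α ν) (h2 : Strip True ν β) :
    Strip True α (ofRows (flipRow α β ν)) ∧ Strip True (ofRows (flipRow α β ν)) β := by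
  have h := flipRow_spec h1 h2
  rw [strip_true_iff] at h1 h2 ⊢
  rw [strip_true_iff]
  simp only [h]
  refine ⟨fun i => ?_, fun i => ?_⟩ <;> cases i with
    | zero =>
      have := h1 0; have := h1 (0 + 1); have := h2 0; have := h2 (0 + 1)
      simp only [flipRow]
      omega
    | succ i =>
      have := h1 i; have := h1 (i + 1); have := h1 (i + 1 + 1)
      have := h2 i; have := h2 (i + 1); have := h2 (i + 1 + 1)
      simp only [flipRow]
      omega

theorem flip_flip {α β ν : YoungDiagram} (h1 : Strip True α ν) (h2 : Strip True ν β) :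
    ofRows (flipRow α β (ofRows (flipRow α β ν))) = ν := by
  have h3 := strip_flip h1 h2
  have h := flipRow_spec h1 h2
  have h' := flipRow_spec h3.1 h3.2
  refine rowLen_ext fun i => ?_
  rw [h']
  rw [strip_true_iff] at h1 h2
  cases i with
  | zero =>
    have := h1 0; have := h2 0
    simp only [flipRow, h]
    omega
  | succ i =>
    have := h1 i; have := h1 (i + 1); have := h2 i; have := h2 (i + 1)
    simp only [flipRow, h]
    omega

/-- The reflection exchanges the sizes of the two strips, because the ends of the intervals add up
to `|α| + |β|`. -/
theorem card_flip {α β ν : YoungDiagram} (h1 : Strip True α ν) (h2 : Strip True ν β) :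
    (ofRows (flipRow α β ν)).card + ν.card = α.card + β.card := by
  have h3 := (strip_flip h1 h2).2
  have h := flipRow_spec h1 h2
  rw [strip_true_iff] at h1 h2 h3
  set N := β.colLen 0
  have hβ : β.rowLen (N + 1) = 0 := rowLen_eq_zero.2 (by omega)
  have := h2 (N + 1); have := h1 (N + 1); have := h3 (N + 1)
  rw [card_eq_sum_rowLen (N := N + 1) (by omega), card_eq_sum_rowLen (N := N + 1) (by omega),
    card_eq_sum_rowLen (N := N + 1) (by omega), card_eq_sum_rowLen (N := N + 1) hβ]
  simp only [h]
  -- The lower end in row `i` and the upper end in row `i + 1` are the maximum and the minimum of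
  -- the same two numbers `α_i` and `β_{i+1}`. Only the lower end of the last row remains unpaired.
  have key (n : ℕ) : ∑ i ∈ range (n + 1), flipRow α β ν i + ∑ i ∈ range (n + 1), ν.rowLen i =
      ∑ i ∈ range n, α.rowLen i + ∑ i ∈ range (n + 1), β.rowLen i +
        max (α.rowLen n) (β.rowLen (n + 1)) := by
    induction n with
    | zero =>
      have := h1 0; have := h2 0
      simp [flipRow]
      omega
    | succ n ih =>
      rw [Finset.sum_range_succ (flipRow α β ν) (n + 1),
        Finset.sum_range_succ (fun i => ν.rowLen i) (n + 1),
        Finset.sum_range_succ (fun i => β.rowLen i) (n + 1),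
        Finset.sum_range_succ (fun i => α.rowLen i) n]
      have := h1 n; have := h2 n
      have := h1 (n + 1); have := h2 (n + 1)
      have : flipRow α β ν (n + 1) + ν.rowLen (n + 1) = max (α.rowLen (n + 1)) (β.rowLen (n + 1 + 1)) +
          min (β.rowLen (n + 1)) (α.rowLen n) := by
        simp only [flipRow]
        omega
      omega
  rw [key, hβ, Finset.sum_range_succ (fun i => α.rowLen i) N]
  simp
  omega

theorem addStrip_true_comm (i j : ℕ) :
    addStrip True i * addStrip True j = addStrip True j * addStrip True i := by
  classical
  refine Finsupp.lhom_ext' fun α => LinearMap.ext_ring (Finsupp.ext fun β => ?_)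
  simp only [LinearMap.comp_apply, Finsupp.lsingle_apply, Module.End.mul_apply]
  rw [addStrip_addStrip_apply, addStrip_addStrip_apply, Finset.sum_boole, Finset.sum_boole]
  congr 1
  have key (i j : ℕ) (ν : YoungDiagram)
      (hν : ν ∈ (finite_card_le β.card).toFinset.filter fun ν =>
        (Strip True α ν ∧ ν.card = α.card + j) ∧ Strip True ν β ∧ β.card = ν.card + i) :
      ofRows (flipRow α β ν) ∈ (finite_card_le β.card).toFinset.filter fun ν =>
        (Strip True α ν ∧ ν.card = α.card + i) ∧ Strip True ν β ∧ β.card = ν.card + j := by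
    simp only [mem_filter, Set.Finite.mem_toFinset, Set.mem_ofPred_eq] at hν ⊢
    obtain ⟨-, ⟨h1, h2⟩, h3, h4⟩ := hν
    have h5 := card_flip h1 h3
    have h6 := strip_flip h1 h3
    exact ⟨by omega, ⟨h6.1, by omega⟩, h6.2, by omega⟩
  refine Finset.card_bij' (fun ν _ => ofRows (flipRow α β ν)) (fun ν _ => ofRows (flipRow α β ν))
    (key i j) (key j i) ?_ ?_
  all_goals
    intro ν hν
    rw [mem_filter] at hν
    exact flip_flip hν.2.1.1 hν.2.2.1

/-- The row lengths of `ν` with the row `r` toggled between the two values that are possible in a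
vertical strip of outer shape `β`. -/
def toggleRow (r : ℕ) (β ν : YoungDiagram) (i : ℕ) : ℕ :=
  if i = r then 2 * β.rowLen r - 1 - ν.rowLen r else ν.rowLen i

/-- Row `r` of `ν` is `β_r` or `β_r - 1`, and both values are admissible: the rows of `α` above `r`
are those of `β`, hence at least `β_r`, while `α_r` and therefore `ν_{r+1}` are at most `β_r - 1`.
-/
theorem toggle_spec {r : ℕ} {α β ν : YoungDiagram} (h1 : Strip True α ν) (h2 : Strip False ν β)
    (hr : α.rowLen r < β.rowLen r) (hr' : ∀ i < r, α.rowLen i = β.rowLen i) :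
    ∀ i, (ofRows (toggleRow r β ν)).rowLen i = toggleRow r β ν i := by
  rw [strip_true_iff] at h1
  rw [strip_false_iff] at h2
  refine rowLen_ofRows (N := max (r + 1) (β.colLen 0)) (fun i => ?_) ?_
  · have := h1 i; have := h1 (i + 1); have := h2 i; have := h2 (i + 1)
    have := hr' i
    have := β.rowLen_anti i (i + 1) (Nat.le_succ i)
    simp only [toggleRow]
    split_ifs with h3 h4 h4
    · omega
    · subst h3
      omega
    · subst h4
      omega
    · omega
  · have := h2 (max (r + 1) (β.colLen 0))
    have : β.rowLen (max (r + 1) (β.colLen 0)) = 0 := rowLen_eq_zero.2 (le_max_right _ _)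
    rw [toggleRow, if_neg (by omega)]
    omega

theorem strip_toggle {r : ℕ} {α β ν : YoungDiagram} (h1 : Strip True α ν) (h2 : Strip False ν β)
    (hr : α.rowLen r < β.rowLen r) (hr' : ∀ i < r, α.rowLen i = β.rowLen i) :
    Strip True α (ofRows (toggleRow r β ν)) ∧ Strip False (ofRows (toggleRow r β ν)) β := by
  have h := toggle_spec h1 h2 hr hr'
  rw [strip_true_iff] at h1 ⊢
  rw [strip_false_iff] at h2 ⊢
  simp only [h, toggleRow]
  refine ⟨fun i => ?_, fun i => ?_⟩
  · have := h1 i; have := h1 (i + 1); have := h2 i; have := h2 (i + 1)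
    have := hr' i
    have := β.rowLen_anti i (i + 1) (Nat.le_succ i)
    split_ifs with h3 h4 h4
    · omega
    · subst h3
      omega
    · subst h4
      omega
    · omega
  · have := h1 i; have := h2 i
    split_ifs with h3
    · subst h3
      omega
    · omega

theorem toggle_toggle {r : ℕ} {α β ν : YoungDiagram} (h1 : Strip True α ν) (h2 : Strip False ν β)
    (hr : α.rowLen r < β.rowLen r) (hr' : ∀ i < r, α.rowLen i = β.rowLen i) :
    ofRows (toggleRow r β (ofRows (toggleRow r β ν))) = ν := by
  have h3 := strip_toggle h1 h2 hr hr'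
  have h := toggle_spec h1 h2 hr hr'
  have h' := toggle_spec h3.1 h3.2 hr hr'
  refine rowLen_ext fun i => ?_
  rw [h', toggleRow, h, h, toggleRow, toggleRow, if_pos rfl]
  rw [strip_false_iff] at h2
  have := h2 r
  split_ifs with h4
  · subst h4
    omega
  · rfl

theorem card_toggle {r : ℕ} {α β ν : YoungDiagram} (h1 : Strip True α ν) (h2 : Strip False ν β)
    (hr : α.rowLen r < β.rowLen r) (hr' : ∀ i < r, α.rowLen i = β.rowLen i) :
    (ofRows (toggleRow r β ν)).card + ν.rowLen r = ν.card + (2 * β.rowLen r - 1 - ν.rowLen r) := by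
  have h3 := (strip_toggle h1 h2 hr hr').2
  have h := toggle_spec h1 h2 hr hr'
  rw [strip_false_iff] at h2 h3
  set N := max (r + 1) (β.colLen 0)
  have hβ : β.rowLen N = 0 := rowLen_eq_zero.2 (le_max_right _ _)
  have := h2 N; have := h3 N
  have hmem : r ∈ range N := by
    rw [mem_range]
    omega
  rw [card_eq_sum_rowLen (N := N) (by omega), card_eq_sum_rowLen (α := ν) (N := N) (by omega),
    ← Finset.add_sum_erase _ _ hmem, ← Finset.add_sum_erase _ _ hmem]
  have : ∑ i ∈ (range N).erase r, (ofRows (toggleRow r β ν)).rowLen i =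
      ∑ i ∈ (range N).erase r, ν.rowLen i := by
    refine Finset.sum_congr rfl fun i hi => ?_
    rw [h, toggleRow, if_neg (Finset.ne_of_mem_erase hi)]
  rw [this, h, toggleRow, if_pos rfl]
  omega

/-- The operator form of `E(-t) H(t) = 1`. The coefficient at `α`, `β` is a signed count of the
diagrams `ν` between them, and toggling one row of `ν` reverses the sign unless `α = β`. -/
theorem sum_addStrip_mul_addStrip (n : ℕ) :
    ∑ c ∈ antidiagonal n, (-1 : ℚ) ^ c.1 • (addStrip False c.1 * addStrip True c.2) =
      if n = 0 then 1 else 0 := by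
  classical
  refine Finsupp.lhom_ext' fun α => LinearMap.ext_ring (Finsupp.ext fun β => ?_)
  have h0 : (if n = 0 then 1 else 0 : Module.End ℚ (YoungDiagram →₀ ℚ)) (Finsupp.single α 1) β =
      if n = 0 ∧ α = β then 1 else 0 := by
    by_cases hn : n = 0 <;> simp [hn, Finsupp.single_apply]
  simp only [LinearMap.comp_apply, Finsupp.lsingle_apply]
  rw [h0]
  simp only [LinearMap.sum_apply, LinearMap.smul_apply, Module.End.mul_apply,
    Finsupp.finsetSum_apply, Finsupp.smul_apply, addStrip_addStrip_apply, smul_eq_mul,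
    Finset.mul_sum]
  rw [Finset.sum_comm]
  -- The diagram `ν` determines both strip sizes, so at most one pair in the antidiagonal
  -- contributes.
  have key : ∀ ν ∈ (finite_card_le β.card).toFinset, (∑ c ∈ antidiagonal n, (-1 : ℚ) ^ c.1 *
      if (Strip True α ν ∧ ν.card = α.card + c.2) ∧ Strip False ν β ∧ β.card = ν.card + c.1
        then 1 else 0) =
      if Strip True α ν ∧ Strip False ν β ∧ β.card = α.card + n then
        (-1) ^ (β.card - ν.card) else 0 := by
    intro ν _
    split_ifs with h
    · obtain ⟨h1, h2, h3⟩ := h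
      have h4 : α.card ≤ ν.card := Finset.card_le_card h1.1
      have h5 : ν.card ≤ β.card := Finset.card_le_card h2.1
      rw [Finset.sum_eq_single (β.card - ν.card, ν.card - α.card)]
      · rw [if_pos ⟨⟨h1, by simp only; omega⟩, h2, by simp only; omega⟩, mul_one]
      · rintro ⟨i, j⟩ _ hc
        rw [if_neg, mul_zero]
        rintro ⟨⟨-, h6⟩, -, h7⟩
        refine hc (Prod.ext ?_ ?_) <;> simp only at * <;> omega
      · intro h6
        rw [HasAntidiagonal.mem_antidiagonal] at h6
        simp only at h6
        omega
    · refine Finset.sum_eq_zero fun c hc => ?_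
      rw [if_neg, mul_zero]
      rintro ⟨⟨h1, h2⟩, h3, h4⟩
      rw [HasAntidiagonal.mem_antidiagonal] at hc
      exact h ⟨h1, h3, by omega⟩
  rw [Finset.sum_congr rfl key]
  by_cases hαβ : α = β
  · subst hαβ
    by_cases hn : n = 0
    · rw [Finset.sum_eq_single α]
      · have h1 : Strip True α α :=
          strip_true_iff.2 fun i => ⟨le_rfl, α.rowLen_anti _ _ (Nat.le_succ i)⟩
        have h2 : Strip False α α := strip_false_iff.2 fun i => ⟨le_rfl, Nat.le_succ _⟩
        simp [hn, h1, h2]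
      · intro ν _ hν
        refine if_neg fun h => hν ?_
        exact le_antisymm h.2.1.1 h.1.1
      · simp
    · rw [if_neg (by simp [hn])]
      refine Finset.sum_eq_zero fun ν _ => if_neg fun h => ?_
      omega
  · rw [if_neg (by simp [hαβ])]
    by_cases hle : α ≤ β
    swap
    · refine Finset.sum_eq_zero fun ν _ => if_neg fun h => hle (h.1.1.trans h.2.1.1)
    -- The row to toggle is the first one in which `α` and `β` differ. It does not depend on `ν`, so
    -- toggling is an involution, and it changes the size of `ν` by one.
    have hex : ∃ r, α.rowLen r < β.rowLen r := by
      by_contra! h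
      exact hαβ (rowLen_ext fun i => le_antisymm (le_iff_rowLen.1 hle i) (h i))
    have hr := Nat.find_spec hex
    have hr' : ∀ i < Nat.find hex, α.rowLen i = β.rowLen i := fun i hi =>
      le_antisymm (le_iff_rowLen.1 hle i) (not_lt.1 (Nat.find_min hex hi))
    set r := Nat.find hex
    rw [← Finset.sum_filter]
    refine Finset.sum_involution (fun ν _ => ofRows (toggleRow r β ν)) ?_ ?_ ?_ ?_
    · intro ν hν
      simp only [mem_filter, Set.Finite.mem_toFinset, Set.mem_ofPred_eq] at hν
      obtain ⟨h0, h1, h2, h3⟩ := hν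
      have h4 := card_toggle h1 h2 hr hr'
      have h5 := (strip_toggle h1 h2 hr hr').2
      have h6 := strip_false_iff.1 h2 r
      have h7 : (ofRows (toggleRow r β ν)).card ≤ β.card := Finset.card_le_card h5.1
      have h8 : β.card - ν.card = β.card - (ofRows (toggleRow r β ν)).card + 1 ∨
        β.card - ν.card + 1 = β.card - (ofRows (toggleRow r β ν)).card := by omega
      rcases h8 with h8 | h8
      · rw [h8, pow_succ]
        ring
      · rw [← h8, pow_succ]
        ring
    · intro ν hν _ heq
      simp only [mem_filter, Set.Finite.mem_toFinset, Set.mem_ofPred_eq] at hν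
      obtain ⟨h0, h1, h2, h3⟩ := hν
      have h4 := card_toggle h1 h2 hr hr'
      rw [heq] at h4
      omega
    · intro ν hν
      simp only [mem_filter, Set.Finite.mem_toFinset, Set.mem_ofPred_eq] at hν ⊢
      obtain ⟨h0, h1, h2, h3⟩ := hν
      have h5 := strip_toggle h1 h2 hr hr'
      exact ⟨Finset.card_le_card h5.2.1, h5.1, h5.2, h3⟩
    · intro ν hν
      simp only [mem_filter, Set.Finite.mem_toFinset, Set.mem_ofPred_eq] at hν
      exact toggle_toggle hν.2.1 hν.2.2.1 hr hr'

theorem addStrip_zero (t : Prop) : addStrip t 0 = 1 := by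
  refine Finsupp.lhom_ext' fun α => LinearMap.ext_ring ?_
  simp only [LinearMap.comp_apply, Finsupp.lsingle_apply, Module.End.one_apply, addStrip_single]
  have : stripSet t 0 α = {α} := by
    ext β
    rw [mem_stripSet, mem_singleton]
    constructor
    · rintro ⟨h1, h2⟩
      exact (YoungDiagram.ext (Finset.eq_of_subset_of_card_le h1.1 h2.le)).symm
    · rintro rfl
      exact ⟨⟨le_rfl, fun _ i j h => β.up_left_mem (Nat.le_succ i) le_rfl h,
        fun _ i j h => β.up_left_mem le_rfl (Nat.le_succ j) h⟩, rfl⟩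
  rw [this, Finset.sum_singleton]

/-- Symmetric functions act on the free module on Young diagrams, through the Pieri rules. -/
theorem exists_pieri_hom : ∃ φ : SymFun →ₐ[ℚ] Module.End ℚ (YoungDiagram →₀ ℚ),
    (∀ n, φ (complete n) = addStrip True n) ∧ ∀ n, φ (elementary n) = addStrip False n := by
  have hcomm : ∀ a ∈ Set.range (addStrip True), ∀ b ∈ Set.range (addStrip True),
      a * b = b * a := by
    rintro _ ⟨i, rfl⟩ _ ⟨j, rfl⟩
    exact addStrip_true_comm i j
  -- `exists_hom_complete` needs a commutative target, so the homomorphism is first built into the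
  -- subalgebra generated by the commuting operators.
  have := Algebra.isMulCommutative_adjoin ℚ hcomm
  open scoped IsMulCommutative in
  obtain ⟨φ, hφ⟩ := exists_hom_complete (A := Algebra.adjoin ℚ (Set.range (addStrip True)))
    (a := fun n => ⟨addStrip True n, Algebra.subset_adjoin ⟨n, rfl⟩⟩)
    (Subtype.ext (addStrip_zero True))
  have h1 (n : ℕ) : (Subalgebra.val _).comp φ (complete n) = addStrip True n := by
    rw [AlgHom.comp_apply, hφ]
    rfl
  refine ⟨(Subalgebra.val _).comp φ, h1, fun n => ?_⟩
  generalize (Subalgebra.val _).comp φ = ψ at h1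
  have hrel (n : ℕ) : ∑ c ∈ antidiagonal n, (-1 : ℚ) ^ c.1 • (ψ (elementary c.1) * ψ (complete c.2)) =
      if n = 0 then 1 else 0 := by
    have h2 := congrArg (PowerSeries.coeff n)
      (completeSeries_mul_rescale_elementarySeries (AlgHom.id ℚ SymFun))
    rw [mul_comm, PowerSeries.coeff_mul, PowerSeries.coeff_one] at h2
    have h3 := congrArg ψ h2
    simp only [completeSeries, elementarySeries, PowerSeries.coeff_rescale, PowerSeries.coeff_mk,
      AlgHom.id_apply, map_sum] at h3
    rw [apply_ite ψ, map_one, map_zero] at h3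
    rw [← h3]
    refine Finset.sum_congr rfl fun c _ => ?_
    rw [map_mul, map_mul, map_pow, map_neg, map_one, Algebra.smul_def]
    simp [mul_assoc]
  -- The relation `E(-t) H(t) = 1` determines the `e_n` from the `h_n`: the term `(n, 0)` is `±
  -- e_n`, all others involve smaller indices, and the strip operators satisfy the same relation.
  induction n using Nat.strong_induction_on with
  | _ n ih =>
    have h4 := (hrel n).trans (sum_addStrip_mul_addStrip n).symm
    have hmem : (n, 0) ∈ antidiagonal n := by simp
    rw [← Finset.add_sum_erase _ _ hmem, ← Finset.add_sum_erase _ _ hmem] at h4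
    rw [Finset.sum_congr rfl (g := fun c : ℕ × ℕ =>
      (-1 : ℚ) ^ c.1 • (addStrip False c.1 * addStrip True c.2)) fun c hc => by
        rw [mem_erase, HasAntidiagonal.mem_antidiagonal] at hc
        rw [h1, ih]
        by_contra! hlt
        exact hc.1 (Prod.ext (by simp only; omega) (by simp only; omega)), h1, addStrip_zero,
      mul_one, mul_one] at h4
    have h5 := add_right_cancel h4
    exact smul_right_injective _ (show ((-1 : ℚ) ^ n) ≠ 0 by simp) h5

end SymChar

namespace SymChar
open Finset

/-! ### Fillings and chains of strips -/

/-- A filling of `shape` by labels below `r` that is weakly increasing along rows and columns, in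
which the label `k` occurs `n k` times, and may be repeated within a row if `t k` holds, within a
column otherwise. -/
@[ext]
structure Filling (t : ℕ → Prop) (n : ℕ → ℕ) (r : ℕ) where
  shape : YoungDiagram
  entry : ℕ → ℕ → ℕ
  row_weak : ∀ i j₁ j₂, j₁ < j₂ → (i, j₂) ∈ shape → entry i j₁ ≤ entry i j₂
  row_repeat : ∀ i j₁ j₂, j₁ < j₂ → (i, j₂) ∈ shape → entry i j₁ = entry i j₂ → t (entry i j₁)
  col_weak : ∀ i₁ i₂ j, i₁ < i₂ → (i₂, j) ∈ shape → entry i₁ j ≤ entry i₂ j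
  col_repeat : ∀ i₁ i₂ j, i₁ < i₂ → (i₂, j) ∈ shape → entry i₁ j = entry i₂ j → ¬t (entry i₁ j)
  zeros : ∀ i j, (i, j) ∉ shape → entry i j = 0
  lt : ∀ i j, (i, j) ∈ shape → entry i j < r
  count : ∀ k < r, (shape.cells.filter fun c => entry c.1 c.2 = k).card = n k

namespace Filling

variable {t : ℕ → Prop} {n : ℕ → ℕ} {r : ℕ}

/-- The shape formed by the labels below `r`. -/
def lowerShape (F : Filling t n (r + 1)) : YoungDiagram where
  cells := F.shape.cells.filter fun c => F.entry c.1 c.2 < r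
  isLowerSet := by
    rintro ⟨i, j⟩ ⟨i', j'⟩ ⟨h1, h2⟩ hc
    simp only [coe_filter, YoungDiagram.mem_cells, Set.mem_ofPred_eq] at hc h1 h2 ⊢
    refine ⟨F.shape.up_left_mem h1 h2 hc.1, ?_⟩
    have h3 : F.entry i' j' ≤ F.entry i' j := by
      rcases h2.lt_or_eq with h | h
      · exact F.row_weak _ _ _ h (F.shape.up_left_mem h1 le_rfl hc.1)
      · rw [h]
    have h4 : F.entry i' j ≤ F.entry i j := by
      rcases h1.lt_or_eq with h | h
      · exact F.col_weak _ _ _ h hc.1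
      · rw [h]
    omega

theorem mem_lowerShape {F : Filling t n (r + 1)} {i j : ℕ} :
    (i, j) ∈ F.lowerShape ↔ (i, j) ∈ F.shape ∧ F.entry i j < r := by
  rw [← YoungDiagram.mem_cells, lowerShape, mem_filter, YoungDiagram.mem_cells]

open Classical in
/-- The restriction of a filling to the labels below `r`. -/
noncomputable def lower (F : Filling t n (r + 1)) : Filling t n r where
  shape := F.lowerShape
  entry i j := if (i, j) ∈ F.lowerShape then F.entry i j else 0
  row_weak i j₁ j₂ hj h := by
    rw [if_pos h, if_pos (F.lowerShape.up_left_mem le_rfl hj.le h)]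
    exact F.row_weak i j₁ j₂ hj (mem_lowerShape.1 h).1
  row_repeat i j₁ j₂ hj h := by
    rw [if_pos h, if_pos (F.lowerShape.up_left_mem le_rfl hj.le h)]
    exact F.row_repeat i j₁ j₂ hj (mem_lowerShape.1 h).1
  col_weak i₁ i₂ j hi h := by
    rw [if_pos h, if_pos (F.lowerShape.up_left_mem hi.le le_rfl h)]
    exact F.col_weak i₁ i₂ j hi (mem_lowerShape.1 h).1
  col_repeat i₁ i₂ j hi h := by
    rw [if_pos h, if_pos (F.lowerShape.up_left_mem hi.le le_rfl h)]
    exact F.col_repeat i₁ i₂ j hi (mem_lowerShape.1 h).1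
  zeros i j h := if_neg h
  lt i j h := by
    rw [if_pos h]
    exact (mem_lowerShape.1 h).2
  count k hk := by
    rw [← F.count k (by omega)]
    congr 1
    ext ⟨i, j⟩
    simp only [mem_filter, YoungDiagram.mem_cells]
    constructor
    · rintro ⟨h1, h2⟩
      rw [if_pos h1] at h2
      exact ⟨(mem_lowerShape.1 h1).1, h2⟩
    · rintro ⟨h1, h2⟩
      have h3 : (i, j) ∈ F.lowerShape := mem_lowerShape.2 ⟨h1, by omega⟩
      exact ⟨h3, by rwa [if_pos h3]⟩

/-- The cells with the largest label `r` form an outer rim. Two of them cannot share a column if `t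
r` holds, nor a row otherwise, which is the strip condition. -/
theorem shape_mem_stripSet (F : Filling t n (r + 1)) :
    F.shape ∈ stripSet (t r) (n r) F.lowerShape := by
  have hr : ∀ i j, (i, j) ∈ F.shape → (i, j) ∉ F.lowerShape → F.entry i j = r := by
    intro i j h1 h2
    rw [mem_lowerShape, not_and] at h2
    have := h2 h1
    have := F.lt i j h1
    omega
  refine mem_stripSet.2 ⟨⟨fun ⟨i, j⟩ h => (mem_lowerShape.1 h).1, fun ht i j h => ?_,
    fun ht i j h => ?_⟩, ?_⟩
  · by_contra hn
    have h1 : (i, j) ∈ F.shape := F.shape.up_left_mem (Nat.le_succ i) le_rfl h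
    have h2 := hr i j h1 hn
    have h3 := F.col_weak i (i + 1) j (Nat.lt_succ_self i) h
    have h4 := F.lt _ _ h
    refine F.col_repeat i (i + 1) j (Nat.lt_succ_self i) h (by omega) ?_
    rwa [h2]
  · by_contra hn
    have h1 : (i, j) ∈ F.shape := F.shape.up_left_mem le_rfl (Nat.le_succ j) h
    have h2 := hr i j h1 hn
    have h3 := F.row_weak i j (j + 1) (Nat.lt_succ_self j) h
    have h4 := F.lt _ _ h
    apply ht
    rw [← h2]
    exact F.row_repeat i j (j + 1) (Nat.lt_succ_self j) h (by omega)
  · rw [← F.count r (Nat.lt_succ_self r), YoungDiagram.card, YoungDiagram.card,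
      ← Finset.card_filter_add_card_filter_not (fun c => F.entry c.1 c.2 < r)]
    congr 2
    refine Finset.filter_congr fun c hc => ?_
    have := F.lt c.1 c.2 hc
    omega

open Classical in
/-- The extension of a filling by a strip labelled `r`. -/
noncomputable def extend (F : Filling t n r) (β : YoungDiagram)
    (hβ : β ∈ stripSet (t r) (n r) F.shape) : Filling t n (r + 1) where
  shape := β
  entry i j := if (i, j) ∈ F.shape then F.entry i j else if (i, j) ∈ β then r else 0
  row_weak i j₁ j₂ hj h := by
    have h' := β.up_left_mem le_rfl hj.le h
    by_cases h2 : (i, j₂) ∈ F.shape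
    · rw [if_pos h2, if_pos (F.shape.up_left_mem le_rfl hj.le h2)]
      exact F.row_weak i j₁ j₂ hj h2
    · rw [if_neg h2, if_pos h, if_pos h']
      split_ifs with h1
      · exact (F.lt _ _ h1).le
      · exact le_rfl
  row_repeat i j₁ j₂ hj h := by
    have h' := β.up_left_mem le_rfl hj.le h
    by_cases h2 : (i, j₂) ∈ F.shape
    · rw [if_pos h2, if_pos (F.shape.up_left_mem le_rfl hj.le h2)]
      exact F.row_repeat i j₁ j₂ hj h2
    · rw [if_neg h2, if_pos h, if_pos h']
      split_ifs with h1
      · have := F.lt _ _ h1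
        omega
      · intro _
        by_contra ht
        obtain ⟨j, rfl⟩ : ∃ j, j₂ = j + 1 := ⟨j₂ - 1, by omega⟩
        exact h1 (F.shape.up_left_mem le_rfl (by omega) ((mem_stripSet.1 hβ).1.2.2 ht i j h))
  col_weak i₁ i₂ j hi h := by
    have h' := β.up_left_mem hi.le le_rfl h
    by_cases h2 : (i₂, j) ∈ F.shape
    · rw [if_pos h2, if_pos (F.shape.up_left_mem hi.le le_rfl h2)]
      exact F.col_weak i₁ i₂ j hi h2
    · rw [if_neg h2, if_pos h, if_pos h']
      split_ifs with h1
      · exact (F.lt _ _ h1).le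
      · exact le_rfl
  col_repeat i₁ i₂ j hi h := by
    have h' := β.up_left_mem hi.le le_rfl h
    by_cases h2 : (i₂, j) ∈ F.shape
    · rw [if_pos h2, if_pos (F.shape.up_left_mem hi.le le_rfl h2)]
      exact F.col_repeat i₁ i₂ j hi h2
    · rw [if_neg h2, if_pos h, if_pos h']
      split_ifs with h1
      · have := F.lt _ _ h1
        omega
      · intro _ ht
        obtain ⟨i, rfl⟩ : ∃ i, i₂ = i + 1 := ⟨i₂ - 1, by omega⟩
        exact h1 (F.shape.up_left_mem (by omega) le_rfl ((mem_stripSet.1 hβ).1.2.1 ht i j h))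
  zeros i j h := by
    rw [if_neg (fun h1 => h ((mem_stripSet.1 hβ).1.1 h1)), if_neg h]
  lt i j h := by
    rw [if_pos h]
    split_ifs with h1
    · have := F.lt _ _ h1
      omega
    · omega
  count k hk := by
    have hsub := (mem_stripSet.1 hβ).1.1
    have hcard := (mem_stripSet.1 hβ).2
    rcases Nat.lt_succ_iff_lt_or_eq.1 hk with hk | rfl
    · rw [← F.count k hk]
      congr 1
      ext ⟨i, j⟩
      simp only [mem_filter, YoungDiagram.mem_cells]
      constructor
      · rintro ⟨h1, h2⟩
        rw [if_pos h1] at h2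
        split_ifs at h2 with h3
        · exact ⟨h3, h2⟩
        · omega
      · rintro ⟨h1, h2⟩
        exact ⟨hsub h1, by rwa [if_pos h1]⟩
    · have h1 : (β.cells.filter fun c => (if (c.1, c.2) ∈ F.shape then F.entry c.1 c.2 else
          if (c.1, c.2) ∈ β then k else 0) = k) = β.cells \ F.shape.cells := by
        ext ⟨i, j⟩
        simp only [mem_filter, YoungDiagram.mem_cells, mem_sdiff]
        refine and_congr_right fun h1 => ?_
        rw [if_pos h1]
        split_ifs with h2
        · have := F.lt _ _ h2
          simp only [h2, not_true_eq_false, iff_false]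
          omega
        · simp [h2]
      rw [h1, Finset.card_sdiff_of_subset hsub]
      simp only [YoungDiagram.card] at hcard
      omega

open Classical in
/-- A filling is a smaller filling together with a strip. -/
noncomputable def succEquiv : Filling t n (r + 1) ≃
    Σ F : Filling t n r, {β // β ∈ stripSet (t r) (n r) F.shape} where
  toFun F := ⟨F.lower, F.shape, F.shape_mem_stripSet⟩
  invFun p := p.1.extend p.2.1 p.2.2
  left_inv F := by
    refine Filling.ext rfl ?_
    funext i j
    simp only [extend, lower, mem_lowerShape]
    by_cases h1 : (i, j) ∈ F.shape
    · have := F.lt _ _ h1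
      by_cases h2 : F.entry i j < r
      · simp [h1, h2]
      · simp only [h1, h2, and_false, if_false, if_true]
        omega
    · simp [h1, F.zeros _ _ h1]
  right_inv := by
    rintro ⟨F, β, hβ⟩
    have hs : (F.extend β hβ).lowerShape = F.shape := by
      ext ⟨i, j⟩
      rw [YoungDiagram.mem_cells, YoungDiagram.mem_cells, mem_lowerShape]
      simp only [extend]
      constructor
      · rintro ⟨h1, h2⟩
        rw [if_pos h1] at h2
        split_ifs at h2 with h3
        · exact h3
        · omega
      · intro h
        rw [if_pos h]
        exact ⟨(mem_stripSet.1 hβ).1.1 h, F.lt _ _ h⟩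
    refine Sigma.subtype_ext (Filling.ext hs ?_) rfl
    funext i j
    simp only [lower, hs]
    simp only [extend]
    split_ifs with h
    · rfl
    · exact (F.zeros _ _ h).symm

end Filling

/-- The result of adding to the empty diagram strips of types `t k` and sizes `n k`, for `k < r`. -/
noncomputable def stripSum (t : ℕ → Prop) (n : ℕ → ℕ) : ℕ → YoungDiagram →₀ ℚ
  | 0 => Finsupp.single ⊥ 1
  | r + 1 => addStrip (t r) (n r) (stripSum t n r)

instance (t : ℕ → Prop) (n : ℕ → ℕ) : Unique (Filling t n 0) where
  default :=
    { shape := ⊥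
      entry := fun _ _ => 0
      row_weak := fun _ _ _ _ _ => le_rfl
      row_repeat := fun _ _ _ _ h => absurd h (YoungDiagram.notMem_bot _)
      col_weak := fun _ _ _ _ _ => le_rfl
      col_repeat := fun _ _ _ _ h => absurd h (YoungDiagram.notMem_bot _)
      zeros := fun _ _ _ => rfl
      lt := fun _ _ h => absurd h (YoungDiagram.notMem_bot _)
      count := fun _ h => absurd h (Nat.not_lt_zero _) }
  uniq F := by
    have h (i j : ℕ) : (i, j) ∉ F.shape := fun h => Nat.not_lt_zero _ (F.lt i j h)
    refine Filling.ext ?_ ?_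
    · ext ⟨i, j⟩
      simp [h]
    · funext i j
      exact F.zeros i j (h i j)

instance (t : ℕ → Prop) (n : ℕ → ℕ) (r : ℕ) : Finite (Filling t n r) := by
  induction r with
  | zero => infer_instance
  | succ r ih => exact Finite.of_equiv _ Filling.succEquiv.symm

theorem finsum_filling (t : ℕ → Prop) (n : ℕ → ℕ) (r : ℕ) :
    ∑ᶠ F : Filling t n r, Finsupp.single F.shape (1 : ℚ) = stripSum t n r := by
  induction r with
  | zero => rw [finsum_unique]; rfl
  | succ r ih =>
    have := Fintype.ofFinite (Filling t n r)
    have := Fintype.ofFinite (Filling t n (r + 1))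
    have h : ∑ F : Filling t n (r + 1), Finsupp.single F.shape (1 : ℚ) =
        ∑ p : Σ F : Filling t n r, {β // β ∈ stripSet (t r) (n r) F.shape},
          Finsupp.single p.2.1 (1 : ℚ) :=
      Fintype.sum_equiv Filling.succEquiv _ _ fun _ => rfl
    rw [stripSum, ← ih, finsum_eq_sum_of_fintype, finsum_eq_sum_of_fintype, map_sum, h,
      Fintype.sum_sigma]
    refine Finset.sum_congr rfl fun F _ => ?_
    rw [addStrip_single]
    exact Finset.sum_coe_sort (stripSet (t r) (n r) F.shape) fun β => Finsupp.single β (1 : ℚ)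

/-! ### Removing the first row -/

theorem mem_removeFirst {α : YoungDiagram} {i j : ℕ} :
    (i, j) ∈ removeFirst α ↔ (i + 1, j) ∈ α := by
  conv_rhs => rw [← YoungDiagram.ofRowLens_to_rowLens_eq_self (μ := α)]
  rw [removeFirst, YoungDiagram.mem_ofRowLens, YoungDiagram.mem_ofRowLens]
  simp only [List.getElem_tail, List.length_tail]
  constructor
  · rintro ⟨h1, h2⟩
    exact ⟨by omega, h2⟩
  · rintro ⟨h1, h2⟩
    exact ⟨by omega, h2⟩

theorem rowLen_removeFirst (α : YoungDiagram) (i : ℕ) :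
    (removeFirst α).rowLen i = α.rowLen (i + 1) := by
  refine eq_of_forall_lt_iff fun j => ?_
  rw [← YoungDiagram.mem_iff_lt_rowLen, ← YoungDiagram.mem_iff_lt_rowLen, mem_removeFirst]

theorem card_removeFirst (α : YoungDiagram) : α.rowLen 0 + (removeFirst α).card = α.card := by
  have h : α.rowLen (α.colLen 0 + 1) = 0 := rowLen_eq_zero.2 (by omega)
  have h' : (removeFirst α).rowLen (α.colLen 0) = 0 := by rw [rowLen_removeFirst, h]
  rw [card_eq_sum_rowLen h, card_eq_sum_rowLen h', Finset.sum_range_succ', add_comm]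
  simp [rowLen_removeFirst]

theorem rowLen_le_card (α : YoungDiagram) (i : ℕ) : α.rowLen i ≤ α.card := by
  rw [YoungDiagram.rowLen_eq_card]
  exact Finset.card_filter_le _ _

theorem eq_of_removeFirst_eq {α β : YoungDiagram} (h : removeFirst α = removeFirst β)
    (hc : α.card = β.card) : α = β := by
  refine rowLen_ext fun i => ?_
  cases i with
  | zero =>
    rw [← card_removeFirst, ← card_removeFirst β, h] at hc
    exact Nat.add_right_cancel hc
  | succ i => rw [← rowLen_removeFirst, ← rowLen_removeFirst, h]

/-- The diagram `ν` with a first row of length `a` added. -/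
noncomputable def consRow (a : ℕ) (ν : YoungDiagram) : YoungDiagram :=
  ofRows fun i => Nat.casesOn i a ν.rowLen

theorem rowLen_consRow {a : ℕ} {ν : YoungDiagram} (h : ν.rowLen 0 ≤ a) (i : ℕ) :
    (consRow a ν).rowLen i = Nat.casesOn i a ν.rowLen := by
  have h0 : ν.rowLen (ν.colLen 0) = 0 := rowLen_eq_zero.2 le_rfl
  refine rowLen_ofRows (fun i => ?_) (N := ν.colLen 0 + 1) h0 i
  cases i with
  | zero => exact h
  | succ i => exact ν.rowLen_anti _ _ (Nat.le_succ i)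

theorem rowLen_consRow_zero {a : ℕ} {ν : YoungDiagram} (h : ν.rowLen 0 ≤ a) :
    (consRow a ν).rowLen 0 = a :=
  rowLen_consRow h 0

theorem rowLen_consRow_one {a : ℕ} {ν : YoungDiagram} (h : ν.rowLen 0 ≤ a) :
    (consRow a ν).rowLen 1 = ν.rowLen 0 :=
  rowLen_consRow h 1

theorem removeFirst_consRow {a : ℕ} {ν : YoungDiagram} (h : ν.rowLen 0 ≤ a) :
    removeFirst (consRow a ν) = ν :=
  rowLen_ext fun i => by rw [rowLen_removeFirst, rowLen_consRow h]

/-- In terms of row lengths, the strip condition is a family of inequalities indexed by rows; the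
one for row `0` is split off. -/
theorem strip_iff_removeFirst {t : Prop} {α β : YoungDiagram} :
    Strip t α β ↔ Strip t (removeFirst α) (removeFirst β) ∧ α.rowLen 0 ≤ β.rowLen 0 ∧
      (t → β.rowLen 1 ≤ α.rowLen 0) ∧ (¬t → β.rowLen 0 ≤ α.rowLen 0 + 1) := by
  have hall (p : ℕ → Prop) : (∀ i, p i) ↔ (∀ i, p (i + 1)) ∧ p 0 :=
    ⟨fun h => ⟨fun i => h _, h 0⟩, fun h i => by cases i with
      | zero => exact h.2
      | succ i => exact h.1 i⟩
  by_cases ht : t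
  · simp only [ht, strip_true_iff, rowLen_removeFirst, true_imp_iff, not_true_eq_false,
      false_imp_iff, and_true]
    rw [hall]
  · simp only [ht, strip_false_iff, rowLen_removeFirst, not_false_eq_true, true_imp_iff,
      false_imp_iff, true_and]
    rw [hall]

open Classical in
/-- The operator that adds strips of those sizes that remain when a first row, which absorbs part
of a strip of size `k`, is ignored. -/
noncomputable def padStrip (t : Prop) (k : ℕ) : Module.End ℚ (YoungDiagram →₀ ℚ) :=
  ∑ j ∈ (range (k + 1)).filter fun j => t ∨ k ≤ j + 1, addStrip t j

/-- Removing the first row. -/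
noncomputable def removeFirstMap : (YoungDiagram →₀ ℚ) →ₗ[ℚ] YoungDiagram →₀ ℚ :=
  Finsupp.lmapDomain ℚ ℚ removeFirst

theorem removeFirstMap_single (α : YoungDiagram) (a : ℚ) :
    removeFirstMap (Finsupp.single α a) = Finsupp.single (removeFirst α) a :=
  Finsupp.mapDomain_single

/-- When the first row is this long, it never limits what is added below. A horizontal strip then
puts any number `j ≤ k` of cells below the first row, a vertical one `k` or `k - 1` (only `0` if `k
= 0`), and the remaining cells extend the first row. -/
theorem removeFirstMap_addStrip_single {t : Prop} {k : ℕ} {α : YoungDiagram}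
    (h : (removeFirst α).card + k ≤ α.rowLen 0) :
    removeFirstMap (addStrip t k (Finsupp.single α 1)) =
      padStrip t k (removeFirstMap (Finsupp.single α 1)) := by
  classical
  rw [addStrip_single, map_sum, removeFirstMap_single, padStrip, LinearMap.sum_apply]
  simp only [removeFirstMap_single, addStrip_single]
  rw [Finset.sum_sigma']
  have hrow (c : Σ _ : ℕ, YoungDiagram) (hc : c ∈ ((range (k + 1)).filter fun j =>
      t ∨ k ≤ j + 1).sigma fun j => stripSet t j (removeFirst α)) :
      c.2.rowLen 0 ≤ α.rowLen 0 + (k - c.1) := by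
    rw [mem_sigma, mem_filter, mem_range, mem_stripSet] at hc
    have := rowLen_le_card c.2 0
    omega
  -- The diagram is recovered from its lower rows because the first row takes the `k - j` cells that
  -- are not added below.
  refine Finset.sum_bij' (fun β _ => ⟨(removeFirst β).card - (removeFirst α).card, removeFirst β⟩)
    (fun c _ => consRow (α.rowLen 0 + (k - c.1)) c.2) ?_ ?_ ?_ ?_ ?_
  · intro β hβ
    rw [mem_stripSet, strip_iff_removeFirst] at hβ
    obtain ⟨⟨h1, h2, h3, h4⟩, h5⟩ := hβ
    have h6 : (removeFirst α).card ≤ (removeFirst β).card := Finset.card_le_card h1.1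
    have := card_removeFirst α
    have := card_removeFirst β
    rw [mem_sigma, mem_filter, mem_range, mem_stripSet]
    refine ⟨⟨by simp only; omega, ?_⟩, h1, by simp only; omega⟩
    by_cases ht : t
    · exact Or.inl ht
    · have := h4 ht
      right
      simp only
      omega
  · intro c hc
    have h0 := hrow c hc
    rw [mem_sigma, mem_filter, mem_range, mem_stripSet] at hc
    have h1 := card_removeFirst (consRow (α.rowLen 0 + (k - c.1)) c.2)
    rw [removeFirst_consRow h0, rowLen_consRow_zero h0] at h1
    have := card_removeFirst α
    simp only at h1
    rw [mem_stripSet, strip_iff_removeFirst, removeFirst_consRow h0, rowLen_consRow_zero h0,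
      rowLen_consRow_one h0]
    have := rowLen_le_card c.2 0
    refine ⟨⟨hc.2.1, by omega, fun _ => by omega, fun ht => ?_⟩, by omega⟩
    have := hc.1.2.resolve_left ht
    omega
  · intro β hβ
    rw [mem_stripSet, strip_iff_removeFirst] at hβ
    obtain ⟨⟨h1, h2, h3, h4⟩, h5⟩ := hβ
    have h6 : (removeFirst α).card ≤ (removeFirst β).card := Finset.card_le_card h1.1
    have := card_removeFirst α
    have := card_removeFirst β
    have h7 : α.rowLen 0 + (k - ((removeFirst β).card - (removeFirst α).card)) = β.rowLen 0 := by
      omega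
    have h8 : (removeFirst β).rowLen 0 ≤ β.rowLen 0 := by
      rw [rowLen_removeFirst]
      exact β.rowLen_anti _ _ (Nat.le_succ 0)
    refine rowLen_ext fun i => ?_
    simp only [h7]
    rw [rowLen_consRow h8]
    cases i with
    | zero => rfl
    | succ i => exact rowLen_removeFirst β i
  · intro c hc
    have h0 := hrow c hc
    rw [mem_sigma, mem_filter, mem_range, mem_stripSet] at hc
    rw [removeFirst_consRow h0]
    refine Sigma.ext ?_ HEq.rfl
    simp only
    omega
  · intro β _
    rfl

theorem removeFirstMap_addStrip {t : Prop} {k : ℕ} {x : YoungDiagram →₀ ℚ}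
    (h : ∀ α ∈ x.support, (removeFirst α).card + k ≤ α.rowLen 0) :
    removeFirstMap (addStrip t k x) = padStrip t k (removeFirstMap x) := by
  conv_lhs => rw [← Finsupp.sum_single x]
  conv_rhs => rw [← Finsupp.sum_single x]
  simp only [Finsupp.sum, map_sum]
  refine Finset.sum_congr rfl fun α hα => ?_
  rw [← Finsupp.smul_single_one, map_smul, map_smul, map_smul, map_smul,
    removeFirstMap_addStrip_single (h α hα)]

theorem exists_strip_of_mem_support {t : Prop} {k : ℕ} {x : YoungDiagram →₀ ℚ} {β : YoungDiagram}
    (h : β ∈ (addStrip t k x).support) :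
    ∃ α ∈ x.support, Strip t α β ∧ β.card = α.card + k := by
  classical
  rw [Finsupp.mem_support_iff, addStrip_apply] at h
  obtain ⟨α, -, hα⟩ := Finset.exists_ne_zero_of_sum_ne_zero h
  refine ⟨α, Finsupp.mem_support_iff.2 (left_ne_zero_of_mul hα), ?_⟩
  by_contra hn
  rw [if_neg hn] at hα
  simp at hα

theorem stripSet_bot (k : ℕ) : stripSet True k ⊥ = {consRow k ⊥} := by
  have hbot (i : ℕ) : (⊥ : YoungDiagram).rowLen i = 0 :=
    Nat.le_zero.1 (rowLen_le_card ⊥ i)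
  have h1 : removeFirst (consRow k ⊥) = ⊥ := removeFirst_consRow (by rw [hbot]; omega)
  have h2 := card_removeFirst (consRow k ⊥)
  have h3 : (consRow k ⊥).rowLen 0 = k := rowLen_consRow_zero (by rw [hbot]; omega)
  rw [h1, h3] at h2
  have h5 : (⊥ : YoungDiagram).card = 0 := rfl
  ext β
  rw [mem_stripSet, mem_singleton]
  constructor
  · rintro ⟨h, h'⟩
    refine eq_of_removeFirst_eq ?_ (by omega)
    rw [h1]
    refine rowLen_ext fun i => ?_
    have := (strip_true_iff.1 h i).2
    rw [rowLen_removeFirst]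
    rw [hbot] at this ⊢
    omega
  · rintro rfl
    refine ⟨strip_true_iff.2 fun i => ?_, by omega⟩
    rw [← rowLen_removeFirst, h1, hbot]
    simp

/-- The result of applying to the empty diagram the operators `padStrip (t (k + 1)) (n (k + 1))`
for `k < r`. -/
noncomputable def padSum (t : ℕ → Prop) (n : ℕ → ℕ) : ℕ → YoungDiagram →₀ ℚ
  | 0 => Finsupp.single ⊥ 1
  | r + 1 => padStrip (t (r + 1)) (n (r + 1)) (padSum t n r)

theorem stripSum_support {t : ℕ → Prop} (ht : t 0) (n : ℕ → ℕ) (r : ℕ) :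
    ∀ α ∈ (stripSum t n (r + 1)).support,
      n 0 ≤ α.rowLen 0 ∧ α.card = n 0 + ∑ k ∈ range r, n (k + 1) := by
  induction r with
  | zero =>
    intro α hα
    obtain ⟨β, hβ, h1, h2⟩ := exists_strip_of_mem_support hα
    have hβ : β = ⊥ := by
      rw [stripSum] at hβ
      simpa using Finsupp.support_single_subset hβ
    subst hβ
    simp only [ht] at h1
    have h5 : (⊥ : YoungDiagram).card = 0 := rfl
    have h3 : α ∈ stripSet True (n 0) ⊥ := mem_stripSet.2 ⟨h1, h2⟩
    rw [stripSet_bot, mem_singleton] at h3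
    have hbot : (⊥ : YoungDiagram).rowLen 0 = 0 := Nat.le_zero.1 (rowLen_le_card ⊥ 0)
    have h4 : (consRow (n 0) ⊥).rowLen 0 = n 0 := rowLen_consRow_zero (by rw [hbot]; omega)
    rw [← h3] at h4
    rw [h2, h5]
    exact ⟨h4.ge, by simp⟩
  | succ r ih =>
    intro α hα
    obtain ⟨β, hβ, h1, h2⟩ := exists_strip_of_mem_support hα
    have h3 := ih β hβ
    have h4 := le_iff_rowLen.1 h1.1 0
    rw [Finset.sum_range_succ]
    omega

/-- The first strip is a row of `n 0` cells. All later strips together have at most `n 0` cells, so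
at every step the first row is long enough for `removeFirstMap_addStrip`. -/
theorem removeFirstMap_stripSum {t : ℕ → Prop} (ht : t 0) {n : ℕ → ℕ} {r : ℕ}
    (hn : ∑ k ∈ range r, n (k + 1) ≤ n 0) :
    removeFirstMap (stripSum t n (r + 1)) = padSum t n r := by
  induction r with
  | zero =>
    have hbot : (⊥ : YoungDiagram).rowLen 0 = 0 := Nat.le_zero.1 (rowLen_le_card ⊥ 0)
    rw [stripSum, stripSum, padSum, addStrip_single]
    simp only [ht]
    rw [stripSet_bot, Finset.sum_singleton, removeFirstMap_single,
      removeFirst_consRow (by rw [hbot]; omega)]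
  | succ r ih =>
    rw [Finset.sum_range_succ] at hn
    rw [stripSum, padSum, ← ih (by omega), removeFirstMap_addStrip]
    intro α hα
    have h1 := stripSum_support ht n r α hα
    have h2 := card_removeFirst α
    omega

end SymChar

namespace SymChar
open Finset

/-! ### The linear map sending `h_μ` to `h̃_μ` -/

/-- The action of symmetric functions on Young diagrams by the Pieri rules. -/
noncomputable def pieri : SymFun →ₐ[ℚ] Module.End ℚ (YoungDiagram →₀ ℚ) := exists_pieri_hom.choose

theorem pieri_complete (n : ℕ) : pieri (complete n) = addStrip True n :=
  exists_pieri_hom.choose_spec.1 n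

theorem pieri_elementary (n : ℕ) : pieri (elementary n) = addStrip False n :=
  exists_pieri_hom.choose_spec.2 n

open Classical in
/-- `h_n` if `t` holds, `e_n` otherwise. -/
noncomputable def stripFun (t : Prop) (n : ℕ) : SymFun := if t then complete n else elementary n

/-- Ignoring a long first row therefore has the same effect as adjoining a variable equal to `1`:
`h_n` becomes `∑_{j ≤ n} h_j`, and `e_n` becomes `e_n + e_{n-1}`. -/
theorem pieri_shift_stripFun (t : Prop) (n : ℕ) :
    pieri (shiftPowerSums (stripFun t n)) = padStrip t n := by
  classical
  by_cases ht : t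
  · rw [stripFun, if_pos ht, shiftPowerSums_complete, map_sum, padStrip]
    simp [ht, pieri_complete]
  · rw [stripFun, if_neg ht, padStrip]
    cases n with
    -- There is no `e_{-1}`: for `n = 0` only the strip of size `0` occurs.
    | zero => 
      simp [ht, elementary_zero, addStrip_zero]
    | succ n =>
      have h : (range (n + 1 + 1)).filter (fun j => t ∨ n + 1 ≤ j + 1) = {n + 1, n} := by
        ext j
        simp only [ht, false_or, mem_filter, mem_range, mem_insert, mem_singleton]
        omega
      rw [shiftPowerSums_elementary_succ, h, Finset.sum_pair (by omega), map_add,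
        pieri_elementary, pieri_elementary]
      simp [ht]

/-- The linear map sending a Young diagram `λ` to `s̃_λ`. -/
noncomputable def sTildeMap : (YoungDiagram →₀ ℚ) →ₗ[ℚ] SymFun :=
  Finsupp.linearCombination ℚ sTilde

/-- The linear endomorphism of the ring of symmetric functions that sends `h_μ` to `h̃_μ`. -/
noncomputable def charMap : SymFun →ₗ[ℚ] SymFun :=
  sTildeMap ∘ₗ LinearMap.applyₗ (Finsupp.single ⊥ 1) ∘ₗ pieri.toLinearMap ∘ₗ
    shiftPowerSums.toLinearMap

theorem charMap_apply (f : SymFun) :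
    charMap f = sTildeMap (pieri (shiftPowerSums f) (Finsupp.single ⊥ 1)) := rfl

theorem pieri_shift_prod (t : ℕ → Prop) (n : ℕ → ℕ) (r : ℕ) :
    pieri (shiftPowerSums (∏ k ∈ range r, stripFun (t (k + 1)) (n (k + 1))))
      (Finsupp.single ⊥ 1) = padSum t n r := by
  induction r with
  | zero => simp [padSum]
  | succ r ih =>
    rw [Finset.prod_range_succ, mul_comm, map_mul, map_mul, Module.End.mul_apply, ih,
      pieri_shift_stripFun, padSum]

/-- This expansion is used twice: with all types horizontal it identifies `h̃_μ`, and with types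
given by the parity of the blocks it produces the tableaux of the theorem. The label `0` fills the
long first row that is deleted in the end. -/
theorem charMap_prod {t : ℕ → Prop} (ht : t 0) {n : ℕ → ℕ} {r : ℕ}
    (hn : ∑ k ∈ range r, n (k + 1) ≤ n 0) :
    charMap (∏ k ∈ range r, stripFun (t (k + 1)) (n (k + 1))) =
      ∑ᶠ F : Filling t n (r + 1), sTilde (removeFirst F.shape) := by
  have := Fintype.ofFinite (Filling t n (r + 1))
  rw [charMap_apply, pieri_shift_prod, ← removeFirstMap_stripSum ht hn, ← finsum_filling,
    finsum_eq_sum_of_fintype, finsum_eq_sum_of_fintype, map_sum, map_sum]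
  refine Finset.sum_congr rfl fun F _ => ?_
  simp [removeFirstMap_single, sTildeMap]

theorem card_padPart {ν : YoungDiagram} {m : ℕ} (h : ν.card ≤ m) :
    (padPart (2 * m) ν).card = 2 * m := by
  obtain ⟨hs, he⟩ := padPart_eq h
  rw [he]
  refine (card_cellsOfRowLens _).trans ?_
  rw [List.sum_cons, sum_rowLens]
  omega

theorem removeFirst_padPart {ν : YoungDiagram} {m : ℕ} (h : ν.card ≤ m) :
    removeFirst (padPart (2 * m) ν) = ν := by
  ext ⟨i, j⟩
  rw [YoungDiagram.mem_cells, YoungDiagram.mem_cells, mem_removeFirst, mem_padPart h]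

theorem rowLen_padPart_succ {ν : YoungDiagram} {m : ℕ} (h : ν.card ≤ m) (k : ℕ) :
    (padPart (2 * m) ν).rowLen (k + 1) = ν.rowLen k := by
  rw [← rowLen_removeFirst, removeFirst_padPart h]

theorem rowLen_padPart_zero (μ : YoungDiagram) : (padPart (2 * μ.card) μ).rowLen 0 = μ.card := by
  have h := card_removeFirst (padPart (2 * μ.card) μ)
  rw [removeFirst_padPart le_rfl, card_padPart le_rfl] at h
  omega

namespace Filling

variable {t : ℕ → Prop} {n : ℕ → ℕ} {r : ℕ}

theorem card_shape (F : Filling t n r) : F.shape.card = ∑ k ∈ range r, n k := by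
  rw [YoungDiagram.card, Finset.card_eq_sum_card_fiberwise (f := fun c => F.entry c.1 c.2)
    (t := range r) (fun c hc => by simpa using F.lt c.1 c.2 hc)]
  exact Finset.sum_congr rfl fun k hk => F.count k (mem_range.1 hk)

theorem fst_eq_zero_of_entry_eq_zero (ht : t 0) (F : Filling t n r) {i j : ℕ}
    (h : (i, j) ∈ F.shape) (h0 : F.entry i j = 0) : i = 0 := by
  by_contra hi
  have h1 := F.col_weak 0 i j (Nat.pos_of_ne_zero hi) h
  refine F.col_repeat 0 i j (Nat.pos_of_ne_zero hi) h (by omega) ?_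
  rwa [show F.entry 0 j = 0 by omega]

theorem le_rowLen_zero (ht : t 0) (F : Filling t n (r + 1)) : n 0 ≤ F.shape.rowLen 0 := by
  rw [← F.count 0 (Nat.succ_pos r), YoungDiagram.rowLen_eq_card]
  refine Finset.card_le_card fun c hc => ?_
  rw [mem_filter] at hc
  rw [YoungDiagram.mem_row_iff]
  exact ⟨hc.1, F.fst_eq_zero_of_entry_eq_zero ht hc.1 hc.2⟩

end Filling

/-- If all labels may repeat only in rows, fillings are column strict tableaux. The size of the
filling is fixed by its content, so the rows below the first determine its shape; no label exceeds
`ℓ(μ)` since the content vanishes beyond it. -/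
theorem card_filling_eq_paddedKostka {μ ν : YoungDiagram} (h : ν.card ≤ μ.card) :
    Nat.card {F : Filling (fun _ => True) (padPart (2 * μ.card) μ).rowLen (μ.colLen 0 + 1) //
      removeFirst F.shape = ν} = paddedKostka ν μ := by
  have hsum : ∑ k ∈ range (μ.colLen 0 + 1), (padPart (2 * μ.card) μ).rowLen k = 2 * μ.card := by
    rw [← card_eq_sum_rowLen, card_padPart le_rfl]
    rw [rowLen_padPart_succ le_rfl]
    exact rowLen_eq_zero.2 le_rfl
  have hshape (F : Filling (fun _ => True) (padPart (2 * μ.card) μ).rowLen (μ.colLen 0 + 1))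
      (hF : removeFirst F.shape = ν) : F.shape = padPart (2 * μ.card) ν := by
    refine eq_of_removeFirst_eq ?_ ?_
    · rw [hF, removeFirst_padPart h]
    · rw [F.card_shape, hsum, card_padPart h]
  refine Nat.card_congr
    { toFun := fun F => ⟨
        { entry := F.1.entry
          row_weak' := fun hj hc => F.1.row_weak _ _ _ hj (by rwa [hshape F.1 F.2])
          col_strict' := fun hi hc => by
            rw [← hshape F.1 F.2] at hc
            refine lt_of_le_of_ne (F.1.col_weak _ _ _ hi hc) fun heq => ?_
            exact F.1.col_repeat _ _ _ hi hc heq trivial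
          zeros' := fun hc => F.1.zeros _ _ (by rwa [hshape F.1 F.2]) }, fun k => ?_⟩
      invFun := fun T => ⟨
        { shape := padPart (2 * μ.card) ν
          entry := T.1
          row_weak := fun i j₁ j₂ hj hc => T.1.row_weak hj hc
          row_repeat := fun _ _ _ _ _ _ => trivial
          col_weak := fun i₁ i₂ j hi hc => (T.1.col_strict hi hc).le
          col_repeat := fun i₁ i₂ j hi hc heq => absurd heq (T.1.col_strict hi hc).ne
          zeros := fun i j hc => T.1.zeros hc
          lt := fun i j hc => ?_
          count := fun k _ => T.2 k }, removeFirst_padPart h⟩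
      left_inv := fun F => ?_
      right_inv := fun T => ?_ }
  · change ((padPart (2 * μ.card) ν).cells.filter fun c => F.1.entry c.1 c.2 = k).card = _
    rw [← hshape F.1 F.2]
    by_cases hk : k < μ.colLen 0 + 1
    · exact F.1.count k hk
    · obtain ⟨k, rfl⟩ : ∃ l, k = l + 1 := ⟨k - 1, by omega⟩
      rw [rowLen_padPart_succ le_rfl, rowLen_eq_zero.2 (by omega), Finset.card_eq_zero,
        Finset.filter_eq_empty_iff]
      intro c hc
      have := F.1.lt c.1 c.2 hc
      omega
  · have h1 := T.2 (T.1 i j)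
    have h2 : 0 < (padPart (2 * μ.card) μ).rowLen (T.1 i j) := by
      rw [← h1, Finset.card_pos]
      exact ⟨(i, j), mem_filter.2 ⟨hc, rfl⟩⟩
    by_contra! hlt
    obtain ⟨k, hk⟩ : ∃ k, T.1 i j = k + 1 := ⟨T.1 i j - 1, by omega⟩
    rw [hk, rowLen_padPart_succ le_rfl, rowLen_eq_zero.2 (by omega)] at h2
    exact lt_irrefl _ h2
  · exact Subtype.ext (Filling.ext (hshape F.1 F.2).symm rfl)
  · rfl

theorem completePart_eq_prod (μ : YoungDiagram) :
    completePart μ = ∏ k ∈ range (μ.colLen 0), complete (μ.rowLen k) := by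
  rw [completePart, YoungDiagram.rowLens, List.map_map]
  rfl

theorem elementaryPart_eq_prod (μ : YoungDiagram) :
    elementaryPart μ = ∏ k ∈ range (μ.colLen 0), elementary (μ.rowLen k) := by
  rw [elementaryPart, YoungDiagram.rowLens, List.map_map]
  rfl

/-- Grouping the fillings of `charMap_prod` by the shape below the first row gives the Kostka
numbers in the definition of `s̃`. The choice `n = 2|μ|` makes the first part of the content `|μ|`,
just enough for `charMap_prod`. -/
theorem charMap_completePart (μ : YoungDiagram) : charMap (completePart μ) = hTilde μ := by
  classical
  set n := (padPart (2 * μ.card) μ).rowLen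
  have hn0 : n 0 = μ.card := rowLen_padPart_zero μ
  have hn (k : ℕ) : n (k + 1) = μ.rowLen k := rowLen_padPart_succ le_rfl k
  have hsum : ∑ k ∈ range (μ.colLen 0), n (k + 1) = μ.card := by
    simp only [hn]
    exact (card_eq_sum_rowLen (rowLen_eq_zero.2 le_rfl)).symm
  have h1 := charMap_prod (t := fun _ => True) trivial (n := n) (r := μ.colLen 0)
    (by rw [hsum, hn0])
  have h2 : ∏ k ∈ range (μ.colLen 0), stripFun True (n (k + 1)) = completePart μ := by
    rw [completePart_eq_prod]
    exact Finset.prod_congr rfl fun k _ => by rw [stripFun, if_pos trivial, hn]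
  rw [h2] at h1
  rw [h1, hTilde_eq_sum_sTilde]
  have hcard (F : Filling (fun _ => True) n (μ.colLen 0 + 1)) :
      (removeFirst F.shape).card ≤ μ.card := by
    have h3 := F.card_shape
    rw [Finset.sum_range_succ', hsum, hn0] at h3
    have h4 := F.le_rowLen_zero trivial
    have h5 := card_removeFirst F.shape
    omega
  have := Fintype.ofFinite (Filling (fun _ => True) n (μ.colLen 0 + 1))
  have := (finite_card_le μ.card).fintype
  rw [finsum_eq_sum_of_fintype]
  change _ = ∑ᶠ ν : {ν : YoungDiagram | ν.card ≤ μ.card}, (paddedKostka ν.1 μ : ℚ) • sTilde ν.1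
  rw [finsum_eq_sum_of_fintype,
    ← Finset.sum_fiberwise (s := univ) (g := fun F : Filling (fun _ => True) n (μ.colLen 0 + 1) =>
      (⟨removeFirst F.shape, hcard F⟩ : {ν : YoungDiagram | ν.card ≤ μ.card}))]
  refine Finset.sum_congr rfl fun ν _ => ?_
  rw [Finset.sum_congr rfl (g := fun _ => sTilde ν.1) fun F hF => by
    rw [← (mem_filter.1 hF).2], Finset.sum_const, ← card_filling_eq_paddedKostka ν.2,
    Nat.cast_smul_eq_nsmul, Nat.card_eq_fintype_card, Fintype.card_subtype]
  congr 2
  ext F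
  simp [Subtype.ext_iff]

end SymChar

namespace SymChar
open Finset

/-! ### Generating functions -/

section Generating

variable {A : Type*} [CommRing A] {ι : Type*}

/-- The power series `f` in the monomial `y^w`. -/
noncomputable def inMonomial (w : ℕ →₀ ℕ) (f : PowerSeries A) : MvPowerSeries ℕ A :=
  f.subst (MvPowerSeries.monomial w (1 : A))

theorem coeff_inMonomial {w : ℕ →₀ ℕ} (hw : w ≠ 0) (f : PowerSeries A) (m : ℕ →₀ ℕ) :
    MvPowerSeries.coeff m (inMonomial w f) =
      ∑ᶠ n : ℕ, if m = n • w then PowerSeries.coeff n f else 0 := by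
  classical
  rw [inMonomial, PowerSeries.coeff_subst (PowerSeries.HasSubst.monomial hw 1)]
  refine finsum_congr fun n => ?_
  rw [MvPowerSeries.monomial_pow, MvPowerSeries.coeff_monomial]
  simp

theorem nsmul_left_injective_of_ne_zero {w : ℕ →₀ ℕ} (hw : w ≠ 0) :
    Function.Injective fun n : ℕ => n • w := by
  obtain ⟨i, hi⟩ := Finsupp.ne_iff.1 hw
  intro a b h
  have := DFunLike.congr_fun h i
  simp only [Finsupp.smul_apply, smul_eq_mul] at this
  exact Nat.eq_of_mul_eq_mul_right (Nat.pos_of_ne_zero hi) this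

theorem coeff_nsmul_inMonomial {w : ℕ →₀ ℕ} (hw : w ≠ 0) (f : PowerSeries A) (n : ℕ) :
    MvPowerSeries.coeff (n • w) (inMonomial w f) = PowerSeries.coeff n f := by
  rw [coeff_inMonomial hw, finsum_eq_single _ n]
  · simp
  · intro k hk
    exact if_neg fun h => hk (nsmul_left_injective_of_ne_zero hw h).symm

theorem coeff_inMonomial_of_ne {w : ℕ →₀ ℕ} (hw : w ≠ 0) (f : PowerSeries A) {m : ℕ →₀ ℕ}
    (h : ∀ n : ℕ, m ≠ n • w) : MvPowerSeries.coeff m (inMonomial w f) = 0 := by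
  rw [coeff_inMonomial hw]
  exact finsum_eq_zero_of_forall_eq_zero fun n => if_neg (h n)

theorem inMonomial_mul {w : ℕ →₀ ℕ} (hw : w ≠ 0) (f g : PowerSeries A) :
    inMonomial w (f * g) = inMonomial w f * inMonomial w g :=
  PowerSeries.subst_mul (PowerSeries.HasSubst.monomial hw 1) f g

theorem inMonomial_add {w : ℕ →₀ ℕ} (hw : w ≠ 0) (f g : PowerSeries A) :
    inMonomial w (f + g) = inMonomial w f + inMonomial w g :=
  PowerSeries.subst_add (PowerSeries.HasSubst.monomial hw 1) f g

theorem inMonomial_one {w : ℕ →₀ ℕ} (hw : w ≠ 0) :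
    inMonomial w (1 : PowerSeries A) = 1 := by
  rw [inMonomial, ← PowerSeries.coe_substAlgHom (PowerSeries.HasSubst.monomial hw 1), map_one]

theorem map_inMonomial {B : Type*} [CommRing B] {w : ℕ →₀ ℕ} (hw : w ≠ 0) (φ : A →+* B)
    (f : PowerSeries A) :
    MvPowerSeries.map φ (inMonomial w f) = inMonomial w (PowerSeries.map φ f) := by
  rw [inMonomial, PowerSeries.map_subst (PowerSeries.HasSubst.monomial hw 1),
    MvPowerSeries.map_monomial, map_one]
  rfl

/-- The multiplicities with which the blocks in `s`, of weights `w`, make up `m`. -/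
def blockSet (s : Finset ι) (w : ι → ℕ →₀ ℕ) (m : ℕ →₀ ℕ) : Set (ι →₀ ℕ) :=
  {π | π.support ⊆ s ∧ ∑ i ∈ s, π i • w i = m}

open Classical in
/-- The weights contributed by the blocks. -/
noncomputable def blockWeights (s : Finset ι) (w : ι → ℕ →₀ ℕ) (π : ι →₀ ℕ) : ι →₀ (ℕ →₀ ℕ) :=
  Finsupp.onFinset s (fun i => if i ∈ s then π i • w i else 0) fun i hi => by
    by_contra h
    exact hi (if_neg h)

theorem blockWeights_injOn {s : Finset ι} {w : ι → ℕ →₀ ℕ} (hw : ∀ i ∈ s, w i ≠ 0)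
    (m : ℕ →₀ ℕ) : Set.InjOn (blockWeights s w) (blockSet s w m) := by
  intro π hπ π' hπ' h
  ext i
  by_cases hi : i ∈ s
  · have h1 := DFunLike.congr_fun h i
    simp only [blockWeights, Finsupp.onFinset_apply, if_pos hi] at h1
    exact nsmul_left_injective_of_ne_zero (hw i hi) h1
  · rw [Finsupp.notMem_support_iff.1 fun h => hi (hπ.1 h),
      Finsupp.notMem_support_iff.1 fun h => hi (hπ'.1 h)]

theorem blockWeights_mem [DecidableEq ι] {s : Finset ι} {w : ι → ℕ →₀ ℕ} {m : ℕ →₀ ℕ} {π : ι →₀ ℕ}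
    (hπ : π ∈ blockSet s w m) : blockWeights s w π ∈ finsuppAntidiag s m := by
  rw [mem_finsuppAntidiag]
  refine ⟨?_, Finsupp.support_onFinset_subset⟩
  rw [← hπ.2]
  refine Finset.sum_congr rfl fun i hi => ?_
  simp [blockWeights, hi]

theorem finite_blockSet {s : Finset ι} {w : ι → ℕ →₀ ℕ} (hw : ∀ i ∈ s, w i ≠ 0)
    (m : ℕ →₀ ℕ) : (blockSet s w m).Finite := by
  classical
  refine Set.Finite.of_finite_image (((finsuppAntidiag s m).finite_toSet).subset ?_)
    (blockWeights_injOn hw m)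
  rintro _ ⟨π, hπ, rfl⟩
  exact blockWeights_mem hπ

/-- A term in the expansion of the product chooses a multiple of `w i` for each `i`, that is, a
multiplicity `π i`. -/
theorem coeff_prod_inMonomial {s : Finset ι} {w : ι → ℕ →₀ ℕ} (hw : ∀ i ∈ s, w i ≠ 0)
    (f : ι → PowerSeries A) (m : ℕ →₀ ℕ) :
    MvPowerSeries.coeff m (∏ i ∈ s, inMonomial (w i) (f i)) =
      ∑ᶠ π ∈ blockSet s w m, ∏ i ∈ s, PowerSeries.coeff (π i) (f i) := by
  classical
  rw [MvPowerSeries.coeff_prod, finsum_mem_eq_finite_toFinset_sum _ (finite_blockSet hw m), eq_comm]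
  refine Finset.sum_of_injOn (blockWeights s w) ?_ ?_ ?_ ?_
  · simpa using blockWeights_injOn hw m
  · intro π hπ
    exact blockWeights_mem (by simpa using hπ)
  -- A decomposition of `m` outside the image has some component that is not a multiple of its
  -- weight, so its term vanishes.
  · intro l hl hn
    rw [mem_finsuppAntidiag] at hl
    by_contra hne
    have h1 : ∀ i ∈ s, ∃ n : ℕ, l i = n • w i := by
      intro i hi
      by_contra! h
      exact hne (Finset.prod_eq_zero hi (coeff_inMonomial_of_ne (hw i hi) _ h))
    choose! π hπ using h1
    refine hn ⟨Finsupp.onFinset s (fun i => if i ∈ s then π i else 0) fun i hi => by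
      by_contra h
      exact hi (if_neg h), ?_, ?_⟩
    · simp only [Set.Finite.coe_toFinset]
      refine ⟨Finsupp.support_onFinset_subset, ?_⟩
      rw [← hl.1]
      refine Finset.sum_congr rfl fun i hi => ?_
      simp [hi, hπ i hi]
    · ext1 i
      by_cases hi : i ∈ s
      · simp [blockWeights, hi, hπ i hi]
      · rw [Finsupp.notMem_support_iff.1 fun h => hi (hl.2 h)]
        simp [blockWeights, hi]
  · intro π _
    refine Finset.prod_congr rfl fun i hi => ?_
    rw [← coeff_nsmul_inMonomial (hw i hi)]
    simp [blockWeights, hi]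

theorem blockSet_single {s : Finset ℕ} {m : ℕ →₀ ℕ} (h : m.support ⊆ s) :
    blockSet s (fun i => Finsupp.single i 1) m = {m} := by
  have key (π : ℕ →₀ ℕ) (hπ : π.support ⊆ s) : ∑ i ∈ s, π i • Finsupp.single i 1 = π := by
    simp only [Finsupp.smul_single, smul_eq_mul, mul_one]
    exact (Finsupp.sum_of_support_subset π hπ (fun i a => Finsupp.single i a) (by simp)).symm.trans
      π.sum_single
  ext π
  simp only [blockSet, Set.mem_ofPred_eq, Set.mem_singleton_iff]
  constructor
  · rintro ⟨h1, h2⟩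
    rwa [key π h1] at h2
  · rintro rfl
    exact ⟨h, key π h⟩

theorem coeff_prod_variables {s : Finset ℕ} {m : ℕ →₀ ℕ} (h : m.support ⊆ s) (f : PowerSeries A) :
    MvPowerSeries.coeff m (∏ i ∈ s, inMonomial (Finsupp.single i 1) f) =
      ∏ i ∈ s, PowerSeries.coeff (m i) f := by
  rw [coeff_prod_inMonomial (w := fun i => Finsupp.single i 1) (by simp) (fun _ => f),
    blockSet_single h, finsum_mem_singleton]

theorem inMonomial_monomial {w : ℕ →₀ ℕ} (hw : w ≠ 0) (k : ℕ) (c : A) :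
    inMonomial w (PowerSeries.monomial k c) = MvPowerSeries.monomial (k • w) c := by
  classical
  ext m
  rw [MvPowerSeries.coeff_monomial]
  by_cases h : ∃ n : ℕ, m = n • w
  · obtain ⟨n, rfl⟩ := h
    rw [coeff_nsmul_inMonomial hw, PowerSeries.coeff_monomial]
    simp only [(nsmul_left_injective_of_ne_zero hw).eq_iff]
  · push Not at h
    rw [coeff_inMonomial_of_ne hw _ h, if_neg (h k)]

/-- Coefficients below `M` of a product depend only on coefficients below `M` of the factors. This
is needed because `blocksComplete` uses only the finitely many blocks contained in `c`, so that its
identity holds only up to the exponent of `c`. -/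
theorem coeff_list_prod_congr {M : ℕ →₀ ℕ} {κ : Type*} {F G : κ → MvPowerSeries ℕ A}
    (h : ∀ k, ∀ m ≤ M, MvPowerSeries.coeff m (F k) = MvPowerSeries.coeff m (G k)) (L : List κ) :
    ∀ m ≤ M, MvPowerSeries.coeff m (L.map F).prod = MvPowerSeries.coeff m (L.map G).prod := by
  classical
  induction L with
  | nil => simp
  | cons k L ih =>
    intro m hm
    rw [List.map_cons, List.prod_cons, List.map_cons, List.prod_cons, MvPowerSeries.coeff_mul,
      MvPowerSeries.coeff_mul]
    refine Finset.sum_congr rfl fun c hc => ?_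
    rw [HasAntidiagonal.mem_antidiagonal] at hc
    rw [h k _ (le_trans (by rw [← hc]; exact le_self_add) hm),
      ih _ (le_trans (by rw [← hc]; exact le_add_self) hm)]

end Generating

/-! ### Derivations on generating functions -/

/-- A derivation applied to the coefficients of a power series. -/
noncomputable def mapDerivation (D : Derivation ℚ SymFun SymFun) (F : MvPowerSeries ℕ SymFun) :
    MvPowerSeries ℕ SymFun := fun m => D (MvPowerSeries.coeff m F)

theorem coeff_mapDerivation (D : Derivation ℚ SymFun SymFun) (F : MvPowerSeries ℕ SymFun)
    (m : ℕ →₀ ℕ) :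
    MvPowerSeries.coeff m (mapDerivation D F) = D (MvPowerSeries.coeff m F) := rfl

theorem mapDerivation_mul (D : Derivation ℚ SymFun SymFun) (F G : MvPowerSeries ℕ SymFun) :
    mapDerivation D (F * G) = mapDerivation D F * G + F * mapDerivation D G := by
  ext m : 1
  rw [coeff_mapDerivation, map_add, MvPowerSeries.coeff_mul, MvPowerSeries.coeff_mul,
    MvPowerSeries.coeff_mul, map_sum, ← Finset.sum_add_distrib]
  refine Finset.sum_congr rfl fun c _ => ?_
  rw [Derivation.leibniz, coeff_mapDerivation, coeff_mapDerivation, smul_eq_mul, smul_eq_mul]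
  ring

theorem mapDerivation_C (D : Derivation ℚ SymFun SymFun) (q : MvPowerSeries ℕ ℚ) :
    mapDerivation D (MvPowerSeries.map (algebraMap ℚ SymFun) q) = 0 := by
  ext m : 1
  rw [coeff_mapDerivation, MvPowerSeries.coeff_map, Derivation.map_algebraMap, map_zero]

/-- Eigenvalues of a derivation add up under products; thus a product over blocks of series in `h`
or `e` is an eigenvector of every `p_k^⊥`. -/
theorem mapDerivation_prod (D : Derivation ℚ SymFun SymFun) {ι : Type*} (s : Finset ι)
    {F : ι → MvPowerSeries ℕ SymFun} {a : ι → MvPowerSeries ℕ SymFun}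
    (h : ∀ i ∈ s, mapDerivation D (F i) = a i * F i) :
    mapDerivation D (∏ i ∈ s, F i) = (∑ i ∈ s, a i) * ∏ i ∈ s, F i := by
  classical
  induction s using Finset.induction_on with
  | empty =>
    have := mapDerivation_C D 1
    rw [map_one] at this
    simp [this]
  | insert i s hi ih =>
    rw [Finset.prod_insert hi, Finset.sum_insert hi, mapDerivation_mul,
      h i (mem_insert_self i s), ih fun j hj => h j (mem_insert_of_mem hj)]
    ring

theorem mapDerivation_inMonomial (D : Derivation ℚ SymFun SymFun) {w : ℕ →₀ ℕ} (hw : w ≠ 0)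
    (f : PowerSeries SymFun) : mapDerivation D (inMonomial w f) =
      inMonomial w (PowerSeries.mk fun n => D (PowerSeries.coeff n f)) := by
  ext m : 1
  rw [coeff_mapDerivation]
  by_cases h : ∃ n : ℕ, m = n • w
  · obtain ⟨n, rfl⟩ := h
    rw [coeff_nsmul_inMonomial hw, coeff_nsmul_inMonomial hw, PowerSeries.coeff_mk]
  · push Not at h
    rw [coeff_inMonomial_of_ne hw _ h, coeff_inMonomial_of_ne hw _ h, map_zero]

/-- The generating function of the complete or of the elementary symmetric functions. -/
noncomputable def stripSeries (t : Prop) : PowerSeries SymFun := PowerSeries.mk (stripFun t)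

/-- The sign with which `k ∂/∂p_k` acts on the generating function `stripSeries t`. -/
noncomputable def stripSign (t : Prop) (k : ℕ) : ℚ := by
  classical exact if t then 1 else -(-1) ^ k

theorem skewPower_stripFun_add (t : Prop) (k : ℕ+) (n : ℕ) :
    skewPower k (stripFun t (n + k)) = algebraMap ℚ _ (stripSign t k) * stripFun t n := by
  by_cases ht : t
  · simp [stripFun, stripSign, ht, skewPower_complete_add]
  · simp [stripFun, stripSign, ht, skewPower_elementary_add]

theorem skewPower_stripFun_of_lt (t : Prop) {k : ℕ+} {n : ℕ} (h : n < k) :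
    skewPower k (stripFun t n) = 0 := by
  by_cases ht : t
  · simp [stripFun, ht, skewPower_complete_of_lt h]
  · simp [stripFun, ht, skewPower_elementary_of_lt h]

theorem mapDerivation_stripSeries (t : Prop) (k : ℕ+) {w : ℕ →₀ ℕ} (hw : w ≠ 0) :
    mapDerivation (skewPower k) (inMonomial w (stripSeries t)) =
      MvPowerSeries.map (algebraMap ℚ SymFun)
        (MvPowerSeries.monomial ((k : ℕ) • w) (stripSign t k)) * inMonomial w (stripSeries t) := by
  have h : (PowerSeries.mk fun n => skewPower k (PowerSeries.coeff n (stripSeries t))) =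
      PowerSeries.monomial (k : ℕ) (algebraMap ℚ SymFun (stripSign t k)) * stripSeries t := by
    have hm (c : SymFun) : PowerSeries.monomial (k : ℕ) c = PowerSeries.C c * PowerSeries.X ^ (k : ℕ) := by
      rw [PowerSeries.X_pow_eq, ← PowerSeries.monomial_zero_eq_C_apply,
        PowerSeries.monomial_mul_monomial, zero_add, mul_one]
    ext1 n
    rw [hm, mul_assoc, PowerSeries.coeff_C_mul, PowerSeries.coeff_X_pow_mul']
    rw [PowerSeries.coeff_mk, stripSeries, PowerSeries.coeff_mk]
    rcases lt_or_ge n k with hn | hn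
    · rw [skewPower_stripFun_of_lt t hn]
      simp [hn]
    · obtain ⟨n, rfl⟩ := Nat.exists_eq_add_of_le' hn
      rw [skewPower_stripFun_add]
      simp
  rw [mapDerivation_inMonomial _ hw, h, inMonomial_mul hw, inMonomial_monomial hw,
    MvPowerSeries.map_monomial]

end SymChar

namespace SymChar
open Finset

/-! ### Evaluations -/

/-- The functionals `f ↦ (∏ (1 + k ∂/∂p_k)) f` at `p = 0`, the product being over a list. -/
noncomputable def evalSkew : List ℕ+ → SymFun →ₗ[ℚ] ℚ
  | [] => MvPolynomial.lcoeff ℚ 0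
  | k :: L => evalSkew L ∘ₗ (LinearMap.id + (skewPower k : SymFun →ₗ[ℚ] SymFun))

theorem evalSkew_cons (k : ℕ+) (L : List ℕ+) (f : SymFun) :
    evalSkew (k :: L) f = evalSkew L (f + skewPower k f) := rfl

/-- The homomorphism `p_j ↦ ∑_{k ∣ j} k`, the sum being over a list. -/
noncomputable def evalRoots (L : List ℕ+) : SymFun →ₐ[ℚ] ℚ :=
  MvPolynomial.aeval fun j => (L.map fun k : ℕ+ => if (k : ℕ) ∣ j then ((k : ℕ) : ℚ) else 0).sum

theorem evalRoots_X (L : List ℕ+) (j : ℕ+) : evalRoots L (MvPolynomial.X j) =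
    (L.map fun k : ℕ+ => if (k : ℕ) ∣ j then ((k : ℕ) : ℚ) else 0).sum := by
  rw [evalRoots, MvPolynomial.aeval_X]

/-- Since `F` is a common eigenvector, `1 + p_k^⊥` multiplies it by `1 + a k`; at `p = 0` it equals
`1`. The scalar series `q`, which derivations ignore, collects the factors already produced and
makes the induction possible. -/
theorem evalSkew_coeff {F : MvPowerSeries ℕ SymFun} {a : ℕ+ → MvPowerSeries ℕ ℚ}
    (hF : ∀ k, mapDerivation (skewPower k) F = MvPowerSeries.map (algebraMap ℚ SymFun) (a k) * F)
    (h0 : MvPowerSeries.map (MvPolynomial.constantCoeff : SymFun →+* ℚ) F = 1) (L : List ℕ+)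
    (q : MvPowerSeries ℕ ℚ) (m : ℕ →₀ ℕ) :
    evalSkew L (MvPowerSeries.coeff m (MvPowerSeries.map (algebraMap ℚ SymFun) q * F)) =
      MvPowerSeries.coeff m (q * (L.map fun k => 1 + a k).prod) := by
  induction L generalizing q with
  | nil =>
    have h1 : MvPowerSeries.map (MvPolynomial.constantCoeff : SymFun →+* ℚ)
        (MvPowerSeries.map (algebraMap ℚ SymFun) q * F) = q := by
      rw [map_mul, h0, mul_one]
      ext m
      simp
    rw [List.map_nil, List.prod_nil, mul_one]
    conv_rhs => rw [← h1]
    rw [MvPowerSeries.coeff_map]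
    rfl
  | cons k L ih =>
    have h1 : MvPowerSeries.map (algebraMap ℚ SymFun) (q * (1 + a k)) * F =
        MvPowerSeries.map (algebraMap ℚ SymFun) q * F +
          mapDerivation (skewPower k) (MvPowerSeries.map (algebraMap ℚ SymFun) q * F) := by
      rw [mapDerivation_mul, mapDerivation_C, hF, map_mul, map_add, map_one]
      ring
    rw [evalSkew_cons, ← coeff_mapDerivation, ← map_add, ← h1, ih, List.map_cons, List.prod_cons,
      mul_assoc]

theorem evalSkew_coeff_prod {ι : Type*} (s : Finset ι) {w : ι → ℕ →₀ ℕ} (hw : ∀ i ∈ s, w i ≠ 0)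
    (t : ι → Prop) (L : List ℕ+) (m : ℕ →₀ ℕ) :
    evalSkew L (MvPowerSeries.coeff m (∏ i ∈ s, inMonomial (w i) (stripSeries (t i)))) =
      MvPowerSeries.coeff m (L.map fun k : ℕ+ => 1 + ∑ i ∈ s,
        MvPowerSeries.monomial ((k : ℕ) • w i) (stripSign (t i) k)).prod := by
  have h := evalSkew_coeff (F := ∏ i ∈ s, inMonomial (w i) (stripSeries (t i)))
    (a := fun k : ℕ+ => ∑ i ∈ s, MvPowerSeries.monomial ((k : ℕ) • w i) (stripSign (t i) k))
    (fun k => by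
      rw [map_sum]
      exact mapDerivation_prod _ s fun i hi => mapDerivation_stripSeries (t i) k (hw i hi)) ?_ L 1 m
  · rwa [map_one, one_mul, one_mul] at h
  · rw [map_prod]
    refine Finset.prod_eq_one fun i hi => ?_
    rw [map_inMonomial (hw i hi)]
    have h1 : PowerSeries.map (MvPolynomial.constantCoeff : SymFun →+* ℚ) (stripSeries (t i)) = 1 := by
      ext n
      rw [PowerSeries.coeff_map, stripSeries, PowerSeries.coeff_mk, PowerSeries.coeff_one]
      have h2 : MvPolynomial.coeff 0 (complete n) = if n = 0 then 1 else 0 := by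
        rw [coeff_complete]
        simp [partsOf, zeeFinsupp, eq_comm]
      have h3 : MvPolynomial.coeff 0 (elementary n) = if n = 0 then 1 else 0 := by
        rw [coeff_elementary, h2]
        split_ifs with hn
        · simp [hn, partsOf]
        · simp
      rw [MvPolynomial.constantCoeff_eq, stripFun]
      split_ifs <;> simp_all
    rw [h1, inMonomial_one (hw i hi)]

/-- The power series `∑ t^{kn}`. -/
def geometric (k : ℕ+) : PowerSeries ℚ := PowerSeries.mk fun n => if (k : ℕ) ∣ n then 1 else 0

theorem geometric_mul (k : ℕ+) : geometric k * (1 - PowerSeries.X ^ (k : ℕ)) = 1 := by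
  ext n
  rw [mul_sub, mul_one, map_sub, PowerSeries.coeff_mul_X_pow', geometric, PowerSeries.coeff_one]
  simp only [PowerSeries.coeff_mk]
  have hk := k.pos
  by_cases h1 : (k : ℕ) ≤ n
  · have h2 : (k : ℕ) ∣ n - k ↔ (k : ℕ) ∣ n := by
      rw [← Nat.dvd_add_self_right (m := (k : ℕ)) (n := n - k), Nat.sub_add_cancel h1]
    rw [if_pos h1, if_neg (show n ≠ 0 by omega)]
    simp [h2]
  · rw [if_neg h1, sub_zero]
    have h2 : (k : ℕ) ∣ n ↔ n = 0 :=
      ⟨fun h => Nat.eq_zero_of_dvd_of_lt h (not_le.1 h1), fun h => h ▸ dvd_zero _⟩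
    simp [h2]

/-- Each entry `k` of `L` contributes the `k`-th roots of unity as variables, hence one factor `1/(1
- t^k)`. -/
theorem completeSeries_evalRoots (L : List ℕ+) :
    completeSeries (evalRoots L) = (L.map geometric).prod := by
  induction L with
  | nil =>
    refine completeSeries_eq_of_derivative _ (by simp) ?_
    have : powerSeries (evalRoots []) = 0 := by
      ext n
      simp [powerSeries, evalRoots_X]
    simp [this]
  | cons k L ih =>
    rw [List.map_cons, List.prod_cons, ← ih, completeSeries_add (φ₂ := evalRoots L)
      (φ₁ := MvPolynomial.aeval fun j : ℕ+ => if (k : ℕ) ∣ j then ((k : ℕ) : ℚ) else 0)]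
    · refine congrArg (· * completeSeries (evalRoots L)) ?_
      have h := completeSeries_root (A := ℚ)
        (φ := MvPolynomial.aeval fun j : ℕ+ => if (k : ℕ) ∣ j then ((k : ℕ) : ℚ) else 0) k
        fun j => MvPolynomial.aeval_X _ j
      calc _ = completeSeries (MvPolynomial.aeval fun j : ℕ+ =>
              if (k : ℕ) ∣ j then ((k : ℕ) : ℚ) else 0) *
              (geometric k * (1 - PowerSeries.X ^ (k : ℕ))) := by rw [geometric_mul, mul_one]
        _ = completeSeries (MvPolynomial.aeval fun j : ℕ+ =>
              if (k : ℕ) ∣ j then ((k : ℕ) : ℚ) else 0) * (1 - PowerSeries.X ^ (k : ℕ)) *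
              geometric k := by ring
        _ = _ := by rw [h, one_mul]
    · intro j
      simp [evalRoots_X]

theorem elementarySeries_evalRoots (L : List ℕ+) :
    elementarySeries (evalRoots L) =
      (L.map fun k : ℕ+ => (1 - (-PowerSeries.X) ^ (k : ℕ) : PowerSeries ℚ)).prod := by
  induction L with
  | nil =>
    rw [elementarySeries_eq, completeSeries_eq_of_derivative (f := 1)]
    · simp
    · simp
    · have : powerSeries ((evalRoots []).comp negPowerSums) = 0 := by
        ext n
        simp [powerSeries, evalRoots_X, negPowerSums]
      simp [this]
  | cons k L ih =>
    rw [List.map_cons, List.prod_cons, ← ih, elementarySeries_add (φ₂ := evalRoots L)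
      (φ₁ := MvPolynomial.aeval fun j : ℕ+ => if (k : ℕ) ∣ j then ((k : ℕ) : ℚ) else 0)]
    · refine congrArg (· * elementarySeries (evalRoots L)) ?_
      exact elementarySeries_root k fun j => MvPolynomial.aeval_X _ j
    · intro j
      simp [evalRoots_X]

/-- The sum of `∏ h` over the multisets of non-empty multisets with multiset union `c`. -/
noncomputable def blocksComplete (c : Multiset ℕ) : SymFun :=
  MvPowerSeries.coeff (Multiset.toFinsupp c) (∏ B ∈ c.powerset.toFinset.erase 0,
    inMonomial (Multiset.toFinsupp B) (stripSeries True))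

/-- The sum of `∏ h ∏ e` over the multisets of non-empty sets with multiset union `c`, sets of odd
size contributing elementary symmetric functions. -/
noncomputable def blocksElementary (c : Multiset ℕ) : SymFun :=
  MvPowerSeries.coeff (Multiset.toFinsupp c) (∏ S ∈ c.toFinset.powerset.erase ∅,
    inMonomial (Multiset.toFinsupp S.val) (stripSeries (Even S.card)))

theorem evalRoots_prod (L : List ℕ+) (c : Multiset ℕ) {g : ℕ → SymFun} {f : List (PowerSeries ℚ)}
    (hf : (PowerSeries.mk fun n => evalRoots L (g n)) = f.prod) :
    evalRoots L (∏ i ∈ c.toFinset, g (c.count i)) = MvPowerSeries.coeff (Multiset.toFinsupp c)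
      (f.map fun f => ∏ i ∈ c.toFinset, inMonomial (Finsupp.single i 1) f).prod := by
  have h : (f.map fun f => ∏ i ∈ c.toFinset, inMonomial (Finsupp.single i 1) f).prod =
      ∏ i ∈ c.toFinset, inMonomial (Finsupp.single i 1) f.prod := by
    clear hf
    induction f with
    | nil => simp [inMonomial_one]
    | cons a f ih =>
      rw [List.map_cons, List.prod_cons, List.prod_cons, ih, ← Finset.prod_mul_distrib]
      exact Finset.prod_congr rfl fun i _ => (inMonomial_mul (by simp) _ _).symm
  rw [h, coeff_prod_variables (by simp), map_prod, ← hf]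
  simp

/-- For each `k` in `L` one compares `∏ 1/(1 - x_i^k)` with `1 + ∑ x^(kB)`, the `1` being the empty
block. They agree at exponents bounded by `c`, since every `B` with `x^(kB)` in this range lies in
`c`. -/
theorem evalRoots_eq_evalSkew_complete (L : List ℕ+) (c : Multiset ℕ) :
    evalRoots L (∏ i ∈ c.toFinset, complete (c.count i)) = evalSkew L (blocksComplete c) := by
  classical
  rw [evalRoots_prod L c (completeSeries_evalRoots L), blocksComplete,
    evalSkew_coeff_prod _ (fun B hB => by simpa using (Finset.mem_erase.1 hB).1) (fun _ => True),
    List.map_map]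
  refine coeff_list_prod_congr (fun k m hm => ?_) L _ le_rfl
  have hsupp : m.support ⊆ c.toFinset := by
    have := Finsupp.support_mono hm
    simpa using this
  rw [Function.comp_apply, coeff_prod_variables hsupp, map_add, map_sum]
  have h1 (B : Multiset ℕ) : MvPowerSeries.coeff m (MvPowerSeries.monomial
      ((k : ℕ) • Multiset.toFinsupp B) (stripSign True k)) =
        if m = (k : ℕ) • Multiset.toFinsupp B then 1 else 0 := by
    rw [MvPowerSeries.coeff_monomial]
    simp [stripSign]
  have h2 : MvPowerSeries.coeff m (1 : MvPowerSeries ℕ ℚ) =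
      if m = (k : ℕ) • Multiset.toFinsupp (0 : Multiset ℕ) then 1 else 0 := by
    rw [MvPowerSeries.coeff_one]
    simp
  simp only [h1]
  rw [h2, Finset.add_sum_erase (c.powerset.toFinset)
    (fun B => if m = (k : ℕ) • Multiset.toFinsupp B then (1 : ℚ) else 0) (by simp)]
  simp only [geometric, PowerSeries.coeff_mk]
  -- Both coefficients are `1` if all exponents of `m` are divisible by `k`, and `0` otherwise.
  by_cases hk : ∃ B : Multiset ℕ, m = (k : ℕ) • Multiset.toFinsupp B
  · obtain ⟨B, rfl⟩ := hk
    rw [Finset.prod_eq_one fun i _ => if_pos (by simp), Finset.sum_eq_single B]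
    · simp
    · intro B' _ hB'
      refine if_neg fun h => hB' ?_
      have h3 := nsmul_right_injective k.pos.ne' h
      exact (Multiset.toFinsupp.injective h3).symm
    · intro hB
      exfalso
      apply hB
      rw [Multiset.mem_toFinset, Multiset.mem_powerset, Multiset.le_iff_count]
      intro i
      have h4 := hm i
      simp only [Finsupp.smul_apply, Multiset.toFinsupp_apply, smul_eq_mul] at h4
      exact (Nat.le_mul_of_pos_left _ k.pos).trans h4
  · rw [Finset.sum_eq_zero fun B _ => if_neg fun h => hk ⟨B, h⟩]
    by_contra hne
    apply hk
    have h5 : ∀ i, (k : ℕ) ∣ m i := by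
      intro i
      by_contra hi
      by_cases hic : i ∈ c.toFinset
      · exact hne (Finset.prod_eq_zero hic (if_neg hi))
      · apply hi
        rw [Finsupp.notMem_support_iff.1 fun h => hic (hsupp h)]
        exact dvd_zero _
    choose q hq using h5
    refine ⟨Finsupp.toMultiset (Finsupp.mapRange (fun a => a / (k : ℕ)) (by simp) m), ?_⟩
    rw [Finsupp.toMultiset_toFinsupp]
    ext i
    simp [Nat.mul_div_cancel' ⟨q i, hq i⟩]

/-- For each `k` in `L`, expanding `∏ (1 - (-x_i)^k)` gives a sum over sets `S` of letters. Here the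
factors are polynomials and the comparison is exact. -/
theorem evalRoots_eq_evalSkew_elementary (L : List ℕ+) (c : Multiset ℕ) :
    evalRoots L (∏ i ∈ c.toFinset, elementary (c.count i)) = evalSkew L (blocksElementary c) := by
  classical
  rw [evalRoots_prod L c (elementarySeries_evalRoots L), blocksElementary,
    evalSkew_coeff_prod _ (fun S hS => by simpa using (Finset.mem_erase.1 hS).1), List.map_map]
  refine congrArg (MvPowerSeries.coeff (Multiset.toFinsupp c))
    (congrArg List.prod (List.map_congr_left fun k _ => ?_))
  have h1 (i : ℕ) : inMonomial (Finsupp.single i 1) (1 - (-PowerSeries.X) ^ (k : ℕ)) =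
      1 + MvPowerSeries.monomial ((k : ℕ) • Finsupp.single i 1) (-(-1) ^ (k : ℕ) : ℚ) := by
    have hi : Finsupp.single i 1 ≠ 0 := by simp
    have hX : (1 - (-PowerSeries.X) ^ (k : ℕ) : PowerSeries ℚ) =
        1 + PowerSeries.monomial (k : ℕ) (-(-1) ^ (k : ℕ) : ℚ) := by
      ext n
      rw [neg_pow, PowerSeries.X_pow_eq, ← map_one (PowerSeries.C (R := ℚ)), ← map_neg, ← map_pow,
        map_sub, map_add, PowerSeries.coeff_C_mul, PowerSeries.coeff_monomial,
        PowerSeries.coeff_monomial]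
      split_ifs <;> ring
    rw [hX, inMonomial_add hi, inMonomial_one hi, inMonomial_monomial hi]
  have h2 (S : Finset ℕ) : MvPowerSeries.monomial ((k : ℕ) • Multiset.toFinsupp S.val)
      (stripSign (Even S.card) k) =
      ∏ i ∈ S, MvPowerSeries.monomial ((k : ℕ) • Finsupp.single i 1) (-(-1) ^ (k : ℕ) : ℚ) := by
    rw [MvPowerSeries.prod_monomial, Finset.prod_const, ← Finset.smul_sum]
    have hS : Multiset.toFinsupp S.val = ∑ i ∈ S, Finsupp.single i 1 := by
      ext a
      rw [Multiset.toFinsupp_apply, Finsupp.finsetSum_apply]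
      simp [Finsupp.single_apply, Multiset.count_eq_of_nodup S.nodup]
    -- The sign squares to `1`, so its power `|S|` depends only on the parity of `|S|`: it is `1`,
    -- the sign for `h`, or the sign itself, the one for `e`.
    have hc : (-(-1) ^ (k : ℕ) : ℚ) * -(-1) ^ (k : ℕ) = 1 := by
      rw [neg_mul_neg, ← mul_pow]
      simp
    rw [hS]
    congr 1
    rw [stripSign]
    split_ifs with hE
    · obtain ⟨r, hr⟩ := hE
      rw [hr, pow_add, ← mul_pow, hc, one_pow]
    · obtain ⟨r, hr⟩ := Nat.not_even_iff_odd.1 hE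
      rw [hr, pow_succ, pow_mul, sq, hc, one_pow, one_mul]
  have h3 : (1 : MvPowerSeries ℕ ℚ) = ∏ i ∈ (∅ : Finset ℕ),
      MvPowerSeries.monomial ((k : ℕ) • Finsupp.single i 1) (-(-1) ^ (k : ℕ) : ℚ) := by simp
  rw [Function.comp_apply]
  simp only [h1, h2]
  rw [Finset.prod_one_add]
  conv_rhs => rw [h3]
  exact (Finset.add_sum_erase c.toFinset.powerset (fun S => ∏ i ∈ S,
    MvPowerSeries.monomial ((k : ℕ) • Finsupp.single i 1) (-(-1) ^ (k : ℕ) : ℚ)) (by simp)).symm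

end SymChar

namespace SymChar
open Finset

/-! ### Spanning and separation -/

theorem X_mem_adjoin_complete (n : ℕ) :
    (MvPolynomial.X n.succPNat : SymFun) ∈ Algebra.adjoin ℚ (Set.range complete) := by
  induction n using Nat.strong_induction_on with
  | _ n ih =>
    have h := newton_complete n
    rw [Finset.sum_range_succ, Nat.sub_self, complete_zero, mul_one] at h
    have h1 : (MvPolynomial.X n.succPNat : SymFun) = ((n + 1 : ℕ) : SymFun) * complete (n + 1) -
        ∑ k ∈ range n, MvPolynomial.X k.succPNat * complete (n - k) := by
      rw [h]
      ring
    rw [h1]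
    refine sub_mem (mul_mem (natCast_mem _ _) (Algebra.subset_adjoin ⟨_, rfl⟩))
      (sum_mem fun k hk => mul_mem (ih k (mem_range.1 hk)) (Algebra.subset_adjoin ⟨_, rfl⟩))

theorem adjoin_complete : Algebra.adjoin ℚ (Set.range complete) = ⊤ := by
  rw [eq_top_iff, ← MvPolynomial.adjoin_range_X]
  refine Algebra.adjoin_le ?_
  rintro _ ⟨k, rfl⟩
  rw [← PNat.succPNat_natPred k]
  exact X_mem_adjoin_complete _

theorem exists_completePart_eq_prod (s : Multiset ℕ) :
    ∃ μ, completePart μ = (s.map complete).prod := by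
  -- A diagram has no rows of length `0`; these factors may be dropped as `h_0 = 1`.
  have hs : ((s.filter (0 < ·)).sort (· ≥ ·)).SortedGE :=
    List.sortedGE_iff_pairwise.2 (Multiset.pairwise_sort _ _)
  refine ⟨YoungDiagram.ofRowLens _ hs, ?_⟩
  rw [completePart, YoungDiagram.rowLens_ofRowLens_eq_self (by simp +contextual)]
  rw [← Multiset.prod_coe, ← Multiset.map_coe, Multiset.sort_eq]
  conv_rhs => rw [← Multiset.filter_add_not (0 < ·) s, Multiset.map_add, Multiset.prod_add]
  rw [Multiset.prod_eq_one (s := Multiset.map complete (s.filter fun a => ¬0 < a)), mul_one]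
  intro x hx
  obtain ⟨i, hi, rfl⟩ := Multiset.mem_map.1 hx
  rw [Multiset.mem_filter] at hi
  rw [show i = 0 by omega, complete_zero]

theorem span_completePart : Submodule.span ℚ (Set.range completePart) = ⊤ := by
  have h : (⊤ : Submodule ℚ SymFun) =
      Submodule.span ℚ (Submonoid.closure (Set.range complete) : Set SymFun) := by
    rw [← Algebra.adjoin_eq_span, adjoin_complete]
    rfl
  rw [eq_top_iff, h]
  refine Submodule.span_mono fun f hf => ?_
  obtain ⟨l, hl, rfl⟩ := Submonoid.exists_multiset_of_mem_closure hf
  have : ∃ s : Multiset ℕ, s.map complete = l := by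
    choose! g hg using hl
    refine ⟨l.map g, ?_⟩
    rw [Multiset.map_map]
    conv_rhs => rw [← Multiset.map_id l]
    exact Multiset.map_congr rfl fun x hx => hg x hx
  obtain ⟨s, rfl⟩ := this
  exact exists_completePart_eq_prod s

/-- The homomorphism `p_j ↦ ∑_{d ∣ j} d x_d`. -/
noncomputable def rootsHom : SymFun →ₐ[ℚ] MvPolynomial ℕ+ ℚ :=
  MvPolynomial.aeval fun j => ∑ d ∈ (j : ℕ).divisors, (d : ℚ) • MvPolynomial.X d.toPNat'

/-- The images of the variables under the inverse of `rootsHom`. -/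
noncomputable def rootsInv (n : ℕ) : SymFun :=
  (n : ℚ)⁻¹ • (powerSum n - ∑ d : n.properDivisors, (d : ℚ) • rootsInv d)
termination_by n
decreasing_by exact (Nat.mem_properDivisors.1 d.2).2

/-- The substitution is triangular along divisibility with diagonal coefficients `j ≠ 0`, and
`rootsInv` solves it recursively for the variables `x_d`. -/
theorem rootsHom_injective : Function.Injective rootsHom := by
  have h : (MvPolynomial.aeval fun k : ℕ+ => rootsInv k : MvPolynomial ℕ+ ℚ →ₐ[ℚ] SymFun).comp
      rootsHom = AlgHom.id ℚ SymFun := by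
    refine MvPolynomial.algHom_ext fun j => ?_
    simp only [AlgHom.comp_apply, rootsHom, MvPolynomial.aeval_X, map_sum, map_smul, AlgHom.id_apply]
    have h1 : ∀ d ∈ (j : ℕ).divisors, (d : ℚ) • rootsInv (d.toPNat' : ℕ+) =
        (d : ℚ) • rootsInv d := by
      intro d hd
      have := Nat.pos_of_mem_divisors hd
      rw [Nat.toPNat'_coe, if_pos this]
    rw [Finset.sum_congr rfl h1, ← Nat.cons_self_properDivisors j.pos.ne', Finset.sum_cons]
    have hj : ((j : ℕ) : ℚ) ≠ 0 := by
      have := j.pos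
      positivity
    rw [rootsInv, smul_smul, mul_inv_cancel₀ hj, one_smul, powerSum_coe,
      Finset.sum_coe_sort ((j : ℕ).properDivisors) (fun d => (d : ℚ) • rootsInv d)]
    ring
  generalize (MvPolynomial.aeval fun k : ℕ+ => rootsInv k : MvPolynomial ℕ+ ℚ →ₐ[ℚ] SymFun) = ψ at h
  intro f g hfg
  have h2 := congrArg ψ hfg
  rwa [← AlgHom.comp_apply, ← AlgHom.comp_apply, h] at h2

/-- In the coordinates `x_d`, a cycle type is the point whose coordinates are its numbers of cycles
of each length. -/
theorem evalRoots_eq_eval (L : List ℕ+) (f : SymFun) :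
    evalRoots L f = MvPolynomial.eval (fun k => (L.count k : ℚ)) (rootsHom f) := by
  have h : evalRoots L =
      (MvPolynomial.aeval fun k => (L.count k : ℚ) : MvPolynomial ℕ+ ℚ →ₐ[ℚ] ℚ).comp rootsHom := by
    refine MvPolynomial.algHom_ext fun j => ?_
    simp only [AlgHom.comp_apply, rootsHom, MvPolynomial.aeval_X, map_sum, map_smul, evalRoots_X]
    induction L with
    | nil => simp
    | cons k L ih =>
      rw [List.map_cons, List.sum_cons, ih]
      have h1 : ∀ d ∈ (j : ℕ).divisors, (d : ℚ) • ((List.count d.toPNat' (k :: L) : ℕ) : ℚ) =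
          (if d = k then ((k : ℕ) : ℚ) else 0) + (d : ℚ) • ((List.count d.toPNat' L : ℕ) : ℚ) := by
        intro d hd
        have hd0 := Nat.pos_of_mem_divisors hd
        have h2 : k = d.toPNat' ↔ d = k := by
          rw [← PNat.coe_inj, Nat.toPNat'_coe, if_pos hd0, eq_comm]
        rw [List.count_cons]
        simp only [beq_iff_eq, h2, smul_eq_mul]
        split_ifs with h3
        · rw [h3]
          push_cast
          ring
        · simp
      rw [Finset.sum_congr rfl h1, Finset.sum_add_distrib, Finset.sum_ite_eq']
      simp
  rw [h]
  rfl

/-- Cycle types supply all points with natural coordinates, and a polynomial over `ℚ` that vanishes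
at all of these is zero. -/
theorem eq_zero_of_evalRoots {f : SymFun} (h : ∀ L, evalRoots L f = 0) : f = 0 := by
  apply rootsHom_injective
  rw [map_zero]
  refine MvPolynomial.funext_set (fun _ => Set.range ((↑) : ℕ → ℚ))
    (fun _ => Set.infinite_range_of_injective Nat.cast_injective) fun x hx => ?_
  rw [map_zero]
  have hx' : ∀ k, ∃ n : ℕ, (n : ℚ) = x k := fun k => hx k trivial
  choose n hn using hx'
  classical
  -- A list has finitely many entries, so only the coordinates of variables occurring in the
  -- polynomial are matched.
  set L : List ℕ+ := (∑ k ∈ (rootsHom f).vars, Multiset.replicate (n k) k).toList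
  have hL : ∀ k ∈ (rootsHom f).vars, (L.count k : ℚ) = x k := by
    intro k hk
    rw [← hn, ← Multiset.coe_count, Multiset.coe_toList, Multiset.count_sum']
    simp only [Multiset.count_replicate]
    rw [Finset.sum_ite_eq' (rootsHom f).vars k, if_pos hk]
  rw [← h L, evalRoots_eq_eval]
  refine MvPolynomial.eval₂Hom_congr' rfl (fun k hk _ => (hL k hk).symm) rfl

/-! ### The linear map sending `h_μ` to `h̃_μ` on elementary symmetric functions -/

theorem prod_count_content {M : Type*} [CommMonoid M] (g : ℕ → M) (μ : YoungDiagram) :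
    ∏ i ∈ (content μ).toFinset, g ((content μ).count i) =
      ∏ k ∈ range (μ.colLen 0), g (μ.rowLen k) := by
  have h : (content μ).toFinset = (range (μ.colLen 0)).map (addRightEmbedding 1) := by
    ext i
    simp only [Multiset.mem_toFinset, content, Multiset.mem_sum, Multiset.mem_replicate, mem_map,
      addRightEmbedding_apply, mem_range]
    constructor
    · rintro ⟨k, hk, -, rfl⟩
      exact ⟨k, hk, rfl⟩
    · rintro ⟨k, hk, rfl⟩
      exact ⟨k, hk, ((rowLen_pos_iff μ k).2 hk).ne', rfl⟩
  rw [h, Finset.prod_map]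
  exact Finset.prod_congr rfl fun k _ => by rw [addRightEmbedding_apply, count_content]

theorem completePart_mTilde (π : Multiset (Multiset ℕ)) :
    completePart (mTilde π) = ∏ B ∈ π.toFinset, complete (π.count B) := by
  rw [completePart, mTilde, YoungDiagram.rowLens_ofRowLens_eq_self]
  · rw [← Multiset.prod_coe, ← Multiset.map_coe, Multiset.sort_eq, Multiset.map_map]
    rfl
  · intro x hx
    rw [Multiset.mem_sort, Multiset.mem_map] at hx
    obtain ⟨B, hB, rfl⟩ := hx
    rw [Multiset.mem_dedup] at hB
    exact Multiset.count_pos.2 hB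

instance (c : Multiset ℕ) : Finite {π // IsMultisetPartition π c} :=
  (finite_multisetPartitions c).to_subtype

theorem bijOn_toFinsupp (c : Multiset ℕ) :
    Set.BijOn (Multiset.toFinsupp : Multiset (Multiset ℕ) ≃+ _) {π | IsMultisetPartition π c}
      (blockSet (c.powerset.toFinset.erase 0) Multiset.toFinsupp (Multiset.toFinsupp c)) := by
  have hsum (π : Multiset (Multiset ℕ)) (hπ : π.toFinset ⊆ c.powerset.toFinset.erase 0) :
      ∑ B ∈ c.powerset.toFinset.erase 0, Multiset.toFinsupp π B • Multiset.toFinsupp B =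
        Multiset.toFinsupp π.sum := by
    rw [Finset.sum_multiset_count_of_subset π _ hπ, map_sum]
    exact Finset.sum_congr rfl fun B _ => by rw [map_nsmul, Multiset.toFinsupp_apply]
  refine ⟨fun π hπ => ?_, Multiset.toFinsupp.injective.injOn, fun p hp => ?_⟩
  · have h1 : π.toFinset ⊆ c.powerset.toFinset.erase 0 := by
      intro B hB
      rw [Multiset.mem_toFinset] at hB
      rw [Finset.mem_erase, Multiset.mem_toFinset, Multiset.mem_powerset]
      refine ⟨fun h => hπ.1 (h ▸ hB), ?_⟩
      rw [← hπ.2]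
      exact Multiset.single_le_sum (fun _ _ => Multiset.zero_le _) _ hB
    exact ⟨h1, by rw [hsum π h1, hπ.2]⟩
  · obtain ⟨π, rfl⟩ := Multiset.toFinsupp.surjective p
    have h1 : π.toFinset ⊆ c.powerset.toFinset.erase 0 := hp.1
    refine ⟨π, ⟨fun h0 => ?_, ?_⟩, rfl⟩
    · exact (Finset.mem_erase.1 (h1 (Multiset.mem_toFinset.2 h0))).1 rfl
    · have h2 := hp.2
      rw [hsum π h1] at h2
      exact Multiset.toFinsupp.injective h2

theorem blocksComplete_eq_finsum (c : Multiset ℕ) : blocksComplete c =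
    ∑ᶠ π : {π // IsMultisetPartition π c}, completePart (mTilde π.1) := by
  rw [blocksComplete, coeff_prod_inMonomial
    (fun B hB => by simpa using (Finset.mem_erase.1 hB).1) (fun _ => stripSeries True)]
  refine Eq.trans (Eq.symm ?_) (finsum_set_coe_eq_finsum_mem
    (f := fun π => completePart (mTilde π)) {π | IsMultisetPartition π c}).symm
  refine finsum_mem_eq_of_bijOn _ (bijOn_toFinsupp c) fun π hπ => ?_
  rw [completePart_mTilde]
  have h1 : π.toFinset ⊆ c.powerset.toFinset.erase 0 := ((bijOn_toFinsupp c).mapsTo hπ).1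
  -- Blocks that do not occur in `π` contribute `h_0 = 1`.
  rw [Finset.prod_subset h1]
  · exact Finset.prod_congr rfl fun B _ => by simp [stripSeries, stripFun]
  · intro B _ hB
    rw [Multiset.mem_toFinset] at hB
    rw [Multiset.count_eq_zero_of_notMem hB, complete_zero]

/-- This is the defining recursion of `h̃`, transported by `charMap h_ν = h̃_ν`. -/
theorem charMap_blocksComplete (μ : YoungDiagram) :
    charMap (blocksComplete (content μ)) = completePart μ := by
  have := Fintype.ofFinite {π // IsMultisetPartition π (content μ)}
  rw [blocksComplete_eq_finsum, completePart_eq_sum_hTilde, finsum_eq_sum_of_fintype,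
    finsum_eq_sum_of_fintype, map_sum]
  exact Finset.sum_congr rfl fun π _ => charMap_completePart _

/-- Both functionals agree on the sum of `h_{m̃(π)}` over all multiset partitions, their common
value being `h_μ` at `L`. In this sum `h_μ` appears once and the other terms belong to smaller
partitions, so the claim follows by induction. -/
theorem evalRoots_charMap_completePart (L : List ℕ+) (μ : YoungDiagram) :
    evalRoots L (charMap (completePart μ)) - evalSkew L (completePart μ) = 0 := by
  induction hn : μ.card using Nat.strong_induction_on generalizing μ with
  | _ n ih =>
    have h : evalRoots L (charMap (blocksComplete (content μ))) -
        evalSkew L (blocksComplete (content μ)) = 0 := by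
      rw [charMap_blocksComplete, ← evalRoots_eq_evalSkew_complete, completePart_eq_prod,
        prod_count_content, sub_self]
    have := Fintype.ofFinite {π // IsMultisetPartition π (content μ)}
    rw [blocksComplete_eq_finsum, finsum_eq_sum_of_fintype, map_sum, map_sum, map_sum,
      ← Finset.sum_sub_distrib] at h
    have h0 : IsMultisetPartition ((content μ).map fun a => {a}) (content μ) := by
      refine ⟨fun h => ?_, Multiset.sum_map_singleton _⟩
      obtain ⟨a, -, ha⟩ := Multiset.mem_map.1 h
      exact Multiset.singleton_ne_zero a ha
    -- Apart from the partition into singletons, every term has fewer than `|μ|` blocks and vanishes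
    -- by induction.
    rw [Finset.sum_eq_single ⟨_, h0⟩] at h
    · rwa [mTilde_singletons] at h
    · intro π _ hπ
      refine ih _ ?_ _ rfl
      rw [← hn]
      refine card_mTilde_lt π.2 fun heq => hπ (Subtype.ext ?_)
      refine (card_le_of_isMultisetPartition π.2).2 ?_
      rw [← card_mTilde, heq, card_content]
    · simp

theorem evalRoots_charMap (L : List ℕ+) (f : SymFun) : evalRoots L (charMap f) = evalSkew L f := by
  have h : (evalRoots L).toLinearMap ∘ₗ charMap = evalSkew L := by
    refine LinearMap.ext_on_range span_completePart fun μ => ?_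
    exact sub_eq_zero.1 (evalRoots_charMap_completePart L μ)
  exact LinearMap.congr_fun h f

/-- At every cycle type `L`, both sides equal `evalSkew L` of the sum over families of sets. -/
theorem elementaryPart_eq_charMap (μ : YoungDiagram) :
    elementaryPart μ = charMap (blocksElementary (content μ)) := by
  rw [← sub_eq_zero]
  refine eq_zero_of_evalRoots fun L => ?_
  rw [map_sub, evalRoots_charMap, elementaryPart_eq_prod,
    ← prod_count_content, evalRoots_eq_evalSkew_elementary,
    sub_self]

end SymChar

namespace SymChar
open Finset

/-! ### Enumerations of blocks -/

/-- An enumeration of the elements of `s` in increasing order by `1, …, size`, with `0` standing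
for the empty set. -/
structure BlockEnum (r : Finset ℕ → Finset ℕ → Prop) (s : Finset (Finset ℕ)) where
  block : ℕ → Finset ℕ
  index : Finset ℕ → ℕ
  size : ℕ
  block_zero : block 0 = ∅
  index_empty : index ∅ = 0
  block_mem : ∀ k < size, block (k + 1) ∈ s
  index_block : ∀ k < size, index (block (k + 1)) = k + 1
  block_index : ∀ S ∈ s, block (index S) = S
  index_pos : ∀ S ∈ s, 0 < index S
  index_le : ∀ S ∈ s, index S ≤ size
  rel_iff : ∀ S ∈ s, ∀ S' ∈ s, r S S' ↔ index S ≤ index S'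

theorem exists_blockEnum (r : Finset ℕ → Finset ℕ → Prop) [IsLinearOrder (Finset ℕ) r]
    (s : Finset (Finset ℕ)) (h0 : ∅ ∉ s) : Nonempty (BlockEnum r s) := by
  classical
  set l := s.sort r
  have hmem (S : Finset ℕ) : S ∈ l ↔ S ∈ s := Finset.mem_sort r
  have hnd : l.Nodup := Finset.sort_nodup s r
  have hsorted : l.Pairwise r := Finset.pairwise_sort s r
  have hle {S S' : Finset ℕ} (hS : S ∈ s) (hS' : S' ∈ s) (h : l.idxOf S ≤ l.idxOf S') : r S S' := by
    have h1 := List.idxOf_lt_length_of_mem ((hmem S).2 hS)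
    have h2 := List.idxOf_lt_length_of_mem ((hmem S').2 hS')
    rcases h.lt_or_eq with h | h
    · have := List.pairwise_iff_getElem.1 hsorted _ _ h1 h2 h
      rwa [List.getElem_idxOf, List.getElem_idxOf] at this
    · rw [(List.idxOf_inj ((hmem S).2 hS)).1 h]
      exact refl_of r S'
  exact ⟨
    { block := fun k => Nat.casesOn k ∅ fun k => l.getD k ∅
      index := fun S => if S ∈ s then l.idxOf S + 1 else 0
      size := l.length
      block_zero := rfl
      index_empty := if_neg h0
      block_mem := fun k hk => by
        rw [← hmem]
        simp only [List.getD_eq_getElem _ _ hk]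
        exact List.getElem_mem hk
      index_block := fun k hk => by
        simp only [List.getD_eq_getElem _ _ hk]
        rw [if_pos ((hmem _).1 (List.getElem_mem hk)), hnd.idxOf_getElem]
      block_index := fun S hS => by
        simp only [if_pos hS]
        have h1 := List.idxOf_lt_length_of_mem ((hmem S).2 hS)
        rw [List.getD_eq_getElem _ _ h1, List.getElem_idxOf]
      index_pos := fun S hS => by
        rw [if_pos hS]
        exact Nat.succ_pos _
      index_le := fun S hS => by
        rw [if_pos hS]
        exact List.idxOf_lt_length_of_mem ((hmem S).2 hS)
      rel_iff := fun S hS S' hS' => by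
        rw [if_pos hS, if_pos hS', Nat.add_le_add_iff_right]
        refine ⟨fun h => ?_, hle hS hS'⟩
        by_contra! hlt
        rw [antisymm_of r h (hle hS' hS hlt.le)] at hlt
        exact lt_irrefl _ hlt }⟩

namespace BlockEnum

variable {r : Finset ℕ → Finset ℕ → Prop} {s : Finset (Finset ℕ)} (E : BlockEnum r s)

theorem exists_index {S : Finset ℕ} (hS : S ∈ s) : ∃ k < E.size, E.index S = k + 1 := by
  have := E.index_pos S hS
  have := E.index_le S hS
  exact ⟨E.index S - 1, by omega, by omega⟩

theorem index_injOn {S S' : Finset ℕ} (hS : S ∈ s) (hS' : S' ∈ s)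
    (h : E.index S = E.index S') : S = S' := by
  rw [← E.block_index S hS, h, E.block_index S' hS']

theorem prod_block {M : Type*} [CommMonoid M] (f : Finset ℕ → M) :
    ∏ S ∈ s, f S = ∏ k ∈ range E.size, f (E.block (k + 1)) := by
  refine (Finset.prod_bij (fun k _ => E.block (k + 1)) ?_ ?_ ?_ ?_).symm
  · exact fun k hk => E.block_mem k (mem_range.1 hk)
  · intro k hk k' hk' h
    have := E.index_block k (mem_range.1 hk)
    rw [h, E.index_block k' (mem_range.1 hk')] at this
    omega
  · intro S hS
    obtain ⟨k, hk, h⟩ := E.exists_index hS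
    exact ⟨k, mem_range.2 hk, by rw [← h, E.block_index S hS]⟩
  · exact fun _ _ => rfl

end BlockEnum

/-! ### Shifting the first row -/

theorem zero_mem_skewCells {lam : YoungDiagram} {j : ℕ} :
    (0, j) ∈ skewCells lam ↔ lam.rowLen 1 ≤ j ∧ j < lam.rowLen 0 := by
  rw [skewCells, mem_filter, YoungDiagram.mem_cells, YoungDiagram.mem_iff_lt_rowLen]
  simp [and_comm]

theorem succ_mem_skewCells {lam : YoungDiagram} {i j : ℕ} :
    (i + 1, j) ∈ skewCells lam ↔ (i + 1, j) ∈ lam := by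
  rw [skewCells, mem_filter, YoungDiagram.mem_cells]
  simp

/-- The first row of `α` arises from the first row of the skew diagram `lam/(lam₂)` by putting `K`
cells in front of it, and the other rows agree. -/
structure Shifted (K : ℕ) (lam α : YoungDiagram) : Prop where
  removeFirst_eq : removeFirst lam = removeFirst α
  rowLen_one_le : lam.rowLen 1 ≤ K
  rowLen_zero : α.rowLen 0 + lam.rowLen 1 = lam.rowLen 0 + K

namespace Shifted

variable {K : ℕ} {lam α : YoungDiagram}

theorem rowLen_succ (h : Shifted K lam α) (i : ℕ) : lam.rowLen (i + 1) = α.rowLen (i + 1) := by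
  rw [← rowLen_removeFirst, h.removeFirst_eq, rowLen_removeFirst]

theorem succ_mem_iff (h : Shifted K lam α) {i j : ℕ} :
    (i + 1, j) ∈ skewCells lam ↔ (i + 1, j) ∈ α := by
  rw [succ_mem_skewCells, ← mem_removeFirst, h.removeFirst_eq, mem_removeFirst]

theorem zero_mem_iff (h : Shifted K lam α) {j : ℕ} :
    (0, j) ∈ skewCells lam ↔ lam.rowLen 1 ≤ j ∧ (0, j + (K - lam.rowLen 1)) ∈ α := by
  rw [zero_mem_skewCells, YoungDiagram.mem_iff_lt_rowLen]
  have := h.rowLen_one_le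
  have := h.rowLen_zero
  omega

theorem zero_mem_iff' (h : Shifted K lam α) {j : ℕ} (hj : K ≤ j) :
    (0, j) ∈ α ↔ (0, j - (K - lam.rowLen 1)) ∈ skewCells lam := by
  rw [zero_mem_skewCells, YoungDiagram.mem_iff_lt_rowLen]
  have := h.rowLen_one_le
  have := h.rowLen_zero
  omega

/-- Moving the first row by `K - λ₂` columns matches the cells of `lam/(λ₂)` with all cells of `α`
but the first `K` of row `0`, where `G` vanishes. -/
theorem sum_skewCells (h : Shifted K lam α) {M : Type*} [AddCommMonoid M] {G G' : ℕ → ℕ → M}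
    (hG : ∀ j < K, G 0 j = 0)
    (hrow : ∀ j, lam.rowLen 1 ≤ j → G' 0 j = G 0 (j + (K - lam.rowLen 1)))
    (hrest : ∀ i j, G' (i + 1) j = G (i + 1) j) :
    ∑ c ∈ skewCells lam, G' c.1 c.2 = ∑ c ∈ α.cells, G c.1 c.2 := by
  classical
  rw [← Finset.sum_filter_add_sum_filter_not α.cells (fun c => c.1 = 0 ∧ c.2 < K),
    Finset.sum_eq_zero (s := α.cells.filter fun c => c.1 = 0 ∧ c.2 < K), zero_add]
  swap
  · rintro ⟨i, j⟩ hc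
    obtain ⟨-, rfl, h2⟩ := mem_filter.1 hc
    exact hG j h2
  have h1 := h.rowLen_one_le
  refine Finset.sum_bij' (fun c _ => (c.1, if c.1 = 0 then c.2 + (K - lam.rowLen 1) else c.2))
    (fun c _ => (c.1, if c.1 = 0 then c.2 - (K - lam.rowLen 1) else c.2)) ?_ ?_ ?_ ?_ ?_
  · rintro ⟨_ | i, j⟩ hc
    · have h2 := h.zero_mem_iff.1 hc
      rw [mem_filter]
      exact ⟨h2.2, by simp; omega⟩
    · rw [mem_filter]
      exact ⟨h.succ_mem_iff.1 hc, by simp⟩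
  · rintro ⟨_ | i, j⟩ hc
    · have h2 := (mem_filter.1 hc)
      exact (h.zero_mem_iff' (by simpa using h2.2)).1 h2.1
    · exact h.succ_mem_iff.2 (mem_filter.1 hc).1
  · rintro ⟨_ | i, j⟩ hc
    · simp
    · simp
  · rintro ⟨_ | i, j⟩ hc
    · have h2 := (mem_filter.1 hc).2
      simp at h2 ⊢
      omega
    · simp
  · rintro ⟨_ | i, j⟩ hc
    · exact hrow j (h.zero_mem_iff.1 hc).1
    · exact hrest i j

end Shifted

namespace Filling

variable {t : ℕ → Prop} {n : ℕ → ℕ} {r : ℕ}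

theorem filter_entry_zero_subset (ht : t 0) (F : Filling t n (r + 1)) :
    ∀ c ∈ F.shape.cells.filter fun c => F.entry c.1 c.2 = 0, c.1 = 0 := by
  rintro ⟨i, j⟩ hc
  rw [mem_filter] at hc
  exact F.fst_eq_zero_of_entry_eq_zero ht hc.1 hc.2

/-- The labels `0` lie in the first row and are weakly smallest, so they form an initial segment of
it; there are `n 0` of them. -/
theorem entry_zero_of_lt (ht : t 0) (F : Filling t n (r + 1)) {j : ℕ} (hj : j < n 0) :
    F.entry 0 j = 0 := by
  by_contra hne
  have hsub : (F.shape.cells.filter fun c => F.entry c.1 c.2 = 0) ⊆ {0} ×ˢ range j := by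
    rintro ⟨i, j'⟩ hc
    have hi := F.filter_entry_zero_subset ht _ hc
    simp only at hi
    subst hi
    rw [mem_filter] at hc
    rw [mem_product, mem_range]
    refine ⟨mem_singleton_self 0, ?_⟩
    by_contra! hlt
    simp only at hlt hc
    rcases hlt.lt_or_eq with h | h
    · have := F.row_weak 0 j j' h hc.1
      omega
    · rw [h] at hne
      exact hne hc.2
  have h1 := Finset.card_le_card hsub
  rw [F.count 0 (Nat.succ_pos r)] at h1
  simp at h1
  omega

theorem lt_of_entry_zero (F : Filling t n (r + 1)) {j : ℕ} (hc : (0, j) ∈ F.shape)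
    (h : F.entry 0 j = 0) : j < n 0 := by
  have hsub : {0} ×ˢ range (j + 1) ⊆ (F.shape.cells.filter fun c => F.entry c.1 c.2 = 0) := by
    rintro ⟨i, j'⟩ hc'
    rw [mem_product, mem_singleton, mem_range] at hc'
    obtain ⟨hi, hj⟩ := hc'
    simp only at hi hj
    subst hi
    rw [mem_filter]
    refine ⟨F.shape.up_left_mem le_rfl (by omega) hc, ?_⟩
    rcases (Nat.lt_succ_iff.1 hj).lt_or_eq with h' | h'
    · have := F.row_weak 0 j' j h' hc
      simp only
      omega
    · rw [h']
      exact h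
  have h1 := Finset.card_le_card hsub
  rw [F.count 0 (Nat.succ_pos r)] at h1
  simp at h1
  omega

theorem rowLen_one_le (ht : t 0) (F : Filling t n (r + 1))
    (hn : ∑ k ∈ range r, n (k + 1) ≤ n 0) : F.shape.rowLen 1 ≤ n 0 := by
  have h1 := F.card_shape
  rw [Finset.sum_range_succ'] at h1
  have h2 := F.le_rowLen_zero ht
  have h3 := card_removeFirst F.shape
  have h4 := rowLen_le_card (removeFirst F.shape) 0
  rw [rowLen_removeFirst, zero_add] at h4
  omega

/-- The first row keeps its nonzero labels, now starting in column `λ₂`, which explains the length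
`α_0 - (n 0 - α_1)`. -/
theorem shifted (ht : t 0) (F : Filling t n (r + 1)) (hn : ∑ k ∈ range r, n (k + 1) ≤ n 0) :
    Shifted (n 0) (consRow (F.shape.rowLen 0 - (n 0 - F.shape.rowLen 1)) (removeFirst F.shape))
      F.shape := by
  have h1 := F.rowLen_one_le ht hn
  have h2 := F.le_rowLen_zero ht
  have h3 : (removeFirst F.shape).rowLen 0 ≤ F.shape.rowLen 0 - (n 0 - F.shape.rowLen 1) := by
    rw [rowLen_removeFirst, zero_add]
    omega
  refine ⟨removeFirst_consRow h3, ?_, ?_⟩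
  · rwa [rowLen_consRow_one h3, rowLen_removeFirst]
  · rw [rowLen_consRow_one h3, rowLen_consRow_zero h3, rowLen_removeFirst, zero_add]
    omega

theorem sum_entry (F : Filling t n r) {M : Type*} [AddCommMonoid M] (g : ℕ → M) :
    ∑ c ∈ F.shape.cells, g (F.entry c.1 c.2) = ∑ k ∈ range r, n k • g k := by
  rw [← Finset.sum_fiberwise_of_maps_to (g := fun c => F.entry c.1 c.2) (t := range r)
    (fun c hc => by simpa using F.lt c.1 c.2 hc)]
  refine Finset.sum_congr rfl fun k hk => ?_
  rw [Finset.sum_congr rfl (g := fun _ => g k) fun c hc => by rw [(mem_filter.1 hc).2],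
    Finset.sum_const, F.count k (mem_range.1 hk)]

end Filling
end SymChar

namespace SymChar
open Finset

namespace BlockEnum

variable {r : Finset ℕ → Finset ℕ → Prop} {s : Finset (Finset ℕ)} (E : BlockEnum r s)

theorem block_mem_of_pos {a : ℕ} (h0 : 0 < a) (ha : a ≤ E.size) : E.block a ∈ s := by
  obtain ⟨k, rfl⟩ := Nat.exists_eq_succ_of_ne_zero h0.ne'
  exact E.block_mem k ha

theorem index_block_of_le {a : ℕ} (ha : a ≤ E.size) : E.index (E.block a) = a := by
  rcases a with _ | k
  · rw [E.block_zero, E.index_empty]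
  · exact E.index_block k ha

theorem rel_block {a b : ℕ} (h0 : 0 < a) (hab : a ≤ b) (hb : b ≤ E.size) :
    r (E.block a) (E.block b) := by
  rwa [E.rel_iff _ (E.block_mem_of_pos h0 (hab.trans hb)) _ (E.block_mem_of_pos (h0.trans_le hab) hb),
    E.index_block_of_le (hab.trans hb), E.index_block_of_le hb]

theorem block_inj {a b : ℕ} (ha : a ≤ E.size) (hb : b ≤ E.size) (h : E.block a = E.block b) :
    a = b := by
  rw [← E.index_block_of_le ha, h, E.index_block_of_le hb]

/-- The labels that may be repeated within a row. -/
def RowLabel (k : ℕ) : Prop := Even (E.block k).card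

theorem rowLabel_zero : E.RowLabel 0 := by
  rw [RowLabel, E.block_zero]
  exact Even.zero

/-- The multiset of the elements of a block, as a monomial. -/
noncomputable def weight (k : ℕ) : ℕ →₀ ℕ := Multiset.toFinsupp (E.block (k + 1)).val

end BlockEnum

/-- The non-empty sets of elements of `c`. -/
def blocks (c : Multiset ℕ) : Finset (Finset ℕ) := c.toFinset.powerset.erase ∅

/-- The multiplicities of the labels: `K` for the label `0`, `π k` for the label `k + 1`. -/
def multiplicity (K : ℕ) (π : ℕ →₀ ℕ) : ℕ → ℕ
  | 0 => K
  | k + 1 => π k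

section

variable {r : Finset ℕ → Finset ℕ → Prop} {c : Multiset ℕ} (E : BlockEnum r (blocks c))

/-- The families of multiplicities of the blocks with multiset union `c`. -/
abbrev blockFamilies : Set (ℕ →₀ ℕ) :=
  blockSet (range E.size) E.weight (Multiset.toFinsupp c)

theorem mem_blockFamilies {π : ℕ →₀ ℕ} : π ∈ blockFamilies E ↔ π.support ⊆ range E.size ∧
    ∑ k ∈ range E.size, π k • (E.block (k + 1)).val = c := by
  refine and_congr_right fun _ => ?_
  rw [← Multiset.toFinsupp.injective.eq_iff, map_sum]
  simp only [map_nsmul]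
  rfl

/-- Each block has at least one element. Hence `c.card` labels `0` make the first row long enough
for `charMap_prod`, whatever the family. -/
theorem sum_le_card {π : ℕ →₀ ℕ} (hπ : π ∈ blockFamilies E) :
    ∑ k ∈ range E.size, π k ≤ c.card := by
  conv_rhs => rw [← ((mem_blockFamilies E).1 hπ).2, Multiset.card_sum]
  refine Finset.sum_le_sum fun k hk => ?_
  rw [Multiset.card_nsmul]
  have h1 := (Finset.mem_erase.1 (E.block_mem k (mem_range.1 hk))).1
  exact Nat.le_mul_of_pos_right _ (Finset.card_pos.2 (Finset.nonempty_iff_ne_empty.2 h1))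

theorem weight_ne_zero : ∀ k ∈ range E.size, E.weight k ≠ 0 := by
  intro k hk h
  have h1 := (Finset.mem_erase.1 (E.block_mem k (mem_range.1 hk))).1
  simp [BlockEnum.weight] at h
  exact h1 h

/-- The fillings by the indices of the blocks, together with `c.card` labels `0`. -/
abbrev BlockFilling : Type :=
  Σ π : blockFamilies E, Filling E.RowLabel (multiplicity c.card π.1) (E.size + 1)

instance : Finite (blockFamilies E) := (finite_blockSet (weight_ne_zero E) _).to_subtype

theorem blocksElementary_eq_finsum : blocksElementary c = ∑ᶠ π ∈ blockFamilies E,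
    ∏ k ∈ range E.size, stripFun (E.RowLabel (k + 1)) (π k) := by
  have h1 := E.prod_block fun S => inMonomial (Multiset.toFinsupp S.val) (stripSeries (Even S.card))
  have h2 := coeff_prod_inMonomial (weight_ne_zero E)
    (fun k => stripSeries (E.RowLabel (k + 1))) (Multiset.toFinsupp c)
  rw [blocksElementary]
  refine (congrArg _ h1).trans (h2.trans ?_)
  simp only [stripSeries, PowerSeries.coeff_mk]

theorem charMap_blocksElementary : charMap (blocksElementary c) =
    ∑ᶠ X : BlockFilling E, sTilde (removeFirst X.2.shape) := by
  have := Fintype.ofFinite (blockFamilies E)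
  have (π : blockFamilies E) :=
    Fintype.ofFinite (Filling E.RowLabel (multiplicity c.card π.1) (E.size + 1))
  rw [blocksElementary_eq_finsum E, ← finsum_set_coe_eq_finsum_mem, finsum_eq_sum_of_fintype,
    finsum_eq_sum_of_fintype, Fintype.sum_sigma, map_sum]
  refine Finset.sum_congr rfl fun π _ => ?_
  rw [← finsum_eq_sum_of_fintype]
  exact charMap_prod (n := multiplicity c.card π.1) E.rowLabel_zero (sum_le_card E π.2)

variable {E}

/-- The multiplicities are determined by the entries, so equality in the dependent pair reduces to
equality of shapes and entries. -/
theorem BlockFilling.ext_of_entry {X Y : BlockFilling E} (h1 : X.2.shape = Y.2.shape)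
    (h2 : X.2.entry = Y.2.entry) : X = Y := by
  obtain ⟨⟨π, hπ⟩, F⟩ := X
  obtain ⟨⟨π', hπ'⟩, F'⟩ := Y
  simp only at h1 h2
  have h : π = π' := by
    ext k
    by_cases hk : k < E.size
    · have h3 := F.count (k + 1) (Nat.succ_lt_succ hk)
      rw [h1, h2, F'.count (k + 1) (Nat.succ_lt_succ hk)] at h3
      exact h3.symm
    · have h3 : k ∉ range E.size := by simpa using hk
      rw [Finsupp.notMem_support_iff.1 fun h => h3 (((mem_blockFamilies E).1 hπ).1 h),
        Finsupp.notMem_support_iff.1 fun h => h3 (((mem_blockFamilies E).1 hπ').1 h)]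
  subst h
  rw [Filling.ext h1 h2]

end

/-! ### The bijection with set-valued tableaux -/

namespace Shifted

variable {K : ℕ} {lam α : YoungDiagram}

/-- The column of the cell of `α` that corresponds to the cell `(i, j)` of `lam/(lam₂)`. -/
def col (K : ℕ) (lam : YoungDiagram) (i j : ℕ) : ℕ :=
  if i = 0 then j + (K - lam.rowLen 1) else j

/-- The column of the cell of `lam/(lam₂)` that corresponds to the cell `(i, j)` of `α`. -/
def uncol (K : ℕ) (lam : YoungDiagram) (i j : ℕ) : ℕ :=
  if i = 0 then j - (K - lam.rowLen 1) else j

theorem uncol_col (i j : ℕ) : uncol K lam i (col K lam i j) = j := by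
  unfold uncol col
  split_ifs <;> omega

theorem col_uncol (i j : ℕ) (h : ¬(i = 0 ∧ j < K)) : col K lam i (uncol K lam i j) = j := by
  unfold uncol col
  split_ifs <;> omega

theorem col_lt (i : ℕ) {j j' : ℕ} (h : j < j') : col K lam i j < col K lam i j' := by
  unfold col
  split_ifs <;> omega

theorem col_mem (h : Shifted K lam α) {i j : ℕ} (hc : (i, j) ∈ skewCells lam) :
    (i, col K lam i j) ∈ α := by
  rcases i with _ | i
  · exact (h.zero_mem_iff.1 hc).2
  · exact h.succ_mem_iff.1 hc

theorem le_col (h : Shifted K lam α) {j : ℕ} (hc : (0, j) ∈ skewCells lam) :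
    K ≤ col K lam 0 j := by
  have := (zero_mem_skewCells.1 hc).1
  have := h.rowLen_one_le
  simp only [col, if_pos]
  omega

theorem uncol_mem (h : Shifted K lam α) {i j : ℕ} (hc : (i, j) ∈ α) (h0 : ¬(i = 0 ∧ j < K)) :
    (i, uncol K lam i j) ∈ skewCells lam := by
  rcases i with _ | i
  · exact (h.zero_mem_iff' (by omega)).1 hc
  · exact h.succ_mem_iff.2 hc

/-- The first row of `lam/(λ₂)` starts to the right of all lower rows. Column conditions therefore
never involve it, and its shift is harmless. -/
theorem pos_of_mem_col {i i' j : ℕ} (hi : i < i') (hc : (i, j) ∈ skewCells lam)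
    (hc' : (i', j) ∈ skewCells lam) : i ≠ 0 := by
  rintro rfl
  obtain ⟨k, rfl⟩ := Nat.exists_eq_succ_of_ne_zero hi.ne'
  have h1 := (zero_mem_skewCells.1 hc).1
  have h2 : (1, j) ∈ lam := lam.up_left_mem (by omega) le_rfl (succ_mem_skewCells.1 hc')
  rw [YoungDiagram.mem_iff_lt_rowLen] at h2
  omega

/-- The counterpart for fillings: cells below the first row lie only under labels `0`. -/
theorem lt_of_mem (h : Shifted K lam α) {i j : ℕ} (hc : (i + 1, j) ∈ α) : j < K := by
  have h2 : (1, j) ∈ α := α.up_left_mem (by omega) le_rfl hc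
  rw [YoungDiagram.mem_iff_lt_rowLen, ← h.rowLen_succ 0] at h2
  exact h2.trans_le h.rowLen_one_le

end Shifted

section

variable {r : Finset ℕ → Finset ℕ → Prop} {μ : YoungDiagram}
  {E : BlockEnum r (blocks (content μ))}

/-- The shape of the set-valued tableau. -/
noncomputable def BlockFilling.tableauShape (X : BlockFilling E) : YoungDiagram :=
  consRow (X.2.shape.rowLen 0 - ((content μ).card - X.2.shape.rowLen 1)) (removeFirst X.2.shape)

theorem BlockFilling.shifted (X : BlockFilling E) :
    Shifted (content μ).card X.tableauShape X.2.shape :=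
  X.2.shifted E.rowLabel_zero (sum_le_card E X.1.2)

theorem BlockFilling.entry_pos (X : BlockFilling E) {i j : ℕ}
    (hc : (i, j) ∈ skewCells X.tableauShape) :
    0 < X.2.entry i (Shifted.col (content μ).card X.tableauShape i j) := by
  refine Nat.pos_of_ne_zero fun h => ?_
  have h1 := X.2.fst_eq_zero_of_entry_eq_zero E.rowLabel_zero (X.shifted.col_mem hc) h
  subst h1
  exact (X.2.lt_of_entry_zero (X.shifted.col_mem hc) h).not_ge (X.shifted.le_col hc)

theorem BlockFilling.entry_le (X : BlockFilling E) {i j : ℕ}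
    (hc : (i, j) ∈ skewCells X.tableauShape) :
    X.2.entry i (Shifted.col (content μ).card X.tableauShape i j) ≤ E.size :=
  Nat.lt_succ_iff.1 (X.2.lt _ _ (X.shifted.col_mem hc))

open Classical in
/-- The set-valued tableau of a filling by indices. -/
noncomputable def BlockFilling.toTableau (X : BlockFilling E) : SetTableau r μ where
  shape := X.tableauShape
  entry i j := if (i, j) ∈ skewCells X.tableauShape then
    E.block (X.2.entry i (Shifted.col (content μ).card X.tableauShape i j)) else ∅
  entry_nonempty := fun i j hc => by
    rw [if_pos hc, Finset.nonempty_iff_ne_empty]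
    exact (Finset.mem_erase.1 (E.block_mem_of_pos (X.entry_pos hc) (X.entry_le hc))).1
  entry_eq_empty := fun i j hc => if_neg hc
  row_weak := fun i j₁ j₂ hj h1 h2 => by
    rw [if_pos h1, if_pos h2]
    exact E.rel_block (X.entry_pos h1)
      (X.2.row_weak _ _ _ (Shifted.col_lt i hj) (X.shifted.col_mem h2)) (X.entry_le h2)
  col_weak := fun i₁ i₂ j hi h1 h2 => by
    have h3 := Shifted.pos_of_mem_col hi h1 h2
    have h4 := X.entry_pos h1
    have h5 := X.entry_le h2
    have h6 := X.shifted.col_mem h2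
    simp only [Shifted.col, if_neg h3, if_neg (Nat.ne_zero_of_lt hi)] at h4 h5 h6
    simp only [if_pos h1, if_pos h2, Shifted.col, if_neg h3, if_neg (Nat.ne_zero_of_lt hi)]
    exact E.rel_block h4 (X.2.col_weak _ _ _ hi h6) h5
  row_repeat := fun i j₁ j₂ hj h1 h2 h => by
    rw [if_pos h1] at h ⊢
    rw [if_pos h2] at h
    exact X.2.row_repeat _ _ _ (Shifted.col_lt i hj) (X.shifted.col_mem h2)
      (E.block_inj (X.entry_le h1) (X.entry_le h2) h)
  col_repeat := fun i₁ i₂ j hi h1 h2 h => by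
    have h3 := Shifted.pos_of_mem_col hi h1 h2
    have h4 := X.entry_le h1
    have h5 := X.entry_le h2
    have h6 := X.shifted.col_mem h2
    simp only [Shifted.col, if_neg h3, if_neg (Nat.ne_zero_of_lt hi)] at h4 h5 h6
    simp only [if_pos h1, if_pos h2, Shifted.col, if_neg h3, if_neg (Nat.ne_zero_of_lt hi)] at h ⊢
    rw [← Nat.not_even_iff_odd]
    exact X.2.col_repeat _ _ _ hi h6 (E.block_inj h4 h5 h)
  content_eq := by
    -- The cells labelled `0` carry the empty block and add nothing to the content.
    rw [Finset.sum_congr rfl fun c hc => by rw [if_pos hc],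
      X.shifted.sum_skewCells (G := fun i j => (E.block (X.2.entry i j)).val)
      (G' := fun i j => (E.block (X.2.entry i
        (Shifted.col (content μ).card X.tableauShape i j))).val)
      ?_ ?_ ?_, X.2.sum_entry fun k => (E.block k).val, Finset.sum_range_succ', E.block_zero]
    · refine Eq.trans ?_ ((mem_blockFamilies E).1 X.1.2).2
      simp [multiplicity]
    · intro j hj
      simp only [X.2.entry_zero_of_lt E.rowLabel_zero hj, E.block_zero]
      rfl
    · intro j hj
      rfl
    · intro i j
      rfl

namespace SetTableau

theorem entry_mem (T : SetTableau r μ) {i j : ℕ} (hc : (i, j) ∈ skewCells T.shape) :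
    T.entry i j ∈ blocks (content μ) := by
  rw [blocks, Finset.mem_erase, mem_powerset]
  refine ⟨(T.entry_nonempty i j hc).ne_empty, fun a ha => ?_⟩
  rw [Multiset.mem_toFinset, ← T.content_eq, Multiset.mem_sum]
  exact ⟨(i, j), hc, ha⟩

theorem card_skewCells_le (T : SetTableau r μ) : (skewCells T.shape).card ≤ (content μ).card := by
  rw [← T.content_eq, Multiset.card_sum, Finset.card_eq_sum_ones]
  exact Finset.sum_le_sum fun c hc => Finset.card_pos.2 (T.entry_nonempty c.1 c.2 hc)

/-- The whole second row belongs to the skew shape and each of its cells uses up an element of the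
content. Thus `|μ|` labels `0` suffice to cover the columns of the second row. -/
theorem rowLen_one_le (T : SetTableau r μ) : T.shape.rowLen 1 ≤ (content μ).card := by
  refine le_trans ?_ T.card_skewCells_le
  rw [YoungDiagram.rowLen_eq_card]
  refine Finset.card_le_card ?_
  rintro ⟨i, j⟩ hc
  rw [YoungDiagram.mem_row_iff] at hc
  obtain ⟨h1, h2⟩ := hc
  simp only at h2
  subst h2
  exact succ_mem_skewCells.2 h1

/-- The shape of the filling by indices. -/
noncomputable def fillingShape (T : SetTableau r μ) : YoungDiagram :=
  consRow (T.shape.rowLen 0 + ((content μ).card - T.shape.rowLen 1)) (removeFirst T.shape)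

theorem shifted (T : SetTableau r μ) : Shifted (content μ).card T.shape T.fillingShape := by
  have h1 := T.rowLen_one_le
  have h2 : T.shape.rowLen 1 ≤ T.shape.rowLen 0 := T.shape.rowLen_anti _ _ zero_le_one
  have h3 : (removeFirst T.shape).rowLen 0 ≤
      T.shape.rowLen 0 + ((content μ).card - T.shape.rowLen 1) := by
    rw [rowLen_removeFirst, zero_add]
    omega
  refine ⟨(removeFirst_consRow h3).symm, h1, ?_⟩
  rw [fillingShape, rowLen_consRow_zero h3]
  omega

variable (E)

/-- The multiplicities of the blocks. -/
noncomputable def family (T : SetTableau r μ) : ℕ →₀ ℕ :=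
  Finsupp.onFinset (range E.size)
    (fun k => if k < E.size then
      ((skewCells T.shape).filter fun c => E.index (T.entry c.1 c.2) = k + 1).card else 0)
    fun k hk => by
      by_contra h
      rw [mem_range] at h
      exact hk (if_neg h)

theorem family_apply (T : SetTableau r μ) {k : ℕ} (hk : k < E.size) : T.family E k =
    ((skewCells T.shape).filter fun c => E.index (T.entry c.1 c.2) = k + 1).card :=
  if_pos hk

theorem family_mem (T : SetTableau r μ) : T.family E ∈ blockFamilies E := by
  rw [mem_blockFamilies]
  refine ⟨Finsupp.support_onFinset_subset, ?_⟩
  conv_rhs => rw [← T.content_eq]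
  rw [← Finset.sum_fiberwise_of_maps_to (g := fun c : ℕ × ℕ => E.index (T.entry c.1 c.2) - 1)
    (t := range E.size)]
  · refine Finset.sum_congr rfl fun k hk => ?_
    rw [family_apply E T (mem_range.1 hk), ← Finset.sum_const]
    have h1 : (skewCells T.shape).filter (fun c => E.index (T.entry c.1 c.2) - 1 = k) =
        (skewCells T.shape).filter fun c => E.index (T.entry c.1 c.2) = k + 1 := by
      refine Finset.filter_congr fun c hc => ?_
      have := E.index_pos _ (T.entry_mem hc)
      omega
    rw [h1]
    refine Finset.sum_congr rfl fun c hc => ?_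
    obtain ⟨hc1, hc2⟩ := mem_filter.1 hc
    rw [← hc2, E.block_index _ (T.entry_mem hc1)]
  · intro c hc
    have h1 := E.index_pos _ (T.entry_mem hc)
    have h2 := E.index_le _ (T.entry_mem hc)
    rw [mem_range]
    omega

/-- The index of the set in the cell that corresponds to `(i, j)`, or `0`. -/
noncomputable def label (T : SetTableau r μ) (i j : ℕ) : ℕ :=
  if i = 0 ∧ j < (content μ).card then 0
  else E.index (T.entry i (Shifted.uncol (content μ).card T.shape i j))

variable {E}

theorem label_of_lt (T : SetTableau r μ) {j : ℕ} (hj : j < (content μ).card) :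
    T.label E 0 j = 0 := if_pos ⟨rfl, hj⟩

theorem label_of_not (T : SetTableau r μ) {i j : ℕ} (h0 : ¬(i = 0 ∧ j < (content μ).card)) :
    T.label E i j = E.index (T.entry i (Shifted.uncol (content μ).card T.shape i j)) := if_neg h0

theorem label_pos (T : SetTableau r μ) {i j : ℕ} (hc : (i, j) ∈ T.fillingShape)
    (h0 : ¬(i = 0 ∧ j < (content μ).card)) : 0 < T.label E i j := by
  rw [T.label_of_not h0]
  exact E.index_pos _ (T.entry_mem (T.shifted.uncol_mem hc h0))

theorem label_lt (T : SetTableau r μ) {i j : ℕ} (hc : (i, j) ∈ T.fillingShape) :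
    T.label E i j < E.size + 1 := by
  by_cases h0 : i = 0 ∧ j < (content μ).card
  · rw [label, if_pos h0]
    exact Nat.succ_pos _
  · rw [T.label_of_not h0]
    exact Nat.lt_succ_of_le (E.index_le _ (T.entry_mem (T.shifted.uncol_mem hc h0)))

theorem label_row (T : SetTableau r μ) {i j₁ j₂ : ℕ} (hj : j₁ < j₂)
    (hc : (i, j₂) ∈ T.fillingShape) : T.label E i j₁ ≤ T.label E i j₂ ∧
      (T.label E i j₁ = T.label E i j₂ → E.RowLabel (T.label E i j₁)) := by
  by_cases h0 : i = 0 ∧ j₁ < (content μ).card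
  · rw [label, if_pos h0]
    exact ⟨Nat.zero_le _, fun _ => E.rowLabel_zero⟩
  · have h0' : ¬(i = 0 ∧ j₂ < (content μ).card) := by omega
    have h1 := T.shifted.uncol_mem (T.fillingShape.up_left_mem le_rfl hj.le hc) h0
    have h2 := T.shifted.uncol_mem hc h0'
    have h3 : Shifted.uncol (content μ).card T.shape i j₁ <
        Shifted.uncol (content μ).card T.shape i j₂ := by
      unfold Shifted.uncol
      split_ifs <;> omega
    rw [T.label_of_not h0, T.label_of_not h0', ← E.rel_iff _ (T.entry_mem h1) _ (T.entry_mem h2)]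
    refine ⟨T.row_weak _ _ _ h3 h1 h2, fun h => ?_⟩
    rw [BlockEnum.RowLabel, E.block_index _ (T.entry_mem h1)]
    exact T.row_repeat _ _ _ h3 h1 h2 (E.index_injOn (T.entry_mem h1) (T.entry_mem h2) h)

theorem label_col (T : SetTableau r μ) {i₁ i₂ j : ℕ} (hi : i₁ < i₂)
    (hc : (i₂, j) ∈ T.fillingShape) : T.label E i₁ j ≤ T.label E i₂ j ∧
      (T.label E i₁ j = T.label E i₂ j → ¬E.RowLabel (T.label E i₁ j)) := by
  have h0' : ¬(i₂ = 0 ∧ j < (content μ).card) := by omega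
  by_cases h0 : i₁ = 0 ∧ j < (content μ).card
  · have h1 := T.label_pos (E := E) hc h0'
    rw [label, if_pos h0]
    exact ⟨Nat.zero_le _, fun h => absurd h h1.ne⟩
  -- A cell of the first row beyond the labels `0` has no cell below it.
  · have h3 : i₁ ≠ 0 := by
      obtain ⟨k, rfl⟩ := Nat.exists_eq_succ_of_ne_zero (Nat.ne_zero_of_lt hi)
      have := T.shifted.lt_of_mem hc
      omega
    have h1 := T.shifted.uncol_mem (T.fillingShape.up_left_mem hi.le le_rfl hc) h0
    have h2 := T.shifted.uncol_mem hc h0'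
    rw [T.label_of_not h0, T.label_of_not h0', ← E.rel_iff _ (T.entry_mem h1) _ (T.entry_mem h2),
      BlockEnum.RowLabel, E.block_index _ (T.entry_mem h1)]
    simp only [Shifted.uncol, if_neg h3, if_neg (Nat.ne_zero_of_lt hi)] at h1 h2 ⊢
    refine ⟨T.col_weak _ _ _ hi h1 h2, fun h => ?_⟩
    rw [Nat.not_even_iff_odd]
    exact T.col_repeat _ _ _ hi h1 h2 (E.index_injOn (T.entry_mem h1) (T.entry_mem h2) h)

theorem label_eq_zero_of_notMem (T : SetTableau r μ) {i j : ℕ} (hc : (i, j) ∉ T.fillingShape) :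
    T.label E i j = 0 := by
  by_cases h0 : i = 0 ∧ j < (content μ).card
  · rw [label, if_pos h0]
  · rw [T.label_of_not h0, T.entry_eq_empty, E.index_empty]
    intro h
    have h1 := T.shifted.col_mem h
    rw [Shifted.col_uncol i j h0] at h1
    exact hc h1

theorem count_label_zero (T : SetTableau r μ) :
    (T.fillingShape.cells.filter fun c => T.label E c.1 c.2 = 0).card = (content μ).card := by
  have h1 : (T.fillingShape.cells.filter fun c => T.label E c.1 c.2 = 0) =
      {0} ×ˢ range (content μ).card := by
    ext ⟨i, j⟩
    rw [mem_filter, mem_product, mem_singleton, mem_range]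
    constructor
    · rintro ⟨h1, h2⟩
      by_contra h0
      exact (T.label_pos h1 h0).ne' h2
    · rintro ⟨h1, h2⟩
      simp only at h1 h2
      subst h1
      refine ⟨?_, T.label_of_lt h2⟩
      rw [YoungDiagram.mem_cells, YoungDiagram.mem_iff_lt_rowLen]
      have h3 := T.shifted.rowLen_zero
      have h4 : T.shape.rowLen 1 ≤ T.shape.rowLen 0 := T.shape.rowLen_anti _ _ zero_le_one
      omega
  rw [h1]
  simp

theorem count_label_succ (T : SetTableau r μ) {k : ℕ} (hk : k < E.size) :
    (T.fillingShape.cells.filter fun c => T.label E c.1 c.2 = k + 1).card = T.family E k := by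
  rw [family_apply E T hk, Finset.card_filter, Finset.card_filter]
  refine (T.shifted.sum_skewCells (G := fun i j => if T.label E i j = k + 1 then 1 else 0)
    (G' := fun i j => if E.index (T.entry i j) = k + 1 then 1 else 0) ?_ ?_ ?_).symm
  · intro j hj
    simp [T.label_of_lt hj]
  · intro j hj
    have h1 : ¬(0 = 0 ∧ j + ((content μ).card - T.shape.rowLen 1) < (content μ).card) := by
      have := T.rowLen_one_le
      omega
    have h2 := Shifted.uncol_col (K := (content μ).card) (lam := T.shape) 0 j
    simp only [Shifted.col, if_true] at h2
    simp only [T.label_of_not h1, h2]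
  · intro i j
    have h1 : ¬(i + 1 = 0 ∧ j < (content μ).card) := by omega
    simp only [T.label_of_not h1]
    rfl

variable (E)

/-- The filling by indices of a set-valued tableau. -/
noncomputable def toFilling (T : SetTableau r μ) : BlockFilling E :=
  ⟨⟨T.family E, T.family_mem E⟩,
    { shape := T.fillingShape
      entry := T.label E
      row_weak := fun _ _ _ hj hc => (T.label_row hj hc).1
      row_repeat := fun _ _ _ hj hc => (T.label_row hj hc).2
      col_weak := fun _ _ _ hi hc => (T.label_col hi hc).1
      col_repeat := fun _ _ _ hi hc => (T.label_col hi hc).2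
      zeros := fun _ _ hc => T.label_eq_zero_of_notMem hc
      lt := fun _ _ hc => T.label_lt hc
      count := fun k hk => by
        rcases k with _ | k
        · exact T.count_label_zero
        · exact T.count_label_succ (Nat.lt_of_succ_lt_succ hk) }⟩

end SetTableau

/-- Together with `right_unique` this shows that each of the two shapes determines the other, which
settles the shapes in both inverse laws of the bijection. -/
theorem Shifted.left_unique {K : ℕ} {lam lam' α : YoungDiagram} (h : Shifted K lam α)
    (h' : Shifted K lam' α) : lam = lam' := by
  refine rowLen_ext fun i => ?_
  rcases i with _ | i
  · have h1 := h.rowLen_zero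
    have h2 := h'.rowLen_zero
    rw [h.rowLen_succ 0] at h1
    rw [h'.rowLen_succ 0] at h2
    omega
  · rw [h.rowLen_succ, h'.rowLen_succ]

theorem Shifted.right_unique {K : ℕ} {lam α α' : YoungDiagram} (h : Shifted K lam α)
    (h' : Shifted K lam α') : α = α' := by
  refine rowLen_ext fun i => ?_
  rcases i with _ | i
  · have h1 := h.rowLen_zero
    have h2 := h'.rowLen_zero
    omega
  · rw [← h.rowLen_succ, ← h'.rowLen_succ]

variable (E)

/-- Set-valued tableaux correspond to fillings by the indices of the sets. -/
noncomputable def blockFillingEquiv : BlockFilling E ≃ SetTableau r μ where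
  toFun := BlockFilling.toTableau
  invFun := SetTableau.toFilling E
  left_inv X := by
    classical
    have hsh : X.toTableau.fillingShape = X.2.shape := X.toTableau.shifted.right_unique X.shifted
    refine BlockFilling.ext_of_entry hsh ?_
    ext i j
    change X.toTableau.label E i j = X.2.entry i j
    by_cases hc : (i, j) ∈ X.2.shape
    · by_cases h0 : i = 0 ∧ j < (content μ).card
      · obtain ⟨rfl, hj⟩ := h0
        rw [X.toTableau.label_of_lt hj, X.2.entry_zero_of_lt E.rowLabel_zero hj]
      · rw [X.toTableau.label_of_not h0]
        refine (congrArg E.index (if_pos (X.shifted.uncol_mem hc h0))).trans ?_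
        rw [show X.toTableau.shape = X.tableauShape from rfl, Shifted.col_uncol i j h0,
          E.index_block_of_le (Nat.lt_succ_iff.1 (X.2.lt i j hc))]
    · rw [X.2.zeros i j hc]
      exact X.toTableau.label_eq_zero_of_notMem (hsh ▸ hc)
  right_inv T := by
    classical
    have hsh : (T.toFilling E).tableauShape = T.shape :=
      (T.toFilling E).shifted.left_unique T.shifted
    refine SetTableau.ext hsh ?_
    ext1 i
    ext1 j
    by_cases hc : (i, j) ∈ skewCells T.shape
    · refine (if_pos (hsh ▸ hc)).trans ?_
      -- After the shift, a cell of the skew shape lands beyond the labels `0`, so its label is the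
      -- index of its set.
      have h0 : ¬(i = 0 ∧ Shifted.col (content μ).card T.shape i j < (content μ).card) := by
        rintro ⟨rfl, h⟩
        exact (T.shifted.le_col hc).not_gt h
      change E.block (T.label E i (Shifted.col _ (T.toFilling E).tableauShape i j)) = _
      rw [hsh, T.label_of_not h0,
        Shifted.uncol_col, E.block_index _ (T.entry_mem hc)]
    · rw [T.entry_eq_empty i j hc]
      exact if_neg (hsh ▸ hc)

theorem finite_setTableau (E : BlockEnum r (blocks (content μ))) : Finite (SetTableau r μ) :=
  Finite.of_equiv _ (blockFillingEquiv E)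

theorem elementaryPart_eq_finsum (E : BlockEnum r (blocks (content μ))) :
    elementaryPart μ = ∑ᶠ T : SetTableau r μ, sTilde (removeFirst T.shape) := by
  rw [elementaryPart_eq_charMap, charMap_blocksElementary E]
  refine finsum_eq_of_bijective (blockFillingEquiv E) (blockFillingEquiv E).bijective fun X => ?_
  rw [← X.shifted.removeFirst_eq]
  rfl

end

end SymChar

theorem mainTheorem4 (r : Finset ℕ → Finset ℕ → Prop) [IsLinearOrder (Finset ℕ) r]
    (μ : YoungDiagram) :
    Finite (SymChar.SetTableau r μ) ∧
      SymChar.elementaryPart μ =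
        ∑ᶠ T : SymChar.SetTableau r μ, SymChar.sTilde (SymChar.removeFirst T.shape) := by
  obtain ⟨E⟩ := SymChar.exists_blockEnum r (SymChar.blocks (SymChar.content μ))
    (Finset.notMem_erase _ _)
  exact ⟨SymChar.finite_setTableau E, SymChar.elementaryPart_eq_finsum E⟩
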